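/- **Setting.** Work on $\mathbb{T}^2\times\mathbb{R}$ with $\mathbb{T}=\mathbb{R}/2\pi\mathbb{Z}$ and frequencies $\xi=(\xi_h,\xi_3)\in\mathbb{Z}^2\times\mathbb{R}$; $\widehat f$ is the Fourier transform and $d\xi$ is counting measure times Lebesgue measure. Let $\|u\|_{L^2_j}^2=(2\pi)^{-3}\int_{A_j}|\widehat u(\xi)|^2\,d\xi$, where $A_{-1}=\{|\xi|\le 1\}$ and $A_j=\{2^j\le|\xi|\le 2^{j+1}\}$ for $j\ge 0$, and set $$\|u\|_{B^s}=\sum_{j\ge-1}2^{js}\|u\|_{L^2_j},\qquad \|f\|_{\widetilde L^\infty_T(B^s)}=\sum_{j\ge -1}2^{js}\|f\|_{L^\infty([0,T];L^2_j)} .$$ Let $M$ be the horizontal average (restriction of the spectrum to $\xi_h=0$) and $M^\perp=\mathrm{Id}-M$. For a vector field $v=(v^h,v^3)$ write $\bar v=Mv$, $w=M^\perp v$. For $0<\varepsilon\le 1$ let $\Delta_\varepsilon=\partial_1^2+\partial_2^2+\varepsilon^2\partial_3^2$, and for $n\in\mathbb{N}$ let $\mathbb{P}_{n,\varepsilon}$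 be the $L^2$-orthogonal projection onto functions whose spectrum lies in $\{|\xi_h|^2+\varepsilon^2\xi_3^2\le n^2\}$. Let $v_0\in L^2$ be a divergence free vector field, $\bar v_0=Mv_0$, $w_0=M^\perp v_0$, and let $v=\bar v+w$, with pressure $q$, be a solution on $\mathbb{R}^+$ (differentiable in time with values in $L^2$, with spectrum in $\{|\xi_h|^2+\varepsilon^2\xi_3^2\le n^2\}$) of the approximate rescaled system $$\begin{cases}\partial_t w^h-\Delta_\varepsilon w^h+\mathbb{P}_{n,\varepsilon}M^\perp\big(v\cdot\nabla w^h+w^3\partial_3\bar v^h+\nabla^h q\big)=0\\ \partial_t w^3-\Delta_\varepsilon w^3+\mathbb{P}_{n,\varepsilon}M^\perp\big(v\cdot\nabla w^3+\varepsilon^2\partial_3 q\big)=0\\ \partial_t\bar v^h-\varepsilon^2\partial_3^2\bar v^h+\mathbb{P}_{n,\varepsilon}\partial_3M(w^3w^h)=0\\ \operatorname{div}(\bar v+w)=0\\ (\bar v,w)|_{t=0}=\mathbb{P}_{n,\varepsilon}(\bar v_0,w_0).\end{cases}$$ Given $a>0$ and $\lambda>0$, let $\theta$ be the solution on $\mathbb{R}^+$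 of $$\dot\theta(t)=\|w^3_\Phi(t)\|_{B^{7/2}}+\varepsilon\|w^h_\Phi(t)\|_{B^{7/2}},\qquad \theta(0)=0,$$ where $\Phi(t,\xi)=t^{1/2}|\xi_h|+a|\xi_3|-\lambda\theta(t)|\xi_3|$ and $\widehat{f_\Phi}(t,\xi)=e^{\Phi(t,\xi)}\widehat f(t,\xi)$. Let $e^{a|D_3|}$ be the Fourier multiplier with symbol $e^{a|\xi_3|}$. **Proposition 2.1.** There is a universal constant $C$, independent of $a,\varepsilon,n,\lambda,v_0$ and $T$, such that, in this setting, for every $T\ge 0$ with $\theta(T)\le a/\lambda$, $$\theta(T)\le 3\Big(\varepsilon\|e^{a|D_3|}w_0^h\|_{B^{7/2}}+\|e^{a|D_3|}w_0^3\|_{B^{7/2}}\Big)+C\,\|v_\Phi\|_{\widetilde L^\infty_T(B^{7/2})}\,\theta(T)$$ and $$\|w^3_\Phi\|_{\widetilde L^\infty_T(B^{7/2})}\le e^{1/4}\,\|e^{a|D_3|}w_0^3\|_{B^{7/2}}+C\,\|v_\Phi\|_{\widetilde L^\infty_T(B^{7/2})}^2 .$$ -/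

import Mathlib

noncomputable section

namespace RescaledNS

open MeasureTheory Set
open scoped ENNReal

instance factTwoPiPos : Fact (0 < 2 * Real.pi) := ⟨Real.two_pi_pos⟩

/-! ### Physical space, frequency space and the Fourier transform -/

/-- The physical domain `𝕋² × ℝ`, with `𝕋 = ℝ / 2πℤ`; its `volume` is Lebesgue measure
(each circle has length `2π`). -/
abbrev Dom : Type := AddCircle (2 * Real.pi) × AddCircle (2 * Real.pi) × ℝ

/-- The frequency space `ℤ² × ℝ`. -/
abbrev Freq : Type := ℤ × ℤ × ℝ

/-- Vectors with three (velocity) or two (horizontal part) complex components. -/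
abbrev Vec3 : Type := EuclideanSpace ℂ (Fin 3)
abbrev Vec2 : Type := EuclideanSpace ℂ (Fin 2)

/-- The measure `(2π)⁻³ dξ` on `ℤ² × ℝ` (counting measure times Lebesgue measure), for which
the Fourier transform is an isometry from `L²(𝕋² × ℝ)` onto `L²(ℤ² × ℝ)`. -/
def freqMeasure : Measure Freq :=
  ENNReal.ofReal ((2 * Real.pi) ^ (-3 : ℝ)) •
    (Measure.count : Measure ℤ).prod ((Measure.count : Measure ℤ).prod (volume : Measure ℝ))

/-- Square integrable vector fields on `𝕋² × ℝ`, represented by their Fourier transforms. -/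
abbrev Field : Type := Lp Vec3 2 freqMeasure

/-- The three coordinates of a frequency. -/
def coord (j : Fin 3) (ξ : Freq) : ℝ := ![(ξ.1 : ℝ), (ξ.2.1 : ℝ), ξ.2.2] j

/-- `|ξ_h|`. -/
def horNorm (ξ : Freq) : ℝ := √(coord 0 ξ ^ 2 + coord 1 ξ ^ 2)

/-- `|ξ|`. -/
def freqNorm (ξ : Freq) : ℝ := √(coord 0 ξ ^ 2 + coord 1 ξ ^ 2 + coord 2 ξ ^ 2)

/-- `|ξ_ε|² = |ξ_h|² + ε² ξ₃²`, the symbol of `-Δ_ε`. -/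
def epsNormSq (ε : ℝ) (ξ : Freq) : ℝ := coord 0 ξ ^ 2 + coord 1 ξ ^ 2 + ε ^ 2 * coord 2 ξ ^ 2

/-- The character `x ↦ exp (i ξ · x)` of `𝕋² × ℝ`. -/
def character (ξ : Freq) (x : Dom) : ℂ :=
  fourier ξ.1 x.1 * fourier ξ.2.1 x.2.1 * Complex.exp (Complex.I * ((ξ.2.2 * x.2.2 : ℝ) : ℂ))

/-- Inverse Fourier transform (used for spectra that are square integrable with bounded
support, hence integrable). -/
def fourierInv (f : Freq → ℂ) (x : Dom) : ℂ := ∫ ξ, f ξ * character ξ x ∂freqMeasure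

/-- Fourier transform (used for products of two `L²` functions, which are integrable). -/
def fourierTr (g : Dom → ℂ) (ξ : Freq) : ℂ := ∫ x, g x * (starRingEnd ℂ) (character ξ x)

/-! ### Fourier multipliers, written on the Fourier side -/

/-- `∂_j`. -/
def dHat (j : Fin 3) (f : Freq → ℂ) (ξ : Freq) : ℂ := Complex.I * (coord j ξ : ℂ) * f ξ

/-- The horizontal average `M`, that is the restriction of the spectrum to `ξ_h = 0`. -/
def meanHat {E : Type} [Zero E] (f : Freq → E) : Freq → E :=
  indicator {ξ | ξ.1 = 0 ∧ ξ.2.1 = 0} f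

/-- `M^⊥ = Id - M`. -/
def perpHat {E : Type} [Zero E] (f : Freq → E) : Freq → E :=
  indicator {ξ | ξ.1 = 0 ∧ ξ.2.1 = 0}ᶜ f

/-- The Friedrichs projection `ℙ_{n,ε}`, onto the frequencies with `|ξ_ε|² ≤ n²`. -/
def projHat {E : Type} [Zero E] (n : ℕ) (ε : ℝ) (f : Freq → E) : Freq → E :=
  indicator {ξ | epsNormSq ε ξ ≤ (n : ℝ) ^ 2} f

/-- Components, and horizontal part, of the spectrum of a vector field. -/
def comp (i : Fin 3) (u : Freq → Vec3) (ξ : Freq) : ℂ := u ξ i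

def hor (u : Freq → Vec3) (ξ : Freq) : Vec2 := !₂[u ξ 0, u ξ 1]

/-- `div u = 0`. -/
def DivFree (u : Freq → Vec3) : Prop :=
  ∀ᵐ ξ ∂freqMeasure, ∑ j : Fin 3, dHat j (comp j u) ξ = 0

/-! ### The approximate rescaled system -/

/-- The value at `x` of `v · ∇ w^i`, with `w = M^⊥ v`. -/
def advect (v : Freq → Vec3) (i : Fin 3) (x : Dom) : ℂ :=
  ∑ j : Fin 3, fourierInv (comp j v) x * fourierInv (dHat j (comp i (perpHat v))) x

/-- The value at `x` of `w³ ∂₃ v̄^i`, with `w = M^⊥ v` and `v̄ = M v`. -/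
def stretch (v : Freq → Vec3) (i : Fin 3) (x : Dom) : ℂ :=
  fourierInv (comp 2 (perpHat v)) x * fourierInv (dHat 2 (comp i (meanHat v))) x

/-- The value at `x` of `w³ w^i`, with `w = M^⊥ v`. -/
def vertFlux (v : Freq → Vec3) (i : Fin 3) (x : Dom) : ℂ :=
  fourierInv (comp 2 (perpHat v)) x * fourierInv (comp i (perpHat v)) x

/-- `v` is a global solution, with pressure `q`, of the Friedrichs approximation of the rescaled
system in the unknowns `w = M^⊥ v` and `v̄ = M v`, with initial data `ℙ_{n,ε} v₀`:
* `∂ₜ w^h - Δ_ε w^h + ℙ_{n,ε} M^⊥ (v · ∇ w^h + w³ ∂₃ v̄^h + ∇^h q) = 0`,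
* `∂ₜ w³ - Δ_ε w³ + ℙ_{n,ε} M^⊥ (v · ∇ w³ + ε² ∂₃ q) = 0`,
* `∂ₜ v̄^h - ε² ∂₃² v̄^h + ℙ_{n,ε} ∂₃ M (w³ w^h) = 0`,
* `div v = 0`.
The field `v` is differentiable in time with values in `L²`, and its spectrum is contained in
`|ξ_ε| ≤ n`. Products are taken in physical space; the equations are equalities between Fourier
transforms. (The third component of `v̄` vanishes because `v` is divergence free.) -/
structure IsApproxSolution (n : ℕ) (ε : ℝ) (v₀ : Field) (v : ℝ → Field) (q : ℝ → Freq → ℂ) :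
    Prop where
  differentiable : DifferentiableOn ℝ v (Ici 0)
  spectrum : ∀ t, 0 ≤ t → (v t : Freq → Vec3) =ᵐ[freqMeasure] projHat n ε (v t)
  horizontal : ∀ t, 0 ≤ t → ∀ i : Fin 3, i ≠ 2 → ∀ᵐ ξ ∂freqMeasure,
    comp i (perpHat (derivWithin v (Ici 0) t : Field)) ξ
      + (epsNormSq ε ξ : ℂ) * comp i (perpHat (v t)) ξ
      + projHat n ε (perpHat (fun ζ =>
          fourierTr (fun x => advect (v t) i x + stretch (v t) i x) ζ + dHat i (q t) ζ)) ξ = 0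
  vertical : ∀ t, 0 ≤ t → ∀ᵐ ξ ∂freqMeasure,
    comp 2 (perpHat (derivWithin v (Ici 0) t : Field)) ξ
      + (epsNormSq ε ξ : ℂ) * comp 2 (perpHat (v t)) ξ
      + projHat n ε (perpHat (fun ζ =>
          fourierTr (fun x => advect (v t) 2 x) ζ + (ε ^ 2 : ℂ) * dHat 2 (q t) ζ)) ξ = 0
  average : ∀ t, 0 ≤ t → ∀ i : Fin 3, i ≠ 2 → ∀ᵐ ξ ∂freqMeasure,
    comp i (meanHat (derivWithin v (Ici 0) t : Field)) ξ
      - (ε ^ 2 : ℂ) * dHat 2 (dHat 2 (comp i (meanHat (v t)))) ξ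
      + projHat n ε (dHat 2 (meanHat (fourierTr (vertFlux (v t) i)))) ξ = 0
  divFree : ∀ t, 0 ≤ t → DivFree (v t)
  initial : (v 0 : Freq → Vec3) =ᵐ[freqMeasure] projHat n ε v₀

/-! ### Besov norms

All norms take values in `[0, ∞]`, so that they are meaningful for every field. -/

/-- The dyadic decomposition: the unit ball (index `j = -1`, here `m = 0`) and the annuli
`2 ^ j ≤ |ξ| ≤ 2 ^ (j + 1)` (index `j ≥ 0`, here `m = j + 1`). -/
def shell : ℕ → Set Freq
  | 0 => {ξ | freqNorm ξ ≤ 1}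
  | j + 1 => {ξ | 2 ^ j ≤ freqNorm ξ ∧ freqNorm ξ ≤ 2 ^ (j + 1)}

/-- The norm of `L²_j`, with `j = m - 1`. -/
def blockNorm {E : Type} [NormedAddCommGroup E] (m : ℕ) (f : Freq → E) : ℝ≥0∞ :=
  eLpNorm f 2 (freqMeasure.restrict (shell m))

/-- The weight `2 ^ (j s)`, with `j = m - 1`. -/
def weight (s : ℝ) (m : ℕ) : ℝ≥0∞ := ENNReal.ofReal ((2 : ℝ) ^ (((m : ℝ) - 1) * s))

/-- The norm of `B^s`. -/
def besovNorm {E : Type} [NormedAddCommGroup E] (s : ℝ) (f : Freq → E) : ℝ≥0∞ :=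
  ∑' m, weight s m * blockNorm m f

/-- The norm of `L̃^∞_T(B^s)`. -/
def tildeNorm {E : Type} [NormedAddCommGroup E] (s T : ℝ) (f : ℝ → Freq → E) : ℝ≥0∞ :=
  ∑' m, weight s m * essSup (fun t => blockNorm m (f t)) (volume.restrict (Icc 0 T))

/-! ### The phase and the loss of analyticity -/

/-- `Φ(t, ξ) = t^{1/2} |ξ_h| + a |ξ₃| - λ θ(t) |ξ₃|`. -/
def phase (a lam : ℝ) (θ : ℝ → ℝ) (t : ℝ) (ξ : Freq) : ℝ :=
  √t * horNorm ξ + a * |coord 2 ξ| - lam * θ t * |coord 2 ξ|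

/-- `e^ψ f` on the Fourier side, for a weight `ψ` depending on the frequency. -/
def expMul {E : Type} [NormedAddCommGroup E] [NormedSpace ℝ E] (ψ : Freq → ℝ) (f : Freq → E)
    (ξ : Freq) : E := Real.exp (ψ ξ) • f ξ

/-- `v_Φ`. -/
def vPhi (a lam : ℝ) (θ : ℝ → ℝ) (v : ℝ → Field) (t : ℝ) : Freq → Vec3 :=
  expMul (phase a lam θ t) (v t)

/-- `w_Φ`, where `w = M^⊥ v`. -/
def wPhi (a lam : ℝ) (θ : ℝ → ℝ) (v : ℝ → Field) (t : ℝ) : Freq → Vec3 :=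
  expMul (phase a lam θ t) (perpHat (v t))

/-- `e^{a |D₃|} w₀`, where `w₀ = M^⊥ v₀`. -/
def wInit (a : ℝ) (v₀ : Field) : Freq → Vec3 :=
  expMul (fun ξ => a * |coord 2 ξ|) (perpHat v₀)

/-- `θ` is the solution on `[0, ∞)` of
`θ' = ‖w³_Φ‖_{B^{7/2}} + ε ‖w^h_Φ‖_{B^{7/2}}`, `θ(0) = 0`.
(The norms are finite for fields with bounded spectrum.) -/
structure IsAnalyticityLoss (a lam ε : ℝ) (v : ℝ → Field) (θ : ℝ → ℝ) : Prop where
  initial : θ 0 = 0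
  ode : ∀ t, 0 ≤ t → HasDerivWithinAt θ
    ((besovNorm (7 / 2) (comp 2 (wPhi a lam θ v t))).toReal
      + ε * (besovNorm (7 / 2) (hor (wPhi a lam θ v t))).toReal) (Ici 0) t

end RescaledNS

end

/-! ### Plancherel and products of Fourier transforms on the line -/

noncomputable section

namespace RescaledNS

open MeasureTheory Set
open scoped ENNReal FourierTransform


/-! Everything happens on the Fourier side. At each time the spectrum of `v` lies in a bounded box,
so its components are in L¹ ∩ L² and products in physical space become convolutions
(`BoxSpec.fourierTr_mul`). Since `v` and `w` are divergence free and `v̄` depends only on `x₃`, the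
nonlinear terms are divergences of products.

The heart is a pointwise bound. Let `r` be the Fourier transform of `∂ₜw - Δ_ε w`. Then `|r³|` and
`ε|r^h|` are at most `36 |ξ_ε|` times a convolution of `|w³| + ε|w^h|` with `|v|`, carrying the
weight `1 + min(|η|, |ξ-η|)` (`NiceField.forcing_le`). Horizontal derivatives cost `|ξ_h| ≤ |ξ_ε|`;
in the horizontal equation, multiplied by `ε`, the vertical derivative costs `ε|ξ₃| ≤ |ξ_ε|`. The
dangerous term is `∂₃(w³w³)`, without any `ε`: it equals `-2 w³ div_h w^h`, and since `|ξ_h| ≥ 1` on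
the spectrum of `w`, the horizontal derivative passes from the factor to the product at the price of
one derivative on the factor of lower frequency. The pressure is eliminated algebraically, because
the residual `r` is divergence free.

The weight `e^Φ` goes through these convolutions because `Φ` is subadditive in `ξ` as long as `λθ ≤
a`. As `θ` is nondecreasing and `√t - √s ≤ √(t-s)`, the weight grows between `s` and `t` by at most
`exp(√(t-s)|ξ_h|)`. The heat factor `exp(-(t-s)|ξ_ε|²)` absorbs both this growth and the factor
`|ξ_ε|`, leaving an integrable kernel in `t-s` (`mul_exp_le_heatKernel`). On the data it leaves a
kernel bounded by `e^{1/4}` with integral at most `3` (`exp_le_initKernel`,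
`lintegral_initKernel_le`).

The convolution acts on `B^{7/2}`: Bernstein costs `3/2` and the weight costs `1`, both on the lower
frequency, and `5/2 ≤ 7/2` (`tsum_weight_lossCoeff_le`). Duhamel's formula on each block
(`IsApproxSolution.block_le`), summed over the blocks, gives a Volterra inequality for `θ'`;
integrating it in time proves the first estimate. Taking the supremum in time on each block before
summing proves the second. -/

theorem fourier_toLp_ae_eq {f : ℝ → ℂ} (h1 : Integrable f) (h2 : MemLp f 2) :
    ((𝓕 (h2.toLp f) : Lp ℂ 2 (volume : Measure ℝ)) : ℝ → ℂ) =ᵐ[volume] 𝓕 f := by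
  have hLI : LocallyIntegrable ((𝓕 (h2.toLp f) : Lp ℂ 2 (volume : Measure ℝ)) : ℝ → ℂ) :=
    (Lp.memLp _).locallyIntegrable (by norm_num)
  have hc : Continuous (𝓕 f) :=
    VectorFourier.fourierIntegral_continuous Real.continuous_fourierChar (by fun_prop) h1
  -- Two locally integrable functions are compared on test functions `φ`: for the distributional
  -- transform as for the integral one, the pairing is `∫ f 𝓕φ`.
  refine ae_eq_of_integral_contDiff_smul_eq hLI hc.locallyIntegrable ?_
  intro g hg hgc
  have hg' : ContDiff ℝ (⊤ : ℕ∞) (fun x => (g x : ℂ)) := Complex.ofRealCLM.contDiff.comp hg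
  have hgc' : HasCompactSupport (fun x => (g x : ℂ)) := hgc.comp_left (g := fun y : ℝ => (y : ℂ)) (by simp)
  let φ : SchwartzMap ℝ ℂ := hgc'.toSchwartzMap hg'
  have hφ : ∀ x, φ x = (g x : ℂ) := fun x => rfl
  have e := congrArg (fun T => T φ) (Lp.fourier_toTemperedDistribution_eq (h2.toLp f))
  simp only [TemperedDistribution.fourier_apply, Lp.toTemperedDistribution_apply] at e
  have e2 : ∫ x, (𝓕 φ) x • (h2.toLp f) x = ∫ x, (𝓕 φ) x • f x := by
    apply integral_congr_ae
    filter_upwards [h2.coeFn_toLp] with x hx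
    rw [hx]
  have e3 : ∫ x, (𝓕 φ) x • f x = ∫ x, φ x • 𝓕 f x := by
    rw [SchwartzMap.fourier_coe]
    simpa using! VectorFourier.integral_fourierIntegral_smul_eq_flip (L := innerₗ ℝ) Real.continuous_fourierChar (by fun_prop) (φ.integrable (μ := volume)) h1
  rw [e2, e3] at e
  simp only [hφ] at e
  simpa [Complex.real_smul] using e.symm


theorem memLp_fourier {f : ℝ → ℂ} (h1 : Integrable f) (h2 : MemLp f 2) :
    MemLp (𝓕 f) 2 :=
  (memLp_congr_ae (fourier_toLp_ae_eq h1 h2)).1 (Lp.memLp _)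

/-- Parseval's identity for `f` and `η ↦ conj (g (z - η))`: reflection, translation and conjugation
turn the second transform into the conjugate of `𝓕 g` times a character, which is what the integrand
on the left needs. -/
theorem integral_fourier_mul_fourier {f g : ℝ → ℂ} (f1 : Integrable f) (f2 : MemLp f 2)
    (g1 : Integrable g) (g2 : MemLp g 2) (z : ℝ) :
    ∫ u, 𝓕 f u * 𝓕 g u * Complex.exp (Complex.I * ((2 * Real.pi * z * u : ℝ) : ℂ))
      = ∫ η, f η * g (z - η) := by
  set h : ℝ → ℂ := fun η => (starRingEnd ℂ) (g (z - η)) with hh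
  have mp : MeasurePreserving (fun η : ℝ => z - η) := Measure.measurePreserving_sub_left volume z
  have h1 : Integrable h := by
    have := (mp.integrable_comp_of_integrable g1)
    exact (Complex.conjLIE.toContinuousLinearEquiv.toContinuousLinearMap).integrable_comp this
  have h2 : MemLp h 2 := by
    have := (g2.comp_measurePreserving mp)
    exact (Complex.conjLIE.toContinuousLinearEquiv.toContinuousLinearMap).comp_memLp' this
  have hF : ∀ u, 𝓕 h u = (starRingEnd ℂ)
      (Complex.exp (Complex.I * ((2 * Real.pi * z * u : ℝ) : ℂ)) * 𝓕 g u) := by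
    intro u
    rw [Real.fourier_real_eq_integral_exp_smul, Real.fourier_real_eq_integral_exp_smul]
    rw [← integral_const_mul, ← integral_conj]
    rw [← integral_sub_left_eq_self _ volume z]
    congr 1
    ext η
    simp only [hh, smul_eq_mul, map_mul, ← Complex.exp_conj, sub_sub_cancel]
    rw [← mul_assoc, ← Complex.exp_add]
    congr 2
    simp [Complex.conj_ofNat]
    ring
  have key := Lp.inner_fourier_eq (h2.toLp h) (f2.toLp f)
  rw [L2.inner_def, L2.inner_def] at key
  have e1 : ∫ u, 𝓕 f u * 𝓕 g u * Complex.exp (Complex.I * ((2 * Real.pi * z * u : ℝ) : ℂ))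
      = ∫ a, inner ℂ ((𝓕 (h2.toLp h) : Lp ℂ 2 (volume : Measure ℝ)) a)
        ((𝓕 (f2.toLp f) : Lp ℂ 2 (volume : Measure ℝ)) a) := by
    apply integral_congr_ae
    filter_upwards [fourier_toLp_ae_eq h1 h2, fourier_toLp_ae_eq f1 f2] with u hu1 hu2
    rw [hu1, hu2, hF]
    simp only [RCLike.inner_apply, starRingEnd_self_apply]
    ring
  have e2 : ∫ η, f η * g (z - η) = ∫ a, inner ℂ (h2.toLp h a) (f2.toLp f a) := by
    apply integral_congr_ae
    filter_upwards [h2.coeFn_toLp, f2.coeFn_toLp] with u hu1 hu2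
    rw [hu1, hu2]
    simp only [RCLike.inner_apply, hh, starRingEnd_self_apply]
  rw [e1, e2, key]

/-- The inverse Fourier transform on the line, without normalization. -/
def lineInv (f : ℝ → ℂ) (y : ℝ) : ℂ := ∫ z, f z * Complex.exp (Complex.I * ((z * y : ℝ) : ℂ))

theorem lineInv_eq (f : ℝ → ℂ) (y : ℝ) : lineInv f y = 𝓕 f ((-(2 * Real.pi)⁻¹) * y) := by
  rw [Real.fourier_real_eq_integral_exp_smul, lineInv]
  congr 1
  ext z
  rw [smul_eq_mul, mul_comm]
  congr 2
  push_cast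
  have : (Real.pi : ℂ) ≠ 0 := by exact_mod_cast Real.pi_ne_zero
  field_simp

theorem memLp_lineInv {f : ℝ → ℂ} (h1 : Integrable f) (h2 : MemLp f 2) :
    MemLp (lineInv f) 2 := by
  have hc : (-(2 * Real.pi)⁻¹ : ℝ) ≠ 0 := neg_ne_zero.2 (inv_ne_zero Real.two_pi_pos.ne')
  have : lineInv f = fun y => 𝓕 f ((-(2 * Real.pi)⁻¹) * y) := funext (lineInv_eq f)
  rw [this]
  have hm := memLp_fourier h1 h2
  have hmap : (volume : Measure ℝ).map (fun y => (-(2 * Real.pi)⁻¹) * y)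
      = ENNReal.ofReal |(-(2 * Real.pi)⁻¹)⁻¹| • volume := Real.map_volume_mul_left hc
  have h3 : MemLp (𝓕 f) 2 ((volume : Measure ℝ).map (fun y => (-(2 * Real.pi)⁻¹) * y)) := by
    rw [hmap]
    exact hm.smul_measure ENNReal.ofReal_ne_top
  exact (memLp_map_measure_iff h3.1 (by fun_prop)).1 h3

/-- The same identity after the substitution `u = -y / 2π`, whose Jacobian is the factor `2π`. -/
theorem integral_lineInv_mul_lineInv {f g : ℝ → ℂ} (f1 : Integrable f) (f2 : MemLp f 2)
    (g1 : Integrable g) (g2 : MemLp g 2) (z : ℝ) :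
    ∫ y, lineInv f y * lineInv g y * Complex.exp (-(Complex.I * ((z * y : ℝ) : ℂ)))
      = 2 * Real.pi * ∫ η, f η * g (z - η) := by
  rw [← integral_fourier_mul_fourier f1 f2 g1 g2 z]
  have hpi : (0:ℝ) < 2 * Real.pi := Real.two_pi_pos
  have := Measure.integral_comp_mul_left (fun u => 𝓕 f u * 𝓕 g u *
    Complex.exp (Complex.I * ((2 * Real.pi * z * u : ℝ) : ℂ))) (-(2 * Real.pi)⁻¹)
  rw [inv_neg, inv_inv, abs_neg, abs_of_pos hpi] at this
  rw [Complex.real_smul] at this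
  push_cast at this ⊢
  rw [← this]
  congr 1
  ext y
  rw [lineInv_eq, lineInv_eq]
  congr 2
  have : (Real.pi : ℂ) ≠ 0 := by exact_mod_cast Real.pi_ne_zero
  field_simp

end RescaledNS

end

/-! ### The frequency measure and functions with bounded spectrum -/

noncomputable section

namespace RescaledNS

open MeasureTheory Set
open scoped ENNReal FourierTransform


/-- The unnormalized product measure on `ℤ² × ℝ`. -/
abbrev prodFreq : Measure Freq :=
  (Measure.count : Measure ℤ).prod ((Measure.count : Measure ℤ).prod (volume : Measure ℝ))

/-- The normalization `(2π)⁻³`. -/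
def normConst : ℝ := (2 * Real.pi) ^ (-3 : ℝ)

theorem normConst_pos : 0 < normConst := Real.rpow_pos_of_pos Real.two_pi_pos _

theorem normConst_mul : normConst * ((2 * Real.pi) * (2 * Real.pi) * (2 * Real.pi)) = 1 := by
  have h : normConst = ((2 * Real.pi) ^ 3)⁻¹ := by
    rw [normConst, Real.rpow_neg Real.two_pi_pos.le]
    norm_cast
  rw [h]
  have := Real.pi_ne_zero
  field_simp

theorem freqMeasure_eq : freqMeasure = ENNReal.ofReal normConst • prodFreq := rfl

theorem ofReal_normConst_ne_zero : ENNReal.ofReal normConst ≠ 0 := by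
  simpa using normConst_pos

instance sFinite_freqMeasure : SFinite freqMeasure := by
  rw [freqMeasure_eq]; infer_instance

instance isAddLeftInvariant_freqMeasure : freqMeasure.IsAddLeftInvariant := by
  rw [freqMeasure_eq]; infer_instance

theorem map_neg_count : Measure.map (fun n : ℤ => -n) Measure.count = Measure.count :=
  Measure.IsNegInvariant.neg_eq_self

instance isNegInvariant_freqMeasure : freqMeasure.IsNegInvariant := by
  constructor
  have hc : MeasurePreserving (fun n : ℤ => -n) Measure.count Measure.count :=
    ⟨measurable_neg, map_neg_count⟩
  have hp : MeasurePreserving (fun ξ : Freq => -ξ) prodFreq prodFreq :=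
    hc.prod (hc.prod (Measure.measurePreserving_neg (volume : Measure ℝ)))
  rw [freqMeasure_eq, Measure.neg_def]
  rw [Measure.map_smul]
  congr 1
  exact hp.map_eq

theorem lintegral_freqMeasure {f : Freq → ℝ≥0∞} (hf : Measurable f) :
    ∫⁻ ξ, f ξ ∂freqMeasure
      = ENNReal.ofReal normConst * ∑' k : ℤ, ∑' l : ℤ, ∫⁻ z, f (k, l, z) := by
  rw [freqMeasure_eq, lintegral_smul_measure, smul_eq_mul, lintegral_prod _ hf.aemeasurable,
    lintegral_count]
  congr 1
  congr 1
  ext k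
  rw [lintegral_prod _ (by fun_prop), lintegral_count]

theorem integrable_prodFreq {f : Freq → ℂ} (hf : Integrable f freqMeasure) :
    Integrable f prodFreq := by
  rw [freqMeasure_eq] at hf
  exact (integrable_smul_measure ofReal_normConst_ne_zero ENNReal.ofReal_ne_top).1 hf

/-- Finitely many horizontal modes turn the integral over `ℤ² × ℝ` into a finite sum of line
integrals, so later exchanges of sums and integrals need no convergence argument. -/
theorem integral_freqMeasure {f : Freq → ℂ} (hf : Integrable f freqMeasure) {S : Finset ℤ}
    (hS : ∀ ξ, f ξ ≠ 0 → ξ.1 ∈ S ∧ ξ.2.1 ∈ S) :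
    ∫ ξ, f ξ ∂freqMeasure
      = normConst * ∑ p ∈ S ×ˢ S, ∫ z, f (p.1, p.2, z) := by
  have hf' := integrable_prodFreq hf
  rw [freqMeasure_eq, integral_smul_measure, ENNReal.toReal_ofReal normConst_pos.le,
    Complex.real_smul, integral_prod _ hf', integral_countable hf'.integral_prod_left]
  congr 1
  have h0 : ∀ k l z, k ∉ S ∨ l ∉ S → f (k, l, z) = 0 := by
    intro k l z h
    by_contra h'
    have := hS _ h'
    tauto
  rw [tsum_eq_sum (s := S), Finset.sum_product]
  · refine Finset.sum_congr rfl fun k hk => ?_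
    have hk' : Integrable (fun y => f (k, y)) (Measure.count.prod volume) :=
      Measure.ae_count_iff.1 hf'.prod_right_ae k
    rw [integral_prod _ hk', integral_countable hk'.integral_prod_left]
    rw [tsum_eq_sum (s := S)]
    · simp
    · intro l hl
      simp [h0 k l _ (Or.inr hl)]
  · intro k hk
    simp [h0 k _ _ (Or.inl hk)]

/-- A square integrable function with spectrum in the box of size `N`. -/
structure BoxSpec (N : ℕ) (f : Freq → ℂ) : Prop where
  meas : Measurable f
  memLp : MemLp f 2 freqMeasure
  supp : ∀ ξ, f ξ ≠ 0 → ∀ j, |coord j ξ| ≤ N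

/-- The frequency box of size `N`. -/
def box (N : ℕ) : Set Freq := {ξ | ∀ j, |coord j ξ| ≤ N}

@[fun_prop] theorem measurable_coord (j : Fin 3) : Measurable (coord j) := by
  fin_cases j
  · exact (measurable_from_top (f := fun k : ℤ => (k : ℝ))).comp measurable_fst
  · exact (measurable_from_top (f := fun k : ℤ => (k : ℝ))).comp measurable_snd.fst
  · exact measurable_snd.snd

theorem measurableSet_box (N : ℕ) : MeasurableSet (box N) := by
  have : box N = ⋂ j, {ξ | |coord j ξ| ≤ N} := by ext; simp [box]
  rw [this]
  exact MeasurableSet.iInter fun j => measurableSet_le (by fun_prop) measurable_const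

theorem int_mem_of_abs_le {k : ℤ} {N : ℕ} (h : |(k : ℝ)| ≤ N) :
    k ∈ Finset.Icc (-(N : ℤ)) N := by
  rw [Finset.mem_Icc]
  have := abs_le.1 h
  constructor
  · exact_mod_cast this.1
  · exact_mod_cast this.2

theorem freqMeasure_box_le (N : ℕ) :
    freqMeasure (box N) ≤ ENNReal.ofReal (normConst * ((2 * N + 1) * (2 * N + 1) * (2 * N))) := by
  have hsub : box N ⊆ ((Finset.Icc (-(N : ℤ)) N : Finset ℤ) : Set ℤ) ×ˢ
      (((Finset.Icc (-(N : ℤ)) N : Finset ℤ) : Set ℤ) ×ˢ Icc (-(N : ℝ)) N) := by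
    intro ξ hξ
    refine ⟨int_mem_of_abs_le (hξ 0), int_mem_of_abs_le (hξ 1), abs_le.1 (hξ 2)⟩
  refine (measure_mono hsub).trans ?_
  rw [freqMeasure_eq, Measure.smul_apply, Measure.prod_prod, Measure.prod_prod,
    Measure.count_apply_finset, Real.volume_Icc, smul_eq_mul, Int.card_Icc,
    ENNReal.ofReal_mul normConst_pos.le, ENNReal.ofReal_mul (by positivity),
    ENNReal.ofReal_mul (by positivity), ← mul_assoc]
  have : ((((N : ℤ) + 1 - -(N : ℤ)).toNat : ℕ) : ℝ≥0∞) = ENNReal.ofReal (2 * N + 1) := by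
    rw [← ENNReal.ofReal_natCast]
    congr 1
    have : ((N : ℤ) + 1 - -(N : ℤ)).toNat = 2 * N + 1 := by omega
    rw [this]; push_cast; ring
  rw [this, ← mul_assoc, mul_assoc (ENNReal.ofReal normConst)]
  apply le_of_eq
  ring_nf

namespace BoxSpec

variable {N : ℕ} {f g : Freq → ℂ}

theorem integrable (h : BoxSpec N f) : Integrable f freqMeasure := by
  have hfin : IsFiniteMeasure (freqMeasure.restrict (box N)) :=
    ⟨by simpa using (freqMeasure_box_le N).trans_lt ENNReal.ofReal_lt_top⟩
  have h1 : Integrable f (freqMeasure.restrict (box N)) :=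
    (h.memLp.restrict (box N)).integrable (by norm_num)
  have h2 : f = (box N).indicator f := by
    ext ξ
    by_cases hξ : ξ ∈ box N
    · simp [hξ]
    · rw [indicator_of_notMem hξ]
      by_contra hne
      exact hξ (h.supp ξ hne)
  rw [h2]
  exact (integrable_indicator_iff (measurableSet_box N)).2 h1

theorem mem_Icc (h : BoxSpec N f) (ξ : Freq) (hξ : f ξ ≠ 0) :
    ξ.1 ∈ Finset.Icc (-(N : ℤ)) N ∧ ξ.2.1 ∈ Finset.Icc (-(N : ℤ)) N :=
  ⟨int_mem_of_abs_le (h.supp ξ hξ 0), int_mem_of_abs_le (h.supp ξ hξ 1)⟩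

theorem memLp_slice (h : BoxSpec N f) (k l : ℤ) : MemLp (fun z : ℝ => f (k, l, z)) 2 := by
  have hm : Measurable (fun z : ℝ => f (k, l, z)) := h.meas.comp (by fun_prop)
  refine ⟨hm.aestronglyMeasurable, ?_⟩
  rw [eLpNorm_lt_top_iff_lintegral_rpow_enorm_lt_top (by norm_num) (by norm_num)]
  have h1 := (eLpNorm_lt_top_iff_lintegral_rpow_enorm_lt_top (by norm_num) (by norm_num)).1
    h.memLp.2
  have hfm := h.meas
  rw [lintegral_freqMeasure (by fun_prop)] at h1
  have h2 := ENNReal.lt_top_of_mul_ne_top_right h1.ne ofReal_normConst_ne_zero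
  refine lt_of_le_of_lt ?_ h2
  exact (ENNReal.le_tsum l).trans
    (ENNReal.le_tsum (f := fun k => ∑' l, ∫⁻ z, ‖f (k, l, z)‖ₑ ^ (2 : ℝ≥0∞).toReal) k)

theorem integrable_slice (h : BoxSpec N f) (k l : ℤ) : Integrable (fun z : ℝ => f (k, l, z)) := by
  have hsl := h.memLp_slice k l
  have h1 : Integrable (fun z : ℝ => f (k, l, z)) (volume.restrict (Icc (-(N : ℝ)) N)) :=
    (hsl.restrict _).integrable (by norm_num)
  have h2 : (fun z : ℝ => f (k, l, z)) = (Icc (-(N : ℝ)) N).indicator (fun z => f (k, l, z)) := by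
    ext z
    by_cases hz : z ∈ Icc (-(N : ℝ)) N
    · simp [hz]
    · rw [indicator_of_notMem hz]
      by_contra hne
      exact hz (abs_le.1 (h.supp _ hne 2))
  rw [h2]
  exact (integrable_indicator_iff measurableSet_Icc).2 h1

theorem fourierInv_eq (h : BoxSpec N f) (x : Dom) :
    fourierInv f x = normConst * ∑ p ∈ Finset.Icc (-(N : ℤ)) N ×ˢ Finset.Icc (-(N : ℤ)) N,
      fourier p.1 x.1 * fourier p.2 x.2.1 * lineInv (fun z => f (p.1, p.2, z)) x.2.2 := by
  have hm : Measurable (fun ξ : Freq => character ξ x) := by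
    unfold character
    refine Measurable.mul (Measurable.mul ?_ ?_) ?_
    · exact (measurable_from_top (f := fun k : ℤ => fourier k x.1)).comp measurable_fst
    · exact (measurable_from_top (f := fun k : ℤ => fourier k x.2.1)).comp measurable_snd.fst
    · fun_prop
  have hn : ∀ ξ : Freq, ‖character ξ x‖ ≤ 1 := by
    intro ξ
    simp [character, fourier_apply, Complex.norm_exp, Circle.norm_coe]
  unfold fourierInv
  rw [integral_freqMeasure (S := Finset.Icc (-(N : ℤ)) N)]
  · congr 1
    refine Finset.sum_congr rfl fun p _ => ?_
    rw [lineInv, ← integral_const_mul]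
    congr 1
    ext z
    simp only [character]
    ring
  · exact h.integrable.mul_bdd (c := 1) hm.aestronglyMeasurable (Filter.Eventually.of_forall hn)
  · intro ξ hξ
    exact h.mem_Icc ξ (left_ne_zero_of_mul hξ)

end BoxSpec

end RescaledNS

end

/-! ### The Fourier transform of a product on `𝕋² × ℝ` -/

noncomputable section

namespace RescaledNS

open MeasureTheory Set
open scoped ENNReal FourierTransform


theorem integral_fourier (n : ℤ) :
    ∫ x : AddCircle (2 * Real.pi), (fourier n x : ℂ) = if n = 0 then 2 * (Real.pi : ℂ) else 0 := by
  have h := congrFun (fourierCoeff_fourier (T := 2 * Real.pi) n) 0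
  rw [fourierCoeff] at h
  simp only [neg_zero, fourier_zero, one_smul] at h
  rw [AddCircle.volume_eq_smul_haarAddCircle, integral_smul_measure, h,
    ENNReal.toReal_ofReal Real.two_pi_pos.le]
  by_cases hn : n = 0
  · subst hn; simp
  · simp [hn, Ne.symm hn]

theorem integrable_fourier (n : ℤ) :
    Integrable (fun x : AddCircle (2 * Real.pi) => (fourier n x : ℂ)) :=
  (map_continuous (fourier n)).integrable_of_hasCompactSupport (HasCompactSupport.of_compactSpace _)

/-- Convolution on the frequency space. -/
def conv (f g : Freq → ℂ) (ξ : Freq) : ℂ := ∫ η, f η * g (ξ - η) ∂freqMeasure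

theorem integrable_tensor (m n : ℤ) {φ : ℝ → ℂ} (hφ : Integrable φ) :
    Integrable (fun x : Dom => (fourier m x.1 : ℂ) * ((fourier n x.2.1 : ℂ) * φ x.2.2)) :=
  (integrable_fourier m).mul_prod ((integrable_fourier n).mul_prod hφ)

theorem integral_tensor (m n : ℤ) (φ : ℝ → ℂ) :
    ∫ x : Dom, (fourier m x.1 : ℂ) * ((fourier n x.2.1 : ℂ) * φ x.2.2)
      = (if m = 0 then 2 * (Real.pi : ℂ) else 0) * ((if n = 0 then 2 * (Real.pi : ℂ) else 0) * ∫ y, φ y) := by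
  have h1 := integral_prod_mul (μ := (volume : Measure (AddCircle (2 * Real.pi))))
    (ν := (volume : Measure (AddCircle (2 * Real.pi) × ℝ)))
    (fun x => (fourier m x : ℂ)) (fun y => (fourier n y.1 : ℂ) * φ y.2)
  have h2 := integral_prod_mul (μ := (volume : Measure (AddCircle (2 * Real.pi))))
    (ν := (volume : Measure ℝ)) (fun x => (fourier n x : ℂ)) φ
  rw [← Measure.volume_eq_prod] at h1 h2
  rw [h1, h2, integral_fourier, integral_fourier]

namespace BoxSpec

variable {N : ℕ} {f g : Freq → ℂ}

theorem integrable_lineInv_mul (hf : BoxSpec N f) (hg : BoxSpec N g) (p q : ℤ × ℤ) :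
    Integrable (fun y => lineInv (fun z => f (p.1, p.2, z)) y
      * lineInv (fun z => g (q.1, q.2, z)) y) :=
  (memLp_lineInv (hf.integrable_slice _ _) (hf.memLp_slice _ _)).integrable_mul
    (memLp_lineInv (hg.integrable_slice _ _) (hg.memLp_slice _ _))

theorem fourierInv_mul_eq (hf : BoxSpec N f) (hg : BoxSpec N g) (x : Dom) :
    fourierInv f x * fourierInv g x
      = (normConst : ℂ) ^ 2 * ∑ p ∈ Finset.Icc (-(N : ℤ)) N ×ˢ Finset.Icc (-(N : ℤ)) N,
        ∑ q ∈ Finset.Icc (-(N : ℤ)) N ×ˢ Finset.Icc (-(N : ℤ)) N,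
        (fourier (p.1 + q.1) x.1 : ℂ) * ((fourier (p.2 + q.2) x.2.1 : ℂ) *
          (lineInv (fun z => f (p.1, p.2, z)) x.2.2
            * lineInv (fun z => g (q.1, q.2, z)) x.2.2)) := by
  rw [hf.fourierInv_eq, hg.fourierInv_eq]
  generalize Finset.Icc (-(N : ℤ)) N ×ˢ Finset.Icc (-(N : ℤ)) N = P
  rw [mul_mul_mul_comm, ← sq, Finset.sum_mul_sum]
  congr 1
  refine Finset.sum_congr rfl fun p _ => Finset.sum_congr rfl fun q _ => ?_
  rw [fourier_add, fourier_add]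
  ring

theorem integrable_mul_fourierInv (hf : BoxSpec N f) (hg : BoxSpec N g) :
    Integrable (fun x => fourierInv f x * fourierInv g x) := by
  rw [funext (hf.fourierInv_mul_eq hg)]
  generalize Finset.Icc (-(N : ℤ)) N ×ˢ Finset.Icc (-(N : ℤ)) N = P
  refine Integrable.const_mul ?_ _
  refine integrable_finsetSum _ fun p _ => integrable_finsetSum _ fun q _ => ?_
  have h1 := hf.integrable_lineInv_mul hg p q
  have h2 := integrable_tensor (p.1 + q.1) (p.2 + q.2) h1
  exact h2

theorem memLp_comp_sub (hg : MemLp g 2 freqMeasure) (ζ : Freq) :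
    MemLp (fun η => g (ζ - η)) 2 freqMeasure :=
  hg.comp_measurePreserving (Measure.measurePreserving_sub_left freqMeasure ζ)

theorem integrable_conv (hf : BoxSpec N f) (hg : BoxSpec N g) (ζ : Freq) :
    Integrable (fun η => f η * g (ζ - η)) freqMeasure :=
  hf.memLp.integrable_mul (memLp_comp_sub hg.memLp ζ)

/-- The Fourier transform of a product is the convolution of the Fourier transforms. -/
theorem fourierTr_mul (hf : BoxSpec N f) (hg : BoxSpec N g) (ζ : Freq) :
    fourierTr (fun x => fourierInv f x * fourierInv g x) ζ = conv f g ζ := by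
  set P := Finset.Icc (-(N : ℤ)) N ×ˢ Finset.Icc (-(N : ℤ)) N with hP
  unfold fourierTr conv
  have hint : ∀ p q : ℤ × ℤ, Integrable (fun y => lineInv (fun z => f (p.1, p.2, z)) y
      * lineInv (fun z => g (q.1, q.2, z)) y * Complex.exp (-(Complex.I * ((ζ.2.2 * y : ℝ) : ℂ)))) := by
    intro p q
    refine (hf.integrable_lineInv_mul hg p q).mul_bdd (c := 1) (by fun_prop) ?_
    refine Filter.Eventually.of_forall fun y => ?_
    rw [Complex.norm_exp]
    simp
  have hx : ∀ x : Dom, fourierInv f x * fourierInv g x * (starRingEnd ℂ) (character ζ x)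
      = (normConst : ℂ) ^ 2 * ∑ p ∈ P, ∑ q ∈ P,
        (fourier (p.1 + q.1 + -ζ.1) x.1 : ℂ) * ((fourier (p.2 + q.2 + -ζ.2.1) x.2.1 : ℂ) *
          (lineInv (fun z => f (p.1, p.2, z)) x.2.2 * lineInv (fun z => g (q.1, q.2, z)) x.2.2
            * Complex.exp (-(Complex.I * ((ζ.2.2 * x.2.2 : ℝ) : ℂ))))) := by
    intro x
    rw [hf.fourierInv_mul_eq hg, mul_assoc, Finset.sum_mul]
    congr 1
    refine Finset.sum_congr rfl fun p _ => ?_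
    rw [Finset.sum_mul]
    refine Finset.sum_congr rfl fun q _ => ?_
    have he : (starRingEnd ℂ) (character ζ x) = fourier (-ζ.1) x.1 * fourier (-ζ.2.1) x.2.1 *
        Complex.exp (-(Complex.I * ((ζ.2.2 * x.2.2 : ℝ) : ℂ))) := by
      rw [character, map_mul, map_mul, fourier_neg, fourier_neg, ← Complex.exp_conj]
      congr 2
      rw [map_mul, Complex.conj_I, Complex.conj_ofReal]
      ring
    rw [he, fourier_add (n := -ζ.1), fourier_add (n := -ζ.2.1)]
    ring
  simp_rw [hx]
  rw [integral_const_mul, integral_finsetSum _ fun p _ => integrable_finsetSum _ fun q _ =>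
    integrable_tensor _ _ (hint p q)]
  rw [integral_freqMeasure (hf.integrable_conv hg ζ) (S := Finset.Icc (-(N : ℤ)) N)
    (fun ξ hξ => hf.mem_Icc ξ (left_ne_zero_of_mul hξ))]
  rw [Finset.mul_sum, Finset.mul_sum]
  refine Finset.sum_congr rfl fun p _ => ?_
  rw [integral_finsetSum _ fun q _ => integrable_tensor _ _ (hint p q)]
  rw [Finset.sum_congr rfl fun q _ => integral_tensor (p.1 + q.1 + -ζ.1) (p.2 + q.2 + -ζ.2.1)
    (fun y => lineInv (fun z => f (p.1, p.2, z)) y * lineInv (fun z => g (q.1, q.2, z)) y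
      * Complex.exp (-(Complex.I * ((ζ.2.2 * y : ℝ) : ℂ))))]
  -- Orthogonality of the characters of the torus: for given `p` only `q = ζ_h - p` survives.
  have hz : ∀ q ∈ P, q ≠ (ζ.1 - p.1, ζ.2.1 - p.2) →
      (if p.1 + q.1 + -ζ.1 = 0 then 2 * (Real.pi : ℂ) else 0) *
      ((if p.2 + q.2 + -ζ.2.1 = 0 then 2 * (Real.pi : ℂ) else 0) *
        ∫ y, lineInv (fun z => f (p.1, p.2, z)) y * lineInv (fun z => g (q.1, q.2, z)) y
            * Complex.exp (-(Complex.I * ((ζ.2.2 * y : ℝ) : ℂ)))) = 0 := by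
    intro q _ hq
    by_cases h1 : p.1 + q.1 + -ζ.1 = 0
    · by_cases h2 : p.2 + q.2 + -ζ.2.1 = 0
      · exact absurd (Prod.ext (by simp; omega) (by simp; omega)) hq
      · simp [h2]
    · simp [h1]
  have hnc : (normConst : ℂ) * ((2 * Real.pi) * (2 * Real.pi) * (2 * Real.pi)) = 1 := by
    exact_mod_cast normConst_mul
  rw [Finset.sum_eq_single _ hz]
  · have h1 : p.1 + (ζ.1 - p.1) + -ζ.1 = 0 := by ring
    have h2 : p.2 + (ζ.2.1 - p.2) + -ζ.2.1 = 0 := by ring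
    simp only [h1, h2, if_true]
    rw [integral_lineInv_mul_lineInv (hf.integrable_slice _ _) (hf.memLp_slice _ _)
      (hg.integrable_slice _ _) (hg.memLp_slice _ _)]
    have : ∀ z : ℝ, ζ - (p.1, p.2, z) = (ζ.1 - p.1, ζ.2.1 - p.2, ζ.2.2 - z) := fun z => rfl
    simp_rw [this]
    -- The two inverse transforms contribute `normConst²` and the three physical integrations
    -- `(2π)³`, which leaves the single `normConst` of the measure in `conv`.
    linear_combination (normConst * ∫ η, f (p.1, p.2, η) * g (ζ.1 - p.1, ζ.2.1 - p.2, ζ.2.2 - η)) * hnc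
  -- If `ζ_h - p` lies outside the index box, the slice of `g` there is zero and both sides vanish.
  · intro hq
    have h0 : ∀ z, g (ζ.1 - p.1, ζ.2.1 - p.2, z) = 0 := by
      intro z
      by_contra hne
      exact hq (Finset.mem_product.2 (hg.mem_Icc _ hne))
    have h00 : lineInv (fun z => g (ζ.1 - p.1, ζ.2.1 - p.2, z)) = 0 := by
      ext y
      simp [lineInv, h0]
    simp [h00]

end BoxSpec

end RescaledNS

end

/-! ### The product estimate in `B^{7/2}` -/

noncomputable section

namespace RescaledNS

open MeasureTheory Set
open scoped ENNReal


/-! ### Square integrals of `[0, ∞]`-valued functions -/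

section Square

variable {α : Type*} [MeasurableSpace α] {ν : Measure α}

theorem eLpNorm_two_sq (f : α → ℝ≥0∞) : eLpNorm f 2 ν ^ 2 = ∫⁻ x, f x ^ 2 ∂ν := by
  rw [eLpNorm_eq_lintegral_rpow_enorm_toReal (by norm_num) (by norm_num), ← ENNReal.rpow_natCast,
    ← ENNReal.rpow_mul]
  simp

theorem eLpNorm_two_le_of_sq_le {f : α → ℝ≥0∞} {c : ℝ≥0∞} (h : ∫⁻ x, f x ^ 2 ∂ν ≤ c ^ 2) :
    eLpNorm f 2 ν ≤ c := by
  rw [← eLpNorm_two_sq] at h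
  exact (ENNReal.pow_le_pow_left_iff (by norm_num)).1 h

theorem lintegral_mul_le_eLpNorm_two {f g : α → ℝ≥0∞} (hf : AEMeasurable f ν)
    (hg : AEMeasurable g ν) : ∫⁻ x, f x * g x ∂ν ≤ eLpNorm f 2 ν * eLpNorm g 2 ν := by
  have := ENNReal.lintegral_mul_le_Lp_mul_Lq ν Real.HolderConjugate.two_two hf hg
  rw [eLpNorm_eq_lintegral_rpow_enorm_toReal (by norm_num) (by norm_num),
    eLpNorm_eq_lintegral_rpow_enorm_toReal (by norm_num) (by norm_num)]
  simpa using this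

/-- Cauchy–Schwarz for `1` and `g` with respect to the measure `f dν`. -/
theorem sq_lintegral_mul_le {f g : α → ℝ≥0∞} (hf : Measurable f) (hg : Measurable g) :
    (∫⁻ x, f x * g x ∂ν) ^ 2 ≤ (∫⁻ x, f x ∂ν) * ∫⁻ x, f x * g x ^ 2 ∂ν := by
  have h := lintegral_mul_le_eLpNorm_two (ν := ν.withDensity f) (f := fun _ => 1) (g := g)
    aemeasurable_const hg.aemeasurable
  have h2 := pow_le_pow_left' h 2
  rw [mul_pow, eLpNorm_two_sq, eLpNorm_two_sq] at h2
  simp only [one_mul, one_pow] at h2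
  rw [lintegral_withDensity_eq_lintegral_mul _ hf hg,
    lintegral_withDensity_eq_lintegral_mul _ hf measurable_const,
    lintegral_withDensity_eq_lintegral_mul _ hf (hg.pow_const 2)] at h2
  simpa using h2

theorem eLpNorm_two_tsum_le {ι : Type*} [Countable ι] {f : ι → α → ℝ≥0∞}
    (hf : ∀ i, Measurable (f i)) :
    eLpNorm (fun x => ∑' i, f i x) 2 ν ≤ ∑' i, eLpNorm (f i) 2 ν := by
  apply eLpNorm_two_le_of_sq_le
  have h : ∀ x, (∑' i, f i x) ^ 2 = ∑' i, ∑' j, f i x * f j x := by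
    intro x
    rw [sq, ← ENNReal.tsum_mul_right]
    simp_rw [ENNReal.tsum_mul_left]
  simp_rw [h]
  rw [lintegral_tsum fun i => by fun_prop, sq, ← ENNReal.tsum_mul_right]
  refine ENNReal.tsum_le_tsum fun i => ?_
  rw [lintegral_tsum fun j => by fun_prop, ← ENNReal.tsum_mul_left]
  exact ENNReal.tsum_le_tsum fun j =>
    lintegral_mul_le_eLpNorm_two (hf i).aemeasurable (hf j).aemeasurable

theorem eLpNorm_two_const_mul (c : ℝ≥0∞) {f : α → ℝ≥0∞} (hf : Measurable f) :
    eLpNorm (fun x => c * f x) 2 ν = c * eLpNorm f 2 ν := by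
  apply (ENNReal.pow_right_strictMono (n := 2) (by norm_num)).injective
  simp only [mul_pow, eLpNorm_two_sq]
  rw [lintegral_const_mul _ (by fun_prop)]

theorem eLpNorm_two_mono {f g : α → ℝ≥0∞} (h : ∀ᵐ x ∂ν, f x ≤ g x) :
    eLpNorm f 2 ν ≤ eLpNorm g 2 ν :=
  eLpNorm_mono_enorm_ae (by simpa using h)

end Square

/-! ### Convolution of nonnegative functions -/

instance isAddRightInvariant_freqMeasure : freqMeasure.IsAddRightInvariant := inferInstance

/-- Convolution of nonnegative functions. -/
def lconv (f g : Freq → ℝ≥0∞) (ξ : Freq) : ℝ≥0∞ := ∫⁻ η, f η * g (ξ - η) ∂freqMeasure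

theorem lconv_comm (f g : Freq → ℝ≥0∞) (ξ : Freq) : lconv f g ξ = lconv g f ξ := by
  unfold lconv
  rw [← lintegral_sub_left_eq_self (fun η => f η * g (ξ - η)) ξ]
  simp_rw [sub_sub_cancel, mul_comm]

@[fun_prop] theorem measurable_lconv {f g : Freq → ℝ≥0∞} (hf : Measurable f) (hg : Measurable g) :
    Measurable (lconv f g) := by
  unfold lconv
  exact Measurable.lintegral_prod_right' (f := fun p : Freq × Freq => f p.2 * g (p.1 - p.2))
    (by fun_prop)

/-- Young's inequality `L¹ * L² ⊆ L²`. -/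
theorem eLpNorm_lconv_le {f g : Freq → ℝ≥0∞} (hf : Measurable f) (hg : Measurable g) :
    eLpNorm (lconv f g) 2 freqMeasure ≤ (∫⁻ η, f η ∂freqMeasure) * eLpNorm g 2 freqMeasure := by
  apply eLpNorm_two_le_of_sq_le
  rw [mul_pow, eLpNorm_two_sq]
  calc ∫⁻ ξ, lconv f g ξ ^ 2 ∂freqMeasure
      ≤ ∫⁻ ξ, (∫⁻ η, f η ∂freqMeasure) * ∫⁻ η, f η * g (ξ - η) ^ 2 ∂freqMeasure ∂freqMeasure :=
        lintegral_mono fun ξ => sq_lintegral_mul_le hf (by fun_prop)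
    _ = (∫⁻ η, f η ∂freqMeasure) *
          ∫⁻ ξ, ∫⁻ η, f η * g (ξ - η) ^ 2 ∂freqMeasure ∂freqMeasure := by
        rw [lintegral_const_mul]
        exact Measurable.lintegral_prod_right'
          (f := fun p : Freq × Freq => f p.2 * g (p.1 - p.2) ^ 2) (by fun_prop)
    _ = (∫⁻ η, f η ∂freqMeasure) ^ 2 * ∫⁻ x, g x ^ 2 ∂freqMeasure := by
        rw [lintegral_lintegral_swap (by fun_prop), sq, mul_assoc]
        congr 1
        rw [← lintegral_mul_const _ hf]
        congr 1
        ext η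
        rw [lintegral_const_mul _ (by fun_prop)]
        congr 1
        exact lintegral_sub_right_eq_self (fun ξ => g ξ ^ 2) η

/-! ### The Euclidean norm of frequencies -/

theorem freqNorm_eq (ξ : Freq) :
    freqNorm ξ = ‖(!₂[coord 0 ξ, coord 1 ξ, coord 2 ξ] : EuclideanSpace ℝ (Fin 3))‖ := by
  rw [EuclideanSpace.norm_eq, freqNorm]
  simp [Fin.sum_univ_three]

theorem horNorm_eq (ξ : Freq) :
    horNorm ξ = ‖(!₂[coord 0 ξ, coord 1 ξ] : EuclideanSpace ℝ (Fin 2))‖ := by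
  rw [EuclideanSpace.norm_eq, horNorm]
  simp [Fin.sum_univ_two]

theorem coord_add (j : Fin 3) (ξ η : Freq) : coord j (ξ + η) = coord j ξ + coord j η := by
  fin_cases j <;> simp [coord]

theorem coord_sub (j : Fin 3) (ξ η : Freq) : coord j (ξ - η) = coord j ξ - coord j η := by
  fin_cases j <;> simp [coord]

theorem freqNorm_add_le (ξ η : Freq) : freqNorm (ξ + η) ≤ freqNorm ξ + freqNorm η := by
  rw [freqNorm_eq, freqNorm_eq, freqNorm_eq]
  refine le_trans (le_of_eq ?_) (norm_add_le _ _)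
  congr 1
  ext i
  fin_cases i <;> simp [coord_add]

theorem horNorm_add_le (ξ η : Freq) : horNorm (ξ + η) ≤ horNorm ξ + horNorm η := by
  rw [horNorm_eq, horNorm_eq, horNorm_eq]
  refine le_trans (le_of_eq ?_) (norm_add_le _ _)
  congr 1
  ext i
  fin_cases i <;> simp [coord_add]

theorem freqNorm_nonneg (ξ : Freq) : 0 ≤ freqNorm ξ := Real.sqrt_nonneg _

theorem horNorm_nonneg (ξ : Freq) : 0 ≤ horNorm ξ := Real.sqrt_nonneg _

theorem horNorm_le_freqNorm (ξ : Freq) : horNorm ξ ≤ freqNorm ξ :=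
  Real.sqrt_le_sqrt (by nlinarith [sq_nonneg (coord 2 ξ)])

theorem abs_coord_le_freqNorm (j : Fin 3) (ξ : Freq) : |coord j ξ| ≤ freqNorm ξ := by
  apply Real.abs_le_sqrt
  fin_cases j <;> simp <;> nlinarith [sq_nonneg (coord 0 ξ), sq_nonneg (coord 1 ξ),
    sq_nonneg (coord 2 ξ)]

@[fun_prop] theorem measurable_freqNorm : Measurable freqNorm := by
  unfold freqNorm; fun_prop

@[fun_prop] theorem measurable_horNorm : Measurable horNorm := by
  unfold horNorm; fun_prop

/-! ### Dyadic shells -/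

theorem measurableSet_shell (m : ℕ) : MeasurableSet (shell m) := by
  cases m with
  | zero => exact measurableSet_le measurable_freqNorm measurable_const
  | succ j =>
    exact (measurableSet_le measurable_const measurable_freqNorm).inter
      (measurableSet_le measurable_freqNorm measurable_const)

theorem freqNorm_le_of_mem_shell {m : ℕ} {ξ : Freq} (h : ξ ∈ shell m) : freqNorm ξ ≤ 2 ^ m := by
  cases m with
  | zero => simpa [shell] using h
  | succ j => exact h.2

theorem two_pow_le_of_mem_shell {m : ℕ} {ξ : Freq} (h : ξ ∈ shell m) :
    2 ^ m ≤ 2 * max 1 (freqNorm ξ) := by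
  cases m with
  | zero => have := le_max_left 1 (freqNorm ξ); norm_num; linarith
  | succ j =>
    have h1 : (2 : ℝ) ^ j ≤ freqNorm ξ := h.1
    have := le_max_right 1 (freqNorm ξ)
    rw [pow_succ]; linarith

theorem exists_mem_shell (ξ : Freq) : ∃ m, ξ ∈ shell m := by
  by_cases h : freqNorm ξ ≤ 1
  · exact ⟨0, h⟩
  · push Not at h
    obtain ⟨n, hn1, hn2⟩ := exists_nat_pow_near h.le (one_lt_two)
    exact ⟨n + 1, hn1, hn2.le⟩

/-- The restriction of the spectrum to a shell. -/
def block (f : Freq → ℝ≥0∞) (m : ℕ) : Freq → ℝ≥0∞ := (shell m).indicator f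

@[fun_prop] theorem measurable_block {f : Freq → ℝ≥0∞} (hf : Measurable f) (m : ℕ) :
    Measurable (block f m) := hf.indicator (measurableSet_shell m)

theorem le_tsum_block (f : Freq → ℝ≥0∞) (ξ : Freq) : f ξ ≤ ∑' m, block f m ξ := by
  obtain ⟨m, hm⟩ := exists_mem_shell ξ
  refine le_trans (le_of_eq ?_) (ENNReal.le_tsum m)
  simp [block, hm]

theorem eLpNorm_block {f : Freq → ℝ≥0∞} (m : ℕ) :
    eLpNorm (block f m) 2 freqMeasure = eLpNorm f 2 (freqMeasure.restrict (shell m)) :=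
  eLpNorm_indicator_eq_eLpNorm_restrict (measurableSet_shell m)

theorem mem_shell_of_block_ne_zero {f : Freq → ℝ≥0∞} {m : ℕ} {ξ : Freq} (h : block f m ξ ≠ 0) :
    ξ ∈ shell m := by
  by_contra hn
  exact h (by simp [block, hn])

/-! ### Powers of `√2` -/

/-- The number `√2`. -/
def rootTwo : ℝ≥0∞ := ENNReal.ofReal √2

theorem rootTwo_sq : rootTwo ^ 2 = 2 := by
  rw [rootTwo, ← ENNReal.ofReal_pow (Real.sqrt_nonneg _), Real.sq_sqrt (by norm_num)]
  simp

theorem one_le_rootTwo : 1 ≤ rootTwo := by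
  rw [rootTwo, ← ENNReal.ofReal_one]
  exact ENNReal.ofReal_le_ofReal (Real.one_le_sqrt.2 (by norm_num))

theorem rootTwo_ne_top : rootTwo ≠ ∞ := ENNReal.ofReal_ne_top

theorem rootTwo_pow_two_mul (m : ℕ) : rootTwo ^ (2 * m) = 2 ^ m := by
  rw [pow_mul, rootTwo_sq]

/-- The shell with index `m` has weight `2^{7(m-1)/2}`. The factor `√2⁷` removes the shift, so that
only natural powers of `√2` remain in the dyadic computations. -/
theorem weight_eq (m : ℕ) : rootTwo ^ 7 * weight (7 / 2) m = rootTwo ^ (7 * m) := by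
  have h2 : (0 : ℝ) < √2 := by positivity
  rw [rootTwo, weight, ← ENNReal.ofReal_pow h2.le, ← ENNReal.ofReal_pow h2.le,
    ← ENNReal.ofReal_mul (by positivity)]
  congr 1
  rw [Real.sqrt_eq_rpow, ← Real.rpow_natCast, ← Real.rpow_natCast, ← Real.rpow_mul (by norm_num),
    ← Real.rpow_mul (by norm_num), ← Real.rpow_add (by norm_num)]
  congr 1
  push_cast
  ring

/-- The number 18 is `3 · 3 · 2`: for `X ≥ 1` the box of size `X` has unnormalized measure at most
`(2X+1)(2X+1)(2X) ≤ 18 X³`. The normalization thus brings the constant in Bernstein's inequality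
down to 1. -/
theorem normConst_le : normConst * 18 ≤ 1 := by
  have h := normConst_mul
  have h3 := Real.pi_gt_three
  have h0 := normConst_pos
  have : (18 : ℝ) ≤ (2 * Real.pi) * (2 * Real.pi) * (2 * Real.pi) := by nlinarith
  nlinarith

theorem freqMeasure_shell_le (m : ℕ) : freqMeasure (shell m) ≤ (rootTwo ^ (3 * m)) ^ 2 := by
  have hsub : shell m ⊆ box (2 ^ m) := by
    intro ξ hξ j
    push_cast
    exact (abs_coord_le_freqNorm j ξ).trans (freqNorm_le_of_mem_shell hξ)
  refine (measure_mono hsub).trans ((freqMeasure_box_le _).trans ?_)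
  have : (rootTwo ^ (3 * m)) ^ 2 = ENNReal.ofReal ((2 ^ m) ^ 3) := by
    rw [← pow_mul, show 3 * m * 2 = 2 * (m * 3) by ring, rootTwo_pow_two_mul, pow_mul,
      ENNReal.ofReal_pow (by positivity), ENNReal.ofReal_pow (by positivity)]
    simp
  rw [this]
  apply ENNReal.ofReal_le_ofReal
  push_cast
  have h1 : (1 : ℝ) ≤ 2 ^ m := one_le_pow₀ (by norm_num)
  generalize (2 : ℝ) ^ m = X at h1
  have h2 : (2 * X + 1) * (2 * X + 1) * (2 * X) ≤ 18 * X ^ 3 := by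
    nlinarith [mul_nonneg (sub_nonneg.2 h1) (sub_nonneg.2 h1), mul_nonneg (by linarith : (0:ℝ) ≤ X) (sub_nonneg.2 h1), mul_nonneg (mul_nonneg (by linarith : (0:ℝ) ≤ X) (by linarith : (0:ℝ) ≤ X)) (sub_nonneg.2 h1)]
  have h0 := normConst_pos
  calc normConst * ((2 * X + 1) * (2 * X + 1) * (2 * X)) ≤ normConst * (18 * X ^ 3) := by gcongr
    _ = (normConst * 18) * X ^ 3 := by ring
    _ ≤ 1 * X ^ 3 := by gcongr; exact normConst_le
    _ = X ^ 3 := one_mul _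

/-- Bernstein's inequality on the Fourier side: Cauchy–Schwarz on a shell of measure at most
`2^{3m}`. -/
theorem lintegral_block_le {f : Freq → ℝ≥0∞} (hf : Measurable f) (m : ℕ) :
    ∫⁻ ξ, block f m ξ ∂freqMeasure
      ≤ rootTwo ^ (3 * m) * eLpNorm f 2 (freqMeasure.restrict (shell m)) := by
  unfold block
  rw [lintegral_indicator (measurableSet_shell m)]
  have := lintegral_mul_le_eLpNorm_two (ν := freqMeasure.restrict (shell m)) (f := fun _ => 1)
    (g := f) aemeasurable_const hf.aemeasurable
  simp only [one_mul] at this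
  refine this.trans ?_
  gcongr
  apply eLpNorm_two_le_of_sq_le
  simpa using freqMeasure_shell_le m

/-! ### The product estimate -/

/-- `|ξ|`, as an extended nonnegative number. -/
def eNorm (ξ : Freq) : ℝ≥0∞ := ENNReal.ofReal (freqNorm ξ)

@[fun_prop] theorem measurable_eNorm : Measurable eNorm := by unfold eNorm; fun_prop

/-- The convolution of two nonnegative functions with a loss of one derivative
on the factor of lower frequency. -/
def lossConv (f g : Freq → ℝ≥0∞) (ξ : Freq) : ℝ≥0∞ :=
  ∫⁻ η, (1 + min (eNorm η) (eNorm (ξ - η))) * (f η * g (ξ - η)) ∂freqMeasure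

/-- The coefficients in the block decomposition of `lossConv`. -/
def lossCoeff (m k l : ℕ) : ℝ≥0∞ :=
  if m ≤ max k l + 2 then 2 * rootTwo ^ (5 * min k l) else 0

theorem lossConv_comm (f g : Freq → ℝ≥0∞) (ξ : Freq) : lossConv f g ξ = lossConv g f ξ := by
  unfold lossConv
  rw [← lintegral_sub_left_eq_self _ ξ]
  refine lintegral_congr fun η => ?_
  rw [sub_sub_cancel, min_comm, mul_comm (f _)]

theorem lconv_le_lossConv (f g : Freq → ℝ≥0∞) (ξ : Freq) : lconv f g ξ ≤ lossConv f g ξ := by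
  refine lintegral_mono fun η => ?_
  exact le_mul_of_one_le_left (zero_le) le_self_add

theorem eNorm_le_of_mem_shell {m : ℕ} {ξ : Freq} (h : ξ ∈ shell m) : eNorm ξ ≤ 2 ^ m := by
  rw [eNorm, show (2 : ℝ≥0∞) ^ m = ENNReal.ofReal (2 ^ m) by
    rw [ENNReal.ofReal_pow (by norm_num)]; simp]
  exact ENNReal.ofReal_le_ofReal (freqNorm_le_of_mem_shell h)

theorem lossConv_le_tsum {f g : Freq → ℝ≥0∞} (hf : Measurable f) (hg : Measurable g) (ξ : Freq) :
    lossConv f g ξ ≤ ∑' p : ℕ × ℕ, lossConv (block f p.1) (block g p.2) ξ := by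
  unfold lossConv
  rw [← lintegral_tsum fun p => by fun_prop]
  refine lintegral_mono fun η => ?_
  simp only
  rw [ENNReal.tsum_mul_left]
  gcongr
  rw [ENNReal.tsum_prod (f := fun k l => block f k η * block g l (ξ - η))]
  simp_rw [ENNReal.tsum_mul_left]
  rw [ENNReal.tsum_mul_right]
  gcongr
  · exact le_tsum_block f η
  · exact le_tsum_block g _

/-- Here `|ξ| ≤ 2^k + 2^l ≤ 2^{max k l + 1}`, while `2^m ≤ 2 max(1, |ξ|)` on the shell `m`; this
accounts for the shift by two. -/
theorem le_add_two_of_mem_shell {m k l : ℕ} {ξ η : Freq} (hξ : ξ ∈ shell m) (hη : η ∈ shell k)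
    (hζ : ξ - η ∈ shell l) : m ≤ max k l + 2 := by
  have h1 := two_pow_le_of_mem_shell hξ
  have h2 := freqNorm_le_of_mem_shell hη
  have h3 := freqNorm_le_of_mem_shell hζ
  have h4 := freqNorm_add_le η (ξ - η)
  rw [add_sub_cancel] at h4
  have h5 : (2 : ℝ) ^ k ≤ 2 ^ max k l := pow_le_pow_right₀ (by norm_num) (le_max_left _ _)
  have h6 : (2 : ℝ) ^ l ≤ 2 ^ max k l := pow_le_pow_right₀ (by norm_num) (le_max_right _ _)
  have h7 : (1 : ℝ) ≤ 2 ^ max k l := one_le_pow₀ (by norm_num)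
  have h8 : (2 : ℝ) ^ m ≤ 2 ^ (max k l + 2) := by
    refine h1.trans ?_
    have : max 1 (freqNorm ξ) ≤ 2 * 2 ^ max k l := max_le (by linarith) (by linarith)
    rw [pow_add]; linarith
  exact (pow_le_pow_iff_right₀ (by norm_num)).1 h8

/-- On the supports of the two blocks the minimum is at most `2^{min k l}`, and `1 ≤ 2^{min k l}`
doubles it. -/
theorem lossConv_block_le (f g : Freq → ℝ≥0∞) {m k l : ℕ} {ξ : Freq} (hξ : ξ ∈ shell m) :
    lossConv (block f k) (block g l) ξ
      ≤ (if m ≤ max k l + 2 then 2 * rootTwo ^ (2 * min k l) else 0)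
        * lconv (block f k) (block g l) ξ := by
  have key : ∀ η, (1 + min (eNorm η) (eNorm (ξ - η))) * (block f k η * block g l (ξ - η))
      ≤ (if m ≤ max k l + 2 then 2 * rootTwo ^ (2 * min k l) else 0)
        * (block f k η * block g l (ξ - η)) := by
    intro η
    by_cases h0 : block f k η * block g l (ξ - η) = 0
    · simp [h0]
    have hη := mem_shell_of_block_ne_zero (left_ne_zero_of_mul h0)
    have hζ := mem_shell_of_block_ne_zero (right_ne_zero_of_mul h0)
    rw [if_pos (le_add_two_of_mem_shell hξ hη hζ)]
    gcongr
    rw [rootTwo_pow_two_mul, two_mul]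
    gcongr
    · exact one_le_pow₀ (by norm_num)
    · rcases le_total k l with h | h
      · rw [min_eq_left h]
        exact (min_le_left _ _).trans (eNorm_le_of_mem_shell hη)
      · rw [min_eq_right h]
        exact (min_le_right _ _).trans (eNorm_le_of_mem_shell hζ)
  unfold lossConv lconv
  rw [← lintegral_const_mul']
  · exact lintegral_mono key
  · split_ifs
    · exact ENNReal.mul_ne_top (by norm_num) (ENNReal.pow_ne_top rootTwo_ne_top)
    · simp

/-- Young's inequality with the factor of lower frequency in L¹, where Bernstein's inequality is
cheapest. -/
theorem eLpNorm_lconv_block_le {f g : Freq → ℝ≥0∞} (hf : Measurable f) (hg : Measurable g)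
    (k l : ℕ) :
    eLpNorm (lconv (block f k) (block g l)) 2 freqMeasure
      ≤ rootTwo ^ (3 * min k l) * (eLpNorm f 2 (freqMeasure.restrict (shell k))
        * eLpNorm g 2 (freqMeasure.restrict (shell l))) := by
  rcases le_total k l with h | h
  · rw [min_eq_left h, ← mul_assoc]
    refine (eLpNorm_lconv_le (by fun_prop) (by fun_prop)).trans ?_
    rw [eLpNorm_block]
    gcongr
    exact lintegral_block_le hf k
  · rw [min_eq_right h, mul_comm (eLpNorm f 2 _), ← mul_assoc, funext (lconv_comm _ _)]
    refine (eLpNorm_lconv_le (by fun_prop) (by fun_prop)).trans ?_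
    rw [eLpNorm_block]
    gcongr
    exact lintegral_block_le hg l

/-- The exponent 5 in `lossCoeff` counts half derivatives on the lower frequency: 2 from the weight
of `lossConv`, 3 from Bernstein's inequality. -/
theorem eLpNorm_lossConv_le {f g : Freq → ℝ≥0∞} (hf : Measurable f) (hg : Measurable g) (m : ℕ) :
    eLpNorm (lossConv f g) 2 (freqMeasure.restrict (shell m))
      ≤ ∑' p : ℕ × ℕ, lossCoeff m p.1 p.2 * (eLpNorm f 2 (freqMeasure.restrict (shell p.1))
        * eLpNorm g 2 (freqMeasure.restrict (shell p.2))) := by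
  have h1 : ∀ᵐ ξ ∂freqMeasure.restrict (shell m), lossConv f g ξ
      ≤ ∑' p : ℕ × ℕ, (if m ≤ max p.1 p.2 + 2 then 2 * rootTwo ^ (2 * min p.1 p.2) else 0)
        * lconv (block f p.1) (block g p.2) ξ := by
    filter_upwards [ae_restrict_mem (measurableSet_shell m)] with ξ hξ
    exact (lossConv_le_tsum hf hg ξ).trans
      (ENNReal.tsum_le_tsum fun p => lossConv_block_le f g hξ)
  refine (eLpNorm_two_mono h1).trans ((eLpNorm_two_tsum_le fun p => by fun_prop).trans ?_)
  refine ENNReal.tsum_le_tsum fun p => ?_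
  rw [eLpNorm_two_const_mul _ (by fun_prop)]
  refine (mul_le_mul_right ((eLpNorm_mono_measure _ Measure.restrict_le_self).trans
    (eLpNorm_lconv_block_le hf hg p.1 p.2)) _).trans (le_of_eq ?_)
  rw [← mul_assoc, lossCoeff]
  congr 1
  split_ifs
  · rw [mul_assoc, ← pow_add]
    congr 2
    ring
  · simp

/-- A geometric sum whose ratio `2^{7/2}` exceeds 2 is bounded by the next term. -/
theorem sum_rootTwo_le (n : ℕ) : ∑ m ∈ Finset.range n, rootTwo ^ (7 * m) ≤ rootTwo ^ (7 * n) := by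
  induction n with
  | zero => simp
  | succ n ih =>
    rw [Finset.sum_range_succ]
    calc _ ≤ rootTwo ^ (7 * n) + rootTwo ^ (7 * n) := by gcongr
      _ = rootTwo ^ (7 * n + 2) := by rw [pow_add, rootTwo_sq, mul_two]
      _ ≤ rootTwo ^ (7 * (n + 1)) := pow_le_pow_right₀ one_le_rootTwo (by omega)

/-- The constant of the product estimate. -/
def prodConst : ℝ≥0∞ := 2 * rootTwo ^ 28

theorem prodConst_ne_top : prodConst ≠ ∞ :=
  ENNReal.mul_ne_top (by norm_num) (ENNReal.pow_ne_top rootTwo_ne_top)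

/-- The sum over the output shells is geometric and dominated by its top term, of order `√2^{7 max k
l}`. The lower frequency has the power 5, and `5 ≤ 7` leaves `√2^{7(max k l + min k l)} = √2^{7(k +
l)}`. In `prodConst`, 21 of the 28 comes from stopping at `m = max k l + 2`, and 7 from the index
shift of the weights. -/
theorem tsum_weight_lossCoeff_le (k l : ℕ) :
    ∑' m, weight (7 / 2) m * lossCoeff m k l
      ≤ prodConst * (weight (7 / 2) k * weight (7 / 2) l) := by
  have h7 : rootTwo ^ 7 ≠ 0 := (zero_lt_one.trans_le (one_le_pow₀ one_le_rootTwo)).ne'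
  have h7' : rootTwo ^ 7 ≠ ∞ := ENNReal.pow_ne_top rootTwo_ne_top
  refine (ENNReal.mul_le_mul_iff_right h7 h7').1 ?_
  rw [← ENNReal.tsum_mul_left]
  have e1 : ∀ m, rootTwo ^ 7 * (weight (7 / 2) m * lossCoeff m k l)
      = rootTwo ^ (7 * m) * lossCoeff m k l := fun m => by rw [← mul_assoc, weight_eq]
  simp_rw [e1]
  rw [tsum_eq_sum (s := Finset.range (max k l + 3)) (by
    intro m hm
    rw [Finset.mem_range] at hm
    simp [lossCoeff, show ¬ m ≤ max k l + 2 by omega])]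
  have e2 : ∀ m ∈ Finset.range (max k l + 3), rootTwo ^ (7 * m) * lossCoeff m k l
      = rootTwo ^ (7 * m) * (2 * rootTwo ^ (5 * min k l)) := by
    intro m hm
    rw [Finset.mem_range] at hm
    simp [lossCoeff, show m ≤ max k l + 2 by omega]
  rw [Finset.sum_congr rfl e2, ← Finset.sum_mul]
  calc _ ≤ rootTwo ^ (7 * (max k l + 3)) * (2 * rootTwo ^ (7 * min k l)) := by
        gcongr
        · exact sum_rootTwo_le _
        · exact one_le_rootTwo
        · norm_num
    _ = 2 * rootTwo ^ 21 * (rootTwo ^ (7 * max k l) * rootTwo ^ (7 * min k l)) := by ring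
    _ = 2 * rootTwo ^ 21 * (rootTwo ^ (7 * k) * rootTwo ^ (7 * l)) := by
        rw [← pow_add, ← pow_add, ← mul_add, ← mul_add, max_add_min]
    _ = _ := by
        rw [← weight_eq, ← weight_eq, prodConst]
        ring

end RescaledNS

end

/-! ### Duhamel's formula for bounded multipliers on L² -/

noncomputable section

namespace RescaledNS

open MeasureTheory Set Filter Topology
open scoped ENNReal


/-! ### Fundamental theorem of calculus as an inequality -/

theorem enorm_le_add_lintegral_deriv {F : Type*} [NormedAddCommGroup F] [NormedSpace ℝ F]
    [CompleteSpace F] {g G : ℝ → F} {t : ℝ} (ht : 0 ≤ t)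
    (hg : ∀ s, 0 ≤ s → HasDerivWithinAt g (G s) (Ici 0) s) :
    ‖g t‖ₑ ≤ ‖g 0‖ₑ + ∫⁻ s in Ioo 0 t, ‖G s‖ₑ := by
  have hd : ∀ s ∈ Ioo 0 t, HasDerivAt g (G s) s := fun s hs =>
    (hg s hs.1.le).hasDerivAt (Ici_mem_nhds hs.1)
  have hE : ∫⁻ s in Ioo 0 t, ‖G s‖ₑ = ∫⁻ s in Ioo 0 t, ‖deriv g s‖ₑ :=
    setLIntegral_congr_fun measurableSet_Ioo fun s hs => by rw [(hd s hs).deriv]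
  -- No regularity of `G` is assumed: an infinite integral makes the bound trivial, and a finite one
  -- makes `deriv g`, always strongly measurable, integrable.
  by_cases hfin : ∫⁻ s in Ioo 0 t, ‖deriv g s‖ₑ = ∞
  · rw [hE, hfin]; simp
  have hI : IntegrableOn (deriv g) (Ioo 0 t) :=
    ⟨(stronglyMeasurable_deriv g).aestronglyMeasurable, lt_top_iff_ne_top.2 hfin⟩
  have hI' : IntervalIntegrable (deriv g) volume 0 t := by
    rw [intervalIntegrable_iff_integrableOn_Ioo_of_le ht]
    exact hI
  have hc : ContinuousOn g (Icc 0 t) := fun s hs =>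
    (hg s hs.1).continuousWithinAt.mono Icc_subset_Ici_self
  have hftc := intervalIntegral.integral_eq_sub_of_hasDerivAt_of_le ht hc
    (fun s hs => (hd s hs).deriv ▸ hd s hs) hI'
  have : g t = g 0 + ∫ s in (0 : ℝ)..t, deriv g s := by rw [hftc]; abel
  rw [this, hE]
  refine (enorm_add_le _ _).trans ?_
  gcongr
  rw [intervalIntegral.integral_of_le ht, integral_Ioc_eq_integral_Ioo]
  exact enorm_integral_le_lintegral_enorm _

/-! ### Multiplication of square integrable functions by bounded functions -/

section Multiplier

variable {α : Type*} [MeasurableSpace α] {ν : Measure α}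
  {E : Type*} [NormedAddCommGroup E] [NormedSpace ℝ E]

/-- Multiplication of `L²` functions by `L^∞` functions. -/
def mulLp (ν : Measure α) (E : Type*) [NormedAddCommGroup E] [NormedSpace ℝ E] :
    Lp ℝ ∞ ν →L[ℝ] Lp E 2 ν →L[ℝ] Lp E 2 ν :=
  (ContinuousLinearMap.lsmul ℝ ℝ).holderL ν ∞ 2 2

theorem mulLp_coeFn (c : Lp ℝ ∞ ν) (u : Lp E 2 ν) : mulLp ν E c u =ᵐ[ν] fun x => c x • u x :=
  (ContinuousLinearMap.lsmul ℝ ℝ : ℝ →L[ℝ] E →L[ℝ] E).coeFn_holder c u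

/-- A bounded measurable function. -/
structure BddMeas (c : α → ℝ) : Prop where
  meas : Measurable c
  bdd : ∃ M, ∀ x, |c x| ≤ M

namespace BddMeas

theorem memLp {c : α → ℝ} (h : BddMeas c) : MemLp c ∞ ν := by
  obtain ⟨M, hM⟩ := h.bdd
  exact memLp_top_of_bound h.meas.aestronglyMeasurable M (Eventually.of_forall hM)

theorem mul {c d : α → ℝ} (hc : BddMeas c) (hd : BddMeas d) : BddMeas (fun x => c x * d x) := by
  obtain ⟨M, hM⟩ := hc.bdd
  obtain ⟨K, hK⟩ := hd.bdd
  refine ⟨hc.meas.mul hd.meas, M * K, fun x => ?_⟩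
  rw [abs_mul]
  exact mul_le_mul (hM x) (hK x) (abs_nonneg _) ((abs_nonneg _).trans (hM x))

theorem exp_mul {ρ : α → ℝ} (h : BddMeas ρ) (s : ℝ) : BddMeas (fun x => Real.exp (s * ρ x)) := by
  obtain ⟨M, hM⟩ := h.bdd
  refine ⟨(h.meas.const_mul s).exp, Real.exp (|s| * M), fun x => ?_⟩
  rw [Real.abs_exp, Real.exp_le_exp]
  refine (le_abs_self _).trans ?_
  rw [abs_mul]
  exact mul_le_mul_of_nonneg_left (hM x) (abs_nonneg _)

/-- The class in `L^∞` of a bounded measurable function. -/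
def toLp {c : α → ℝ} (h : BddMeas c) (ν : Measure α) : Lp ℝ ∞ ν := h.memLp.toLp c

theorem coeFn_toLp {c : α → ℝ} (h : BddMeas c) : h.toLp ν =ᵐ[ν] c := h.memLp.coeFn_toLp

theorem norm_le {c : Lp ℝ ∞ ν} {K : ℝ} (hK : 0 ≤ K) (h : ∀ᵐ x ∂ν, |c x| ≤ K) : ‖c‖ ≤ K := by
  rw [Lp.norm_def]
  refine ENNReal.toReal_le_of_le_ofReal hK ?_
  rw [eLpNorm_exponent_top]
  exact eLpNormEssSup_le_of_ae_bound h

theorem enorm_mulLp {c : α → ℝ} (h : BddMeas c) (u : Lp E 2 ν) :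
    ‖mulLp ν E (h.toLp ν) u‖ₑ = eLpNorm (fun x => c x • u x) 2 ν := by
  rw [Lp.enorm_def]
  apply eLpNorm_congr_ae
  filter_upwards [mulLp_coeFn (h.toLp ν) u, h.coeFn_toLp (ν := ν)] with x h1 h2
  rw [h1, h2]

/-- Boundedness of `ρ` makes the Taylor remainder uniform in `x`: `|e^y - 1 - y| ≤ y²` for `|y| ≤ 1`
gives an error `O((s' - s)²)` in the L^∞ norm. -/
theorem hasDerivAt_exp {ρ : α → ℝ} (h : BddMeas ρ) (s : ℝ) :
    HasDerivAt (fun s => (h.exp_mul s).toLp ν) ((h.mul (h.exp_mul s)).toLp ν) s := by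
  obtain ⟨M, hM⟩ := h.bdd
  set K := |M| + 1 with hK
  have hKpos : 0 < K := by positivity
  have hMK : ∀ x, |ρ x| ≤ K := fun x => (hM x).trans ((le_abs_self M).trans (by linarith))
  rw [hasDerivAt_iff_isLittleO]
  have hO : (fun s' => (h.exp_mul s').toLp ν - (h.exp_mul s).toLp ν
      - (s' - s) • (h.mul (h.exp_mul s)).toLp ν) =O[𝓝 s] fun s' => (s' - s) ^ 2 := by
    refine Asymptotics.IsBigO.of_bound (Real.exp (|s| * K) * K ^ 2) ?_
    have hn : ∀ᶠ s' in 𝓝 s, |s' - s| < 1 / K := by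
      have := Metric.ball_mem_nhds s (show 0 < 1 / K by positivity)
      filter_upwards [this] with s' hs'
      simpa [Real.dist_eq] using hs'
    filter_upwards [hn] with s' hs'
    refine norm_le (by positivity) ?_
    filter_upwards [Lp.coeFn_sub ((h.exp_mul s').toLp ν - (h.exp_mul s).toLp ν)
        ((s' - s) • (h.mul (h.exp_mul s)).toLp ν),
      Lp.coeFn_sub ((h.exp_mul s').toLp ν) ((h.exp_mul s).toLp ν),
      Lp.coeFn_smul (s' - s) ((h.mul (h.exp_mul s)).toLp ν),
      (h.exp_mul s').coeFn_toLp (ν := ν), (h.exp_mul s).coeFn_toLp (ν := ν),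
      (h.mul (h.exp_mul s)).coeFn_toLp (ν := ν)] with x h1 h2 h3 h4 h5 h6
    rw [h1, Pi.sub_apply, h2, Pi.sub_apply, h3, Pi.smul_apply, h4, h5, h6, smul_eq_mul]
    have hy : |(s' - s) * ρ x| ≤ 1 := by
      rw [abs_mul]
      calc |s' - s| * |ρ x| ≤ (1 / K) * K := by gcongr; exact hMK x
        _ = 1 := by field_simp
    have e : Real.exp (s' * ρ x) - Real.exp (s * ρ x) - (s' - s) * (ρ x * Real.exp (s * ρ x))
        = Real.exp (s * ρ x) * (Real.exp ((s' - s) * ρ x) - 1 - (s' - s) * ρ x) := by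
      have : s' * ρ x = s * ρ x + (s' - s) * ρ x := by ring
      rw [this, Real.exp_add]
      ring
    rw [e, abs_mul, Real.abs_exp]
    have h7 := Real.abs_exp_sub_one_sub_id_le hy
    have h8 : Real.exp (s * ρ x) ≤ Real.exp (|s| * K) := by
      rw [Real.exp_le_exp]
      refine (le_abs_self _).trans ?_
      rw [abs_mul]
      exact mul_le_mul_of_nonneg_left (hMK x) (abs_nonneg _)
    have h9 : ((s' - s) * ρ x) ^ 2 ≤ K ^ 2 * ‖(s' - s) ^ 2‖ := by
      rw [mul_pow, Real.norm_of_nonneg (sq_nonneg _), mul_comm]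
      exact mul_le_mul_of_nonneg_right
        (sq_le_sq' (by linarith [(abs_le.1 (hMK x)).1]) (abs_le.1 (hMK x)).2) (sq_nonneg _)
    calc _ ≤ Real.exp (|s| * K) * (K ^ 2 * ‖(s' - s) ^ 2‖) :=
          mul_le_mul h8 (h7.trans h9) (abs_nonneg _) (by positivity)
      _ = _ := by ring
  refine hO.trans_isLittleO ?_
  have := (Asymptotics.isLittleO_pow_pow (𝕜 := ℝ) (m := 1) (n := 2) (by norm_num)).comp_tendsto
    (show Tendsto (fun s' : ℝ => s' - s) (𝓝 s) (𝓝 0) by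
      have : Tendsto (fun s' : ℝ => s' - s) (𝓝 s) (𝓝 (s - s)) := (continuous_sub_right s).tendsto s
      simpa using this)
  simpa [Function.comp_def] using this

end BddMeas

/-- Duhamel's formula, as an inequality, for an evolution in `L²` whose linear part is the
multiplication by a bounded function `-ρ`, tested against a bounded weight `c`. -/
theorem eLpNorm_duhamel_le [CompleteSpace E] {ρ c : α → ℝ} (hρ : BddMeas ρ) (hc : BddMeas c)
    {u : ℝ → Lp E 2 ν} (hu : DifferentiableOn ℝ u (Ici 0)) {t : ℝ} (ht : 0 ≤ t) :
    eLpNorm (fun x => c x • u t x) 2 ν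
      ≤ eLpNorm (fun x => (c x * Real.exp (-(t * ρ x))) • u 0 x) 2 ν
        + ∫⁻ s in Ioo 0 t, eLpNorm (fun x => (c x * Real.exp (-((t - s) * ρ x))) •
            ((derivWithin u (Ici 0) s : Lp E 2 ν) x + ρ x • u s x)) 2 ν := by
  set e : ℝ → Lp ℝ ∞ ν := fun s => (hρ.exp_mul s).toLp ν
  set d : ℝ → α → ℝ := fun s x => c x * Real.exp (-(t * ρ x)) * Real.exp (s * ρ x)
  have h0 : BddMeas (fun x => c x * Real.exp (-(t * ρ x))) := by
    have := hc.mul (hρ.exp_mul (-t))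
    simpa only [neg_mul] using this
  -- With `t` frozen, the `s`-derivative of `c e^{-tρ} e^{sρ} u(s)` is `c e^{-(t-s)ρ} (u'(s) + ρ
  -- u(s))`; its values at `s = t` and `s = 0` are the two boundary terms.
  have hder : ∀ s, 0 ≤ s → HasDerivWithinAt (fun s => mulLp ν E (h0.toLp ν) (mulLp ν E (e s) (u s)))
      (mulLp ν E (h0.toLp ν) (mulLp ν E ((hρ.mul (hρ.exp_mul s)).toLp ν) (u s)
        + mulLp ν E (e s) (derivWithin u (Ici 0) s))) (Ici 0) s := by
    intro s hs
    have h1 : HasDerivWithinAt (fun s => mulLp ν E (e s))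
        (mulLp ν E ((hρ.mul (hρ.exp_mul s)).toLp ν)) (Ici 0) s :=
      ((mulLp ν E).hasFDerivAt.comp_hasDerivAt s (hρ.hasDerivAt_exp (ν := ν) s)).hasDerivWithinAt
    have h2 := h1.clm_apply (hu s hs).hasDerivWithinAt
    exact (mulLp ν E (h0.toLp ν)).hasFDerivAt.comp_hasDerivWithinAt s h2
  have key := enorm_le_add_lintegral_deriv ht hder
  refine le_trans (le_of_eq ?_) (key.trans (add_le_add (le_of_eq ?_)
    (lintegral_mono fun s => le_of_eq ?_)))
  · rw [BddMeas.enorm_mulLp]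
    apply eLpNorm_congr_ae
    filter_upwards [mulLp_coeFn (e t) (u t), (hρ.exp_mul t).coeFn_toLp (ν := ν)] with x h1 h2
    rw [h1, h2, smul_smul, mul_assoc, ← Real.exp_add]
    simp
  · rw [BddMeas.enorm_mulLp]
    apply eLpNorm_congr_ae
    filter_upwards [mulLp_coeFn (e 0) (u 0), (hρ.exp_mul 0).coeFn_toLp (ν := ν)] with x h1 h2
    rw [h1, h2]
    simp
  · rw [BddMeas.enorm_mulLp]
    apply eLpNorm_congr_ae
    filter_upwards [mulLp_coeFn (e s) (derivWithin u (Ici 0) s),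
      mulLp_coeFn ((hρ.mul (hρ.exp_mul s)).toLp ν) (u s), (hρ.exp_mul s).coeFn_toLp (ν := ν),
      (hρ.mul (hρ.exp_mul s)).coeFn_toLp (ν := ν),
      Lp.coeFn_add (mulLp ν E ((hρ.mul (hρ.exp_mul s)).toLp ν) (u s))
        (mulLp ν E (e s) (derivWithin u (Ici 0) s))] with x h1 h2 h3 h4 h5
    rw [h5, Pi.add_apply, h1, h2, h3, h4]
    have : Real.exp (-((t - s) * ρ x)) = Real.exp (-(t * ρ x)) * Real.exp (s * ρ x) := by
      rw [← Real.exp_add]; congr 1; ring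
    rw [this]
    module

end Multiplier

end RescaledNS

end

/-! ### Good representatives and the divergence form of the nonlinear terms -/

noncomputable section

namespace RescaledNS

open MeasureTheory Set Filter Topology
open scoped ENNReal


/-! ### Almost everywhere equal fields -/

theorem fourierInv_congr {f g : Freq → ℂ} (h : f =ᵐ[freqMeasure] g) :
    fourierInv f = fourierInv g := by
  ext x
  refine integral_congr_ae ?_
  filter_upwards [h] with ξ hξ
  rw [hξ]

theorem comp_congr {u V : Freq → Vec3} (h : u =ᵐ[freqMeasure] V) (j : Fin 3) :
    comp j u =ᵐ[freqMeasure] comp j V := by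
  filter_upwards [h] with ξ hξ
  simp [comp, hξ]

theorem perpHat_congr {u V : Freq → Vec3} (h : u =ᵐ[freqMeasure] V) :
    perpHat u =ᵐ[freqMeasure] perpHat V := by
  filter_upwards [h] with ξ hξ
  simp [perpHat, indicator, hξ]

theorem meanHat_congr {u V : Freq → Vec3} (h : u =ᵐ[freqMeasure] V) :
    meanHat u =ᵐ[freqMeasure] meanHat V := by
  filter_upwards [h] with ξ hξ
  simp [meanHat, indicator, hξ]

theorem dHat_congr {f g : Freq → ℂ} (h : f =ᵐ[freqMeasure] g) (j : Fin 3) :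
    dHat j f =ᵐ[freqMeasure] dHat j g := by
  filter_upwards [h] with ξ hξ
  simp [dHat, hξ]

theorem advect_congr {u V : Freq → Vec3} (h : u =ᵐ[freqMeasure] V) (i : Fin 3) :
    advect u i = advect V i := by
  ext x
  unfold advect
  refine Finset.sum_congr rfl fun j _ => ?_
  rw [fourierInv_congr (comp_congr h j),
    fourierInv_congr (dHat_congr (comp_congr (perpHat_congr h) i) j)]

theorem stretch_congr {u V : Freq → Vec3} (h : u =ᵐ[freqMeasure] V) (i : Fin 3) :
    stretch u i = stretch V i := by
  ext x
  unfold stretch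
  rw [fourierInv_congr (comp_congr (perpHat_congr h) 2),
    fourierInv_congr (dHat_congr (comp_congr (meanHat_congr h) i) 2)]

/-! ### Fields with good pointwise representatives -/

/-- A square integrable divergence free field with spectrum in `|ξ_ε| ≤ n`, for which all the
properties hold everywhere. -/
structure NiceField (n : ℕ) (ε : ℝ) (u : Freq → Vec3) : Prop where
  meas : Measurable u
  memLp : MemLp u 2 freqMeasure
  supp : ∀ ξ, u ξ ≠ 0 → epsNormSq ε ξ ≤ (n : ℝ) ^ 2
  div : ∀ ξ, ∑ j : Fin 3, (coord j ξ : ℂ) * u ξ j = 0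
  mean : ∀ ξ : Freq, ξ.1 = 0 ∧ ξ.2.1 = 0 → u ξ 2 = 0

theorem freqMeasure_coord_two_eq_zero : freqMeasure {ξ | coord 2 ξ = 0} = 0 := by
  have : {ξ : Freq | coord 2 ξ = 0} = univ ×ˢ (univ ×ˢ {(0 : ℝ)}) := by
    ext ξ; simp [coord]
  rw [this, freqMeasure_eq, Measure.smul_apply, Measure.prod_prod, Measure.prod_prod]
  simp

@[fun_prop] theorem measurable_epsNormSq (ε : ℝ) : Measurable (epsNormSq ε) := by
  unfold epsNormSq; fun_prop

theorem measurableSet_hor_eq_zero : MeasurableSet {ξ : Freq | ξ.1 = 0 ∧ ξ.2.1 = 0} := by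
  have : {ξ : Freq | ξ.1 = 0 ∧ ξ.2.1 = 0} = {ξ | coord 0 ξ = 0} ∩ {ξ | coord 1 ξ = 0} := by
    ext ξ; simp [coord]
  rw [this]
  exact (measurableSet_eq_fun (by fun_prop) measurable_const).inter
    (measurableSet_eq_fun (by fun_prop) measurable_const)

@[fun_prop] theorem measurable_comp {u : Freq → Vec3} (hu : Measurable u) (j : Fin 3) :
    Measurable (comp j u) := by
  unfold comp; fun_prop

/-- Convolutions evaluate fields at every point, so the almost everywhere properties are made to
hold everywhere by setting the field to zero off the good set `G`, whose complement meets the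
support of `V` in a null set. The third component of the average vanishes because on `ξ_h = 0` the
divergence condition reads `ξ₃ v³ = 0`, and `ξ₃ = 0` is a null set. -/
theorem exists_niceField {n : ℕ} {ε : ℝ} (V : Field)
    (hs : (V : Freq → Vec3) =ᵐ[freqMeasure] projHat n ε V) (hd : DivFree V) :
    ∃ u, NiceField n ε u ∧ u =ᵐ[freqMeasure] V := by
  have hV : Measurable (V : Freq → Vec3) := (Lp.stronglyMeasurable V).measurable
  set G : Set Freq := {ξ | epsNormSq ε ξ ≤ (n : ℝ) ^ 2} ∩
    {ξ | ∑ j : Fin 3, (coord j ξ : ℂ) * V ξ j = 0} ∩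
    ({ξ : Freq | ξ.1 = 0 ∧ ξ.2.1 = 0}ᶜ ∪ {ξ | V ξ 2 = 0}) with hG
  have hVj : ∀ j, Measurable fun ξ => V ξ j := fun j => measurable_comp hV j
  have hGm : MeasurableSet G := by
    refine ((measurableSet_le (by fun_prop) measurable_const).inter
      (measurableSet_eq_fun ?_ measurable_const)).inter
      (measurableSet_hor_eq_zero.compl.union (measurableSet_eq_fun (hVj 2) measurable_const))
    exact Finset.measurable_sum _ fun j _ =>
      (Complex.measurable_ofReal.comp (measurable_coord j)).mul (hVj j)
  have hae : G.indicator (V : Freq → Vec3) =ᵐ[freqMeasure] V := by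
    have h0 : ∀ᵐ ξ ∂freqMeasure, coord 2 ξ ≠ 0 := by
      rw [ae_iff]; simpa using freqMeasure_coord_two_eq_zero
    filter_upwards [hs, hd, h0] with ξ h1 h2 h3
    by_cases hξ : ξ ∈ G
    · simp [hξ]
    · rw [indicator_of_notMem hξ]
      by_contra hne
      apply hξ
      have hdiv : ∑ j : Fin 3, (coord j ξ : ℂ) * V ξ j = 0 := by
        simp only [dHat, comp, mul_assoc] at h2
        rw [← Finset.mul_sum] at h2
        exact (mul_eq_zero.1 h2).resolve_left Complex.I_ne_zero
      refine ⟨⟨?_, hdiv⟩, ?_⟩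
      · by_contra hn
        exact hne (by rw [h1, projHat, indicator_of_notMem hn])
      · by_cases hh : ξ.1 = 0 ∧ ξ.2.1 = 0
        · right
          have e0 : coord 0 ξ = 0 := by simp [coord, hh.1]
          have e1 : coord 1 ξ = 0 := by simp [coord, hh.2]
          rw [Fin.sum_univ_three, e0, e1] at hdiv
          simpa [h3] using hdiv
        · exact Or.inl hh
  refine ⟨G.indicator V, ⟨hV.indicator hGm, (memLp_congr_ae hae).2 (Lp.memLp V), ?_, ?_, ?_⟩, hae⟩
  · intro ξ hξ
    have : ξ ∈ G := mem_of_indicator_ne_zero hξ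
    exact this.1.1
  · intro ξ
    by_cases hξ : ξ ∈ G
    · simp only [indicator_of_mem hξ]
      exact hξ.1.2
    · simp [indicator_of_notMem hξ]
  · intro ξ hh
    by_cases hξ : ξ ∈ G
    · rw [indicator_of_mem hξ]
      exact hξ.2.resolve_left (fun h => h hh)
    · simp [indicator_of_notMem hξ]

theorem epsNormSq_nonneg (ε : ℝ) (ξ : Freq) : 0 ≤ epsNormSq ε ξ := by
  unfold epsNormSq; positivity

/-- Since `ε ≤ 1`, every coordinate satisfies `ε|ξ_j| ≤ |ξ_ε|`. The size of the box depends on `n`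
and `ε`, but it is only used qualitatively. -/
theorem abs_coord_le_of_epsNormSq_le {n : ℕ} {ε : ℝ} (hε : 0 < ε) (hε1 : ε ≤ 1) {ξ : Freq}
    (h : epsNormSq ε ξ ≤ (n : ℝ) ^ 2) (j : Fin 3) : |coord j ξ| ≤ (⌈(n : ℝ) / ε⌉₊ : ℕ) := by
  refine le_trans ?_ (Nat.le_ceil _)
  rw [le_div_iff₀ hε]
  refine abs_le_of_sq_le_sq' ?_ (Nat.cast_nonneg n) |>.2
  rw [mul_pow, sq_abs]
  refine le_trans ?_ h
  have hε2 : ε ^ 2 ≤ 1 := pow_le_one₀ hε.le hε1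
  have h0 := sq_nonneg (coord 0 ξ)
  have h1 := sq_nonneg (coord 1 ξ)
  have h2 : 0 ≤ ε ^ 2 * coord 2 ξ ^ 2 := by positivity
  unfold epsNormSq
  fin_cases j <;> simp <;> nlinarith

namespace BoxSpec

variable {N : ℕ} {f g : Freq → ℂ}

theorem indicator (hf : BoxSpec N f) {s : Set Freq} (hs : MeasurableSet s) :
    BoxSpec N (s.indicator f) where
  meas := hf.meas.indicator hs
  memLp := hf.memLp.indicator hs
  supp ξ hξ := hf.supp ξ (fun h => hξ (by simp [Set.indicator, h]))

theorem dHat (hf : BoxSpec N f) (j : Fin 3) : BoxSpec N (dHat j f) where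
  meas := by
    have := hf.meas
    unfold RescaledNS.dHat
    fun_prop
  memLp := by
    refine hf.memLp.of_le_mul (c := N) ?_ (Eventually.of_forall fun ξ => ?_)
    · have := hf.meas
      unfold RescaledNS.dHat
      exact Measurable.aestronglyMeasurable (by fun_prop)
    · rw [RescaledNS.dHat, norm_mul, norm_mul, Complex.norm_I, one_mul, Complex.norm_real]
      by_cases h : f ξ = 0
      · simp [h]
      · exact mul_le_mul_of_nonneg_right (hf.supp ξ h j) (norm_nonneg _)
  supp ξ hξ := hf.supp ξ (fun h => hξ (by simp [RescaledNS.dHat, h]))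

theorem integrable_mul_conj (hf : BoxSpec N f) (hg : BoxSpec N g) (ζ : Freq) :
    Integrable (fun x => fourierInv f x * fourierInv g x * (starRingEnd ℂ) (character ζ x)) := by
  refine (hf.integrable_mul_fourierInv hg).mul_bdd (c := 1) ?_ (Eventually.of_forall fun x => ?_)
  · refine Measurable.aestronglyMeasurable ?_
    unfold character
    have h1 : Measurable (fun x : Dom => (fourier ζ.1 x.1 : ℂ)) :=
      ((map_continuous (fourier ζ.1)).comp continuous_fst).measurable
    have h2 : Measurable (fun x : Dom => (fourier ζ.2.1 x.2.1 : ℂ)) :=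
      ((map_continuous (fourier ζ.2.1)).comp (continuous_fst.comp continuous_snd)).measurable
    exact Complex.continuous_conj.measurable.comp (by fun_prop)
  · simp [character, fourier_apply, Complex.norm_exp, Circle.norm_coe]

/-- Divergence form of the transport term: `∑ⱼ aⱼ ∂ⱼ g = div (a g)` when `div a = 0`. -/
theorem sum_conv_dHat {a : Fin 3 → Freq → ℂ} (ha : ∀ j, BoxSpec N (a j)) (hg : BoxSpec N g)
    (hdiv : ∀ η, ∑ j : Fin 3, (coord j η : ℂ) * a j η = 0) (ξ : Freq) :
    ∑ j : Fin 3, conv (a j) (RescaledNS.dHat j g) ξ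
      = Complex.I * ∑ j : Fin 3, (coord j ξ : ℂ) * conv (a j) g ξ := by
  unfold conv
  rw [← integral_finsetSum _ fun j _ => (ha j).integrable_conv (hg.dHat j) ξ]
  simp_rw [← integral_const_mul]
  rw [← integral_finsetSum _ fun j _ => ((ha j).integrable_conv hg ξ).const_mul _,
    ← integral_const_mul]
  refine integral_congr_ae (Eventually.of_forall fun η => ?_)
  have h := hdiv η
  simp only [Fin.sum_univ_three, RescaledNS.dHat, coord_sub] at h ⊢
  push_cast
  linear_combination (-(Complex.I * g (ξ - η))) * h

end BoxSpec

theorem fourierTr_sum {ι : Type*} (s : Finset ι) {G : ι → Dom → ℂ} (ζ : Freq)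
    (h : ∀ i ∈ s, Integrable (fun x => G i x * (starRingEnd ℂ) (character ζ x))) :
    fourierTr (fun x => ∑ i ∈ s, G i x) ζ = ∑ i ∈ s, fourierTr (G i) ζ := by
  unfold fourierTr
  simp_rw [Finset.sum_mul]
  exact integral_finsetSum s h

theorem fourierTr_add {G H : Dom → ℂ} (ζ : Freq)
    (hG : Integrable (fun x => G x * (starRingEnd ℂ) (character ζ x)))
    (hH : Integrable (fun x => H x * (starRingEnd ℂ) (character ζ x))) :
    fourierTr (fun x => G x + H x) ζ = fourierTr G ζ + fourierTr H ζ := by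
  unfold fourierTr
  simp_rw [add_mul]
  exact integral_add hG hH

namespace NiceField

variable {n : ℕ} {ε : ℝ} {u : Freq → Vec3}

theorem boxSpec_comp (h : NiceField n ε u) (hε : 0 < ε) (hε1 : ε ≤ 1) (j : Fin 3) :
    BoxSpec ⌈(n : ℝ) / ε⌉₊ (comp j u) where
  meas := measurable_comp h.meas j
  memLp := h.memLp.of_le (measurable_comp h.meas j).aestronglyMeasurable
    (Eventually.of_forall fun ξ => PiLp.norm_apply_le (u ξ) j)
  supp ξ hξ := abs_coord_le_of_epsNormSq_le hε hε1
    (h.supp ξ (fun h0 => hξ (by simp [comp, h0])))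

theorem comp_perpHat (u : Freq → Vec3) (j : Fin 3) : comp j (perpHat u) = perpHat (comp j u) := by
  ext ξ
  by_cases h : ξ.1 = 0 ∧ ξ.2.1 = 0 <;> simp [comp, perpHat, h]

theorem comp_meanHat (u : Freq → Vec3) (j : Fin 3) : comp j (meanHat u) = meanHat (comp j u) := by
  ext ξ
  by_cases h : ξ.1 = 0 ∧ ξ.2.1 = 0 <;> simp [comp, meanHat, h]

theorem boxSpec_perp (h : NiceField n ε u) (hε : 0 < ε) (hε1 : ε ≤ 1) (j : Fin 3) :
    BoxSpec ⌈(n : ℝ) / ε⌉₊ (comp j (perpHat u)) := by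
  rw [comp_perpHat]
  exact (h.boxSpec_comp hε hε1 j).indicator measurableSet_hor_eq_zero.compl

theorem boxSpec_mean (h : NiceField n ε u) (hε : 0 < ε) (hε1 : ε ≤ 1) (j : Fin 3) :
    BoxSpec ⌈(n : ℝ) / ε⌉₊ (comp j (meanHat u)) := by
  rw [comp_meanHat]
  exact (h.boxSpec_comp hε hε1 j).indicator measurableSet_hor_eq_zero

theorem div_perp (h : NiceField n ε u) (ξ : Freq) :
    ∑ j : Fin 3, (coord j ξ : ℂ) * comp j (perpHat u) ξ = 0 := by
  by_cases hξ : ξ.1 = 0 ∧ ξ.2.1 = 0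
  · simp [comp, perpHat, hξ]
  · simpa [comp, perpHat, hξ] using h.div ξ

theorem comp_two_perp (h : NiceField n ε u) : comp 2 (perpHat u) = comp 2 u := by
  ext ξ
  by_cases hξ : ξ.1 = 0 ∧ ξ.2.1 = 0
  · simp [comp, perpHat, hξ, h.mean ξ hξ]
  · simp [comp, perpHat, hξ]

theorem integrable_advect (h : NiceField n ε u) (hε : 0 < ε) (hε1 : ε ≤ 1) (i j : Fin 3)
    (ζ : Freq) : Integrable (fun x => fourierInv (comp j u) x *
      fourierInv (dHat j (comp i (perpHat u))) x * (starRingEnd ℂ) (character ζ x)) :=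
  (h.boxSpec_comp hε hε1 j).integrable_mul_conj ((h.boxSpec_perp hε hε1 i).dHat j) ζ

theorem fourierTr_advect (h : NiceField n ε u) (hε : 0 < ε) (hε1 : ε ≤ 1) (i : Fin 3) (ξ : Freq) :
    fourierTr (fun x => advect u i x) ξ
      = Complex.I * ∑ j : Fin 3, (coord j ξ : ℂ) * conv (comp j u) (comp i (perpHat u)) ξ := by
  unfold advect
  rw [fourierTr_sum _ _ fun j _ => h.integrable_advect hε hε1 i j ξ,
    ← BoxSpec.sum_conv_dHat (fun j => h.boxSpec_comp hε hε1 j) (h.boxSpec_perp hε hε1 i) h.div ξ]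
  exact Finset.sum_congr rfl fun j _ =>
    (h.boxSpec_comp hε hε1 j).fourierTr_mul ((h.boxSpec_perp hε hε1 i).dHat j) ξ

theorem dHat_mean_eq_zero (u : Freq → Vec3) (i : Fin 3) {j : Fin 3} (hj : j ≠ 2) :
    dHat j (comp i (meanHat u)) = 0 := by
  ext ξ
  by_cases hξ : ξ.1 = 0 ∧ ξ.2.1 = 0
  · fin_cases j
    · simp [dHat, coord, hξ]
    · simp [dHat, coord, hξ]
    · simp at hj
  · simp [dHat, comp, meanHat, hξ]

/-- The average depends only on `x₃`, so `w³ ∂₃ v̄^i = w · ∇ v̄^i`, which is the divergence of `w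
v̄^i` since `div w = 0`. -/
theorem fourierTr_advect_add_stretch (h : NiceField n ε u) (hε : 0 < ε) (hε1 : ε ≤ 1) (i : Fin 3)
    (ξ : Freq) :
    fourierTr (fun x => advect u i x + stretch u i x) ξ
      = Complex.I * ∑ j : Fin 3, (coord j ξ : ℂ) * (conv (comp j u) (comp i (perpHat u)) ξ
          + conv (comp j (perpHat u)) (comp i (meanHat u)) ξ) := by
  have hst : fourierTr (fun x => stretch u i x) ξ = Complex.I * ∑ j : Fin 3, (coord j ξ : ℂ) *
      conv (comp j (perpHat u)) (comp i (meanHat u)) ξ := by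
    rw [← BoxSpec.sum_conv_dHat (fun j => h.boxSpec_perp hε hε1 j) (h.boxSpec_mean hε hε1 i)
      h.div_perp ξ, Fin.sum_univ_three, dHat_mean_eq_zero u i (by decide : (0 : Fin 3) ≠ 2),
      dHat_mean_eq_zero u i (by decide : (1 : Fin 3) ≠ 2)]
    unfold stretch
    rw [(h.boxSpec_perp hε hε1 2).fourierTr_mul ((h.boxSpec_mean hε hε1 i).dHat 2) ξ]
    simp [conv]
  rw [fourierTr_add, fourierTr_advect h hε hε1, hst]
  · simp_rw [mul_add, Finset.sum_add_distrib]
    ring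
  · unfold advect
    simp_rw [Finset.sum_mul]
    exact integrable_finsetSum _ fun j _ => h.integrable_advect hε hε1 i j ξ
  · exact (h.boxSpec_perp hε hε1 2).integrable_mul_conj ((h.boxSpec_mean hε hε1 i).dHat 2) ξ

end NiceField

end RescaledNS

end

/-! ### Pointwise bounds on the quadratic terms -/

noncomputable section

namespace RescaledNS

open MeasureTheory Set Filter Topology
open scoped ENNReal


/-! ### Bounds on the quadratic terms -/

theorem enorm_conv_le (f g : Freq → ℂ) (ξ : Freq) :
    ‖conv f g ξ‖ₑ ≤ lconv (fun η => ‖f η‖ₑ) (fun η => ‖g η‖ₑ) ξ := by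
  refine (enorm_integral_le_lintegral_enorm _).trans (le_of_eq ?_)
  unfold lconv
  simp only [enorm_mul]

theorem lconv_mono {f f' g g' : Freq → ℝ≥0∞} (hf : ∀ η, f η ≤ f' η) (hg : ∀ η, g η ≤ g' η)
    (ξ : Freq) : lconv f g ξ ≤ lconv f' g' ξ :=
  lintegral_mono fun η => mul_le_mul' (hf η) (hg _)

theorem lossConv_mono {f f' g g' : Freq → ℝ≥0∞} (hf : ∀ η, f η ≤ f' η) (hg : ∀ η, g η ≤ g' η)
    (ξ : Freq) : lossConv f g ξ ≤ lossConv f' g' ξ :=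
  lintegral_mono fun η => mul_le_mul_right (mul_le_mul' (hf η) (hg _)) _

theorem lossConv_congr {f f' g g' : Freq → ℝ≥0∞} (hf : f =ᵐ[freqMeasure] f')
    (hg : g =ᵐ[freqMeasure] g') (ξ : Freq) : lossConv f g ξ = lossConv f' g' ξ := by
  have hg' := (Measure.measurePreserving_sub_left freqMeasure ξ).quasiMeasurePreserving.ae hg
  refine lintegral_congr_ae ?_
  filter_upwards [hf, hg'] with η h1 h2
  rw [h1, h2]

/-- Horizontal frequencies are integers. This spectral gap of the oscillating part gives both the
exponential decay in time and the transfer of horizontal derivatives. -/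
theorem one_le_horNorm {ξ : Freq} (h : ¬ (ξ.1 = 0 ∧ ξ.2.1 = 0)) : 1 ≤ horNorm ξ := by
  have key : ∀ k : ℤ, k ≠ 0 → (1 : ℝ) ≤ (k : ℝ) ^ 2 := by
    intro k hk
    have : (1 : ℤ) ≤ k ^ 2 := by have := sq_pos_of_ne_zero hk; omega
    exact_mod_cast this
  apply Real.one_le_sqrt.2
  have h0 := sq_nonneg (coord 0 ξ)
  have h1 := sq_nonneg (coord 1 ξ)
  by_cases hk : ξ.1 = 0
  · have : ξ.2.1 ≠ 0 := fun h' => h ⟨hk, h'⟩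
    have : 1 ≤ coord 1 ξ ^ 2 := key _ this
    linarith
  · have : 1 ≤ coord 0 ξ ^ 2 := key _ hk
    linarith

theorem abs_coord_le_horNorm {j : Fin 3} (hj : j ≠ 2) (ξ : Freq) : |coord j ξ| ≤ horNorm ξ := by
  apply Real.abs_le_sqrt
  fin_cases j
  · simp; positivity
  · simp; positivity
  · simp at hj

/-- A horizontal derivative on a factor of a product is controlled by a horizontal derivative of
the product and the lower of the two frequencies. -/
theorem horNorm_le_mul (ξ η : Freq) (h : 1 ≤ horNorm ξ) :
    ENNReal.ofReal (horNorm η)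
      ≤ ENNReal.ofReal (horNorm ξ) * (1 + min (eNorm η) (eNorm (ξ - η))) := by
  have hp := zero_le_one.trans h
  rw [eNorm, eNorm, ← ENNReal.ofReal_min, ← ENNReal.ofReal_one, ← ENNReal.ofReal_add zero_le_one
    (le_min (freqNorm_nonneg _) (freqNorm_nonneg _)), ← ENNReal.ofReal_mul hp]
  apply ENNReal.ofReal_le_ofReal
  rcases le_total (freqNorm η) (freqNorm (ξ - η)) with hle | hle
  · rw [min_eq_left hle]
    have := horNorm_le_freqNorm η
    nlinarith [freqNorm_nonneg η]
  · rw [min_eq_right hle]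
    have h1 := horNorm_add_le ξ (η - ξ)
    rw [add_sub_cancel] at h1
    have h2 : horNorm (η - ξ) = horNorm (ξ - η) := by
      unfold horNorm
      simp only [coord_sub]
      congr 1
      ring
    have h3 := horNorm_le_freqNorm (ξ - η)
    nlinarith [freqNorm_nonneg (ξ - η)]

theorem conv_comm (f g : Freq → ℂ) (ξ : Freq) : conv f g ξ = conv g f ξ := by
  unfold conv
  rw [← integral_sub_left_eq_self (fun η => f η * g (ξ - η)) freqMeasure ξ]
  simp_rw [sub_sub_cancel, mul_comm]

theorem norm_comp_le (u : Freq → Vec3) (j : Fin 3) (η : Freq) : ‖comp j u η‖ₑ ≤ ‖u η‖ₑ := by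
  rw [enorm_le_iff_norm_le]
  exact PiLp.norm_apply_le (u η) j

theorem norm_comp_le_hor (u : Freq → Vec3) {j : Fin 3} (hj : j ≠ 2) (η : Freq) :
    ‖comp j u η‖ₑ ≤ ‖hor u η‖ₑ := by
  rw [enorm_le_iff_norm_le]
  fin_cases j
  · exact PiLp.norm_apply_le (hor u η) 0
  · exact PiLp.norm_apply_le (hor u η) 1
  · simp at hj

theorem norm_hor_le (u : Freq → Vec3) (η : Freq) : ‖hor u η‖ₑ ≤ ‖u η‖ₑ := by
  rw [enorm_le_iff_norm_le, EuclideanSpace.norm_eq, EuclideanSpace.norm_eq]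
  apply Real.sqrt_le_sqrt
  simp [hor, Fin.sum_univ_three, Fin.sum_univ_two]

theorem norm_perpHat_le (u : Freq → Vec3) (η : Freq) : ‖perpHat u η‖ₑ ≤ ‖u η‖ₑ := by
  by_cases h : η.1 = 0 ∧ η.2.1 = 0 <;> simp [perpHat, h]

theorem norm_meanHat_le (u : Freq → Vec3) (η : Freq) : ‖meanHat u η‖ₑ ≤ ‖u η‖ₑ := by
  by_cases h : η.1 = 0 ∧ η.2.1 = 0 <;> simp [meanHat, h]

/-- The size of the oscillating part: `|w³| + ε |w^h|`. -/
def oscSize (ε : ℝ) (w : Freq → Vec3) (ξ : Freq) : ℝ≥0∞ :=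
  ‖comp 2 w ξ‖ₑ + ENNReal.ofReal ε * ‖hor w ξ‖ₑ

theorem lossConv_vert_le (ε : ℝ) (w : Freq → Vec3) (g : Freq → ℝ≥0∞) (ξ : Freq) :
    lossConv (fun η => ‖comp 2 w η‖ₑ) g ξ ≤ lossConv (oscSize ε w) g ξ :=
  lossConv_mono (fun _ => le_self_add) (fun _ => le_rfl) ξ

theorem lossConv_hor_le (ε : ℝ) (w : Freq → Vec3) (g : Freq → ℝ≥0∞) (ξ : Freq) :
    ENNReal.ofReal ε * lossConv (fun η => ‖hor w η‖ₑ) g ξ ≤ lossConv (oscSize ε w) g ξ := by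
  unfold lossConv
  rw [← lintegral_const_mul' _ _ ENNReal.ofReal_ne_top]
  refine lintegral_mono fun η => ?_
  have : ENNReal.ofReal ε * ‖hor w η‖ₑ ≤ oscSize ε w η := le_add_self
  calc ENNReal.ofReal ε * ((1 + min (eNorm η) (eNorm (ξ - η))) * (‖hor w η‖ₑ * g (ξ - η)))
      = (1 + min (eNorm η) (eNorm (ξ - η))) * ((ENNReal.ofReal ε * ‖hor w η‖ₑ) * g (ξ - η)) := by
        ring
    _ ≤ _ := by gcongr

namespace NiceField

variable {n : ℕ} {ε : ℝ} {u : Freq → Vec3}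

/-- The majorant of the quadratic terms. -/
def majorant (ε : ℝ) (u : Freq → Vec3) (ξ : Freq) : ℝ≥0∞ :=
  lossConv (oscSize ε (perpHat u)) (fun η => ‖u η‖ₑ) ξ

theorem lconv_vert_le (u : Freq → Vec3) (ξ : Freq) :
    lconv (fun η => ‖comp 2 (perpHat u) η‖ₑ) (fun η => ‖u η‖ₑ) ξ ≤ majorant ε u ξ :=
  (lconv_le_lossConv _ _ ξ).trans (lossConv_vert_le ε _ _ ξ)

theorem lconv_hor_le (u : Freq → Vec3) (ξ : Freq) :
    ENNReal.ofReal ε * lconv (fun η => ‖hor (perpHat u) η‖ₑ) (fun η => ‖u η‖ₑ) ξ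
      ≤ majorant ε u ξ :=
  (mul_le_mul_right (lconv_le_lossConv _ _ ξ) _).trans (lossConv_hor_le ε _ _ ξ)

theorem enorm_conv_vert_le (u : Freq → Vec3) (j : Fin 3) (ξ : Freq) :
    ‖conv (comp j u) (comp 2 (perpHat u)) ξ‖ₑ ≤ majorant ε u ξ := by
  rw [conv_comm]
  exact (enorm_conv_le _ _ ξ).trans ((lconv_mono (fun _ => le_rfl)
    (fun η => norm_comp_le u j η) ξ).trans (lconv_vert_le u ξ))

/-- In the vertical flux of `w^i` both terms contain `w³`, because `v³ = w³`. Hence this flux needs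
no factor `ε`, and the `ε` of the horizontal estimate remains available for `∂₃`. -/
theorem enorm_add_conv_vert_le (h : NiceField n ε u) (i : Fin 3) (ξ : Freq) :
    ‖conv (comp 2 u) (comp i (perpHat u)) ξ + conv (comp 2 (perpHat u)) (comp i (meanHat u)) ξ‖ₑ
      ≤ 2 * majorant ε u ξ := by
  rw [two_mul, ← h.comp_two_perp]
  refine (enorm_add_le _ _).trans (add_le_add ?_ ?_)
  · exact (enorm_conv_le _ _ ξ).trans ((lconv_mono (fun _ => le_rfl)
      (fun η => (norm_comp_le _ i η).trans (norm_perpHat_le u η)) ξ).trans (lconv_vert_le u ξ))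
  · exact (enorm_conv_le _ _ ξ).trans ((lconv_mono (fun _ => le_rfl)
      (fun η => (norm_comp_le _ i η).trans (norm_meanHat_le u η)) ξ).trans (lconv_vert_le u ξ))

/-- Each horizontal flux contains a component of `w^h`: `w^i` in the first term, `w^j` in the
second. It enters `oscSize` only after multiplication by `ε`. -/
theorem enorm_add_conv_hor_le (u : Freq → Vec3) {i j : Fin 3} (hi : i ≠ 2) (hj : j ≠ 2)
    (ξ : Freq) :
    ENNReal.ofReal ε *
      ‖conv (comp j u) (comp i (perpHat u)) ξ + conv (comp j (perpHat u)) (comp i (meanHat u)) ξ‖ₑ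
      ≤ 2 * majorant ε u ξ := by
  have h1 : ‖conv (comp j u) (comp i (perpHat u)) ξ‖ₑ
      ≤ lconv (fun η => ‖hor (perpHat u) η‖ₑ) (fun η => ‖u η‖ₑ) ξ := by
    rw [conv_comm]
    exact (enorm_conv_le _ _ ξ).trans (lconv_mono (fun η => norm_comp_le_hor _ hi η)
      (fun η => norm_comp_le _ j η) ξ)
  have h2 : ‖conv (comp j (perpHat u)) (comp i (meanHat u)) ξ‖ₑ
      ≤ lconv (fun η => ‖hor (perpHat u) η‖ₑ) (fun η => ‖u η‖ₑ) ξ :=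
    (enorm_conv_le _ _ ξ).trans (lconv_mono (fun η => norm_comp_le_hor _ hj η)
      (fun η => (norm_comp_le _ i η).trans (norm_meanHat_le u η)) ξ)
  calc _ ≤ ENNReal.ofReal ε * (lconv (fun η => ‖hor (perpHat u) η‖ₑ) (fun η => ‖u η‖ₑ) ξ
        + lconv (fun η => ‖hor (perpHat u) η‖ₑ) (fun η => ‖u η‖ₑ) ξ) := by
        gcongr
        exact (enorm_add_le _ _).trans (add_le_add h1 h2)
    _ ≤ majorant ε u ξ + majorant ε u ξ := by
        rw [mul_add]
        exact add_le_add (lconv_hor_le u ξ) (lconv_hor_le u ξ)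
    _ = _ := (two_mul _).symm

/-- The vertical derivative of `w³ w³` is a product with a horizontal derivative. -/
theorem coord_mul_conv_vert (h : NiceField n ε u) (hε : 0 < ε) (hε1 : ε ≤ 1) (ξ : Freq) :
    (coord 2 ξ : ℂ) * conv (comp 2 u) (comp 2 (perpHat u)) ξ
      = -2 * ∫ η, ((coord 0 η : ℂ) * comp 0 (perpHat u) η + (coord 1 η : ℂ) * comp 1 (perpHat u) η)
          * comp 2 (perpHat u) (ξ - η) ∂freqMeasure := by
  rw [← h.comp_two_perp]
  set f := comp 2 (perpHat u) with hf
  have hb : BoxSpec ⌈(n : ℝ) / ε⌉₊ f := h.boxSpec_perp hε hε1 2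
  have e1 : conv (dHat 2 f) f ξ = conv f (dHat 2 f) ξ := conv_comm _ _ _
  have e2 : conv (dHat 2 f) f ξ + conv f (dHat 2 f) ξ = Complex.I * (coord 2 ξ * conv f f ξ) := by
    unfold conv
    rw [← integral_add ((hb.dHat 2).integrable_conv hb ξ) (hb.integrable_conv (hb.dHat 2) ξ),
      ← integral_const_mul, ← integral_const_mul]
    refine integral_congr_ae (Eventually.of_forall fun η => ?_)
    simp only [dHat, coord_sub]
    push_cast
    ring
  have e3 : conv (dHat 2 f) f ξ = -(Complex.I * ∫ η, ((coord 0 η : ℂ) * comp 0 (perpHat u) η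
      + (coord 1 η : ℂ) * comp 1 (perpHat u) η) * f (ξ - η) ∂freqMeasure) := by
    unfold conv
    rw [← integral_const_mul, ← integral_neg]
    refine integral_congr_ae (Eventually.of_forall fun η => ?_)
    have hd := h.div_perp η
    rw [Fin.sum_univ_three] at hd
    simp only [dHat]
    linear_combination (Complex.I * f (ξ - η)) * hd
  rw [← e1, e3] at e2
  have hI := Complex.I_ne_zero
  apply mul_left_cancel₀ hI
  rw [← e2]
  ring

/-- This is the term with a vertical derivative and no `ε`. After `coord_mul_conv_vert` the
horizontal derivative acts on `w^h`, which is bounded by `|u|`, and `w³` remains as the small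
factor; `horNorm_le_mul` then moves the derivative to the product. The constant is 2 from the
product rule times 2 for the horizontal components. -/
theorem enorm_coord_mul_conv_vert_le (h : NiceField n ε u) (hε : 0 < ε) (hε1 : ε ≤ 1) {ξ : Freq}
    (hξ : 1 ≤ horNorm ξ) :
    ‖(coord 2 ξ : ℂ) * conv (comp 2 u) (comp 2 (perpHat u)) ξ‖ₑ
      ≤ 4 * (ENNReal.ofReal (horNorm ξ) * majorant ε u ξ) := by
  rw [h.coord_mul_conv_vert hε hε1, enorm_mul]
  have h2 : ‖(-2 : ℂ)‖ₑ = 2 := by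
    rw [enorm_neg, ← ofReal_norm]; simp
  rw [h2, show (4 : ℝ≥0∞) = 2 * 2 by norm_num, mul_assoc]
  gcongr
  refine (enorm_integral_le_lintegral_enorm _).trans ?_
  have hpt : ∀ η, ‖((coord 0 η : ℂ) * comp 0 (perpHat u) η + (coord 1 η : ℂ) * comp 1 (perpHat u) η)
          * comp 2 (perpHat u) (ξ - η)‖ₑ ≤ (2 * ENNReal.ofReal (horNorm ξ)) *
          ((1 + min (eNorm η) (eNorm (ξ - η))) *
            (‖u η‖ₑ * ‖comp 2 (perpHat u) (ξ - η)‖ₑ)) := by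
    intro η
    have hc : ∀ j : Fin 3, j ≠ 2 → ‖(coord j η : ℂ) * comp j (perpHat u) η‖ₑ
        ≤ ENNReal.ofReal (horNorm ξ) * (1 + min (eNorm η) (eNorm (ξ - η))) * ‖u η‖ₑ := by
      intro j hj
      rw [enorm_mul]
      refine mul_le_mul' ?_ ((norm_comp_le _ j η).trans (norm_perpHat_le u η))
      refine le_trans ?_ (horNorm_le_mul ξ η hξ)
      rw [← ofReal_norm, Complex.norm_real]
      exact ENNReal.ofReal_le_ofReal (abs_coord_le_horNorm hj η)
    rw [enorm_mul]
    calc _ ≤ (ENNReal.ofReal (horNorm ξ) * (1 + min (eNorm η) (eNorm (ξ - η))) * ‖u η‖ₑ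
          + ENNReal.ofReal (horNorm ξ) * (1 + min (eNorm η) (eNorm (ξ - η))) * ‖u η‖ₑ)
          * ‖comp 2 (perpHat u) (ξ - η)‖ₑ := by
          gcongr
          exact (enorm_add_le _ _).trans (add_le_add (hc 0 (by decide)) (hc 1 (by decide)))
      _ = _ := by ring
  refine (lintegral_mono hpt).trans ?_
  rw [lintegral_const_mul' _ _ (ENNReal.mul_ne_top (by norm_num) ENNReal.ofReal_ne_top), mul_assoc]
  gcongr
  change lossConv (fun η => ‖u η‖ₑ) (fun η => ‖comp 2 (perpHat u) η‖ₑ) ξ ≤ _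
  rw [lossConv_comm]
  exact lossConv_vert_le ε _ _ ξ

end NiceField

end RescaledNS

end

/-! ### Elimination of the pressure -/

noncomputable section

namespace RescaledNS

open MeasureTheory Set Filter Topology
open scoped ENNReal


/-! ### Elimination of the pressure -/

theorem norm_three_le {a0 a1 a2 b0 b1 b2 : ℝ} {P0 P1 P2 : ℂ} (h0 : ‖(a0 : ℂ) * P0‖ ≤ b0)
    (h1 : ‖(a1 : ℂ) * P1‖ ≤ b1) (h2 : ‖(a2 : ℂ) * P2‖ ≤ b2) :
    ‖Complex.I * (a0 * P0 + a1 * P1 + a2 * P2)‖ ≤ b0 + b1 + b2 := by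
  rw [norm_mul, Complex.norm_I, one_mul]
  exact (norm_add₃_le).trans (by linarith)

/-- Two horizontal or rescaled vertical components are dominated by the rescaled frequency. -/
theorem pressure_elimination {a0 a1 a2 ε x K : ℝ} {A0 A1 A2 F0 F1 F2 q : ℂ} (hε : 0 < ε)
    (hx : 0 < x) (hX : a0 ^ 2 + a1 ^ 2 + ε ^ 2 * a2 ^ 2 = x ^ 2)
    (e0 : A0 + (F0 + Complex.I * a0 * q) = 0) (e1 : A1 + (F1 + Complex.I * a1 * q) = 0)
    (e2 : A2 + (F2 + (ε : ℂ) ^ 2 * (Complex.I * a2 * q)) = 0)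
    (hdiv : (a0 : ℂ) * A0 + a1 * A1 + a2 * A2 = 0)
    (hF0 : ε * ‖F0‖ ≤ K) (hF1 : ε * ‖F1‖ ≤ K) (hF2 : ‖F2‖ ≤ K) :
    ‖A2‖ ≤ 3 * K ∧ ε * ‖A0‖ ≤ 3 * K ∧ ε * ‖A1‖ ≤ 3 * K := by
  have hXc : (a0 : ℂ) ^ 2 + a1 ^ 2 + ε ^ 2 * a2 ^ 2 = x ^ 2 := by exact_mod_cast hX
  have b0 : |a0| ≤ x := abs_le_of_sq_le_sq (by nlinarith [sq_nonneg a1, sq_nonneg (ε * a2)]) hx.le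
  have b1 : |a1| ≤ x := abs_le_of_sq_le_sq (by nlinarith [sq_nonneg a0, sq_nonneg (ε * a2)]) hx.le
  have b2 : |ε * a2| ≤ x :=
    abs_le_of_sq_le_sq (by nlinarith [sq_nonneg a0, sq_nonneg a1]) hx.le
  have prod_le : ∀ {a b : ℝ} {F : ℂ}, |a| ≤ x → |b| ≤ x → ‖F‖ ≤ K →
      ‖(a : ℂ) * (b : ℂ) * F‖ ≤ x ^ 2 * K := by
    intro a b F ha hb hF
    rw [norm_mul, norm_mul, Complex.norm_real, Complex.norm_real, Real.norm_eq_abs,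
      Real.norm_eq_abs, sq]
    gcongr
  have eps_le : ∀ {F : ℂ}, ε * ‖F‖ ≤ K → ‖(ε : ℂ) * F‖ ≤ K := by
    intro F hF
    rwa [norm_mul, Complex.norm_real, Real.norm_of_nonneg hε.le]
  have hF0' := eps_le hF0
  have hF1' := eps_le hF1
  have diag_le : ∀ {y : ℝ} {F : ℂ}, 0 ≤ y → y ≤ x ^ 2 → ‖F‖ ≤ K →
      ‖(y : ℂ) * F‖ ≤ x ^ 2 * K := by
    intro y F h0 h1 hF
    rw [norm_mul, Complex.norm_real, Real.norm_of_nonneg h0]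
    gcongr
  have finish : ∀ {A G1 G2 G3 : ℂ}, (x : ℂ) ^ 2 * A = -G1 + G2 + G3 → ‖G1‖ ≤ x ^ 2 * K →
      ‖G2‖ ≤ x ^ 2 * K → ‖G3‖ ≤ x ^ 2 * K → ‖A‖ ≤ 3 * K := by
    intro A G1 G2 G3 hA h1 h2 h3
    have hn : ‖(x : ℂ) ^ 2 * A‖ ≤ x ^ 2 * (3 * K) := by
      rw [hA]
      refine norm_add₃_le.trans ?_
      rw [norm_neg]
      linarith
    rw [norm_mul, norm_pow, Complex.norm_real, Real.norm_of_nonneg hx.le] at hn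
    exact le_of_mul_le_mul_left hn (by positivity)
  -- The divergence of the system: the `A` terms cancel and the pressure is multiplied by `a₀² + a₁²
  -- + ε²a₂² = x²`.
  have hq : Complex.I * q * x ^ 2 = -(a0 * F0 + a1 * F1 + a2 * F2) := by
    linear_combination (a0 : ℂ) * e0 + a1 * e1 + a2 * e2 - hdiv - Complex.I * q * hXc
  refine ⟨?_, ?_, ?_⟩
  -- Inserting `q` cancels part of the diagonal term. The factor `ε²` in front of `F0` and `F1` is
  -- split: one `ε` goes with `a2`, bounded by `x`, and one with the force, bounded by `K`.
  · refine finish (G1 := ((a0 ^ 2 + a1 ^ 2 : ℝ) : ℂ) * F2)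
      (G2 := ((ε * a2 : ℝ) : ℂ) * (a0 : ℂ) * (ε * F0))
      (G3 := ((ε * a2 : ℝ) : ℂ) * (a1 : ℂ) * (ε * F1)) ?_
      (diag_le (by positivity) (by nlinarith [sq_nonneg (ε * a2)]) hF2)
      (prod_le b2 b0 hF0') (prod_le b2 b1 hF1')
    push_cast
    linear_combination (x : ℂ) ^ 2 * e2 - (ε : ℂ) ^ 2 * a2 * hq + F2 * hXc
  · rw [← Real.norm_of_nonneg hε.le, ← Complex.norm_real, ← norm_mul]
    refine finish (G1 := ((a1 ^ 2 + ε ^ 2 * a2 ^ 2 : ℝ) : ℂ) * (ε * F0))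
      (G2 := (a0 : ℂ) * (a1 : ℂ) * (ε * F1))
      (G3 := (a0 : ℂ) * ((ε * a2 : ℝ) : ℂ) * F2) ?_
      (diag_le (by positivity) (by nlinarith [sq_nonneg a0]) hF0')
      (prod_le b0 b1 hF1') (prod_le b0 b2 hF2)
    push_cast
    linear_combination (ε : ℂ) * (x : ℂ) ^ 2 * e0 - (ε : ℂ) * a0 * hq + ε * F0 * hXc
  · rw [← Real.norm_of_nonneg hε.le, ← Complex.norm_real, ← norm_mul]
    refine finish (G1 := ((a0 ^ 2 + ε ^ 2 * a2 ^ 2 : ℝ) : ℂ) * (ε * F1))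
      (G2 := (a1 : ℂ) * (a0 : ℂ) * (ε * F0))
      (G3 := (a1 : ℂ) * ((ε * a2 : ℝ) : ℂ) * F2) ?_
      (diag_le (by positivity) (by nlinarith [sq_nonneg a1]) hF1')
      (prod_le b1 b0 hF0') (prod_le b1 b2 hF2)
    push_cast
    linear_combination (ε : ℂ) * (x : ℂ) ^ 2 * e1 - (ε : ℂ) * a1 * hq + ε * F1 * hXc

theorem horNorm_le_sqrt_epsNormSq (ε : ℝ) (ξ : Freq) : horNorm ξ ≤ √(epsNormSq ε ξ) :=
  Real.sqrt_le_sqrt (by unfold epsNormSq; nlinarith [sq_nonneg (ε * coord 2 ξ)])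

theorem eps_mul_abs_coord_le {ε : ℝ} (hε : 0 < ε) (ξ : Freq) :
    ε * |coord 2 ξ| ≤ √(epsNormSq ε ξ) := by
  rw [← abs_of_pos hε, ← abs_mul, abs_of_pos hε]
  apply Real.abs_le_sqrt
  unfold epsNormSq
  nlinarith [sq_nonneg (coord 0 ξ), sq_nonneg (coord 1 ξ)]

theorem norm_le_of_enorm_le {z : ℂ} {k : ℝ} {β : ℝ≥0∞} (hk : 0 ≤ k) (hβ : β ≠ ∞)
    (h : ‖z‖ₑ ≤ ENNReal.ofReal k * β) : ‖z‖ ≤ k * β.toReal := by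
  have := ENNReal.toReal_mono (ENNReal.mul_ne_top ENNReal.ofReal_ne_top hβ) h
  rwa [toReal_enorm, ENNReal.toReal_mul, ENNReal.toReal_ofReal hk] at this

/-- The forcing in the heat equations satisfied by the oscillating part is controlled by one
rescaled derivative of the majorant. -/
theorem NiceField.forcing_le {n : ℕ} {ε : ℝ} {u : Freq → Vec3} (h : NiceField n ε u) (hε : 0 < ε)
    (hε1 : ε ≤ 1) {ξ : Freq} (hξ : ¬ (ξ.1 = 0 ∧ ξ.2.1 = 0)) {A : Vec3} {q : ℂ}
    (hh : ∀ i : Fin 3, i ≠ 2 →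
      A i + (fourierTr (fun x => advect u i x + stretch u i x) ξ
        + Complex.I * (coord i ξ : ℂ) * q) = 0)
    (hv : A 2 + (fourierTr (fun x => advect u 2 x) ξ
        + (ε : ℂ) ^ 2 * (Complex.I * (coord 2 ξ : ℂ) * q)) = 0)
    (hdiv : ∑ j : Fin 3, (coord j ξ : ℂ) * A j = 0) :
    ‖A 2‖ₑ ≤ 36 * (ENNReal.ofReal √(epsNormSq ε ξ) * majorant ε u ξ) ∧
      ENNReal.ofReal ε * ‖(!₂[A 0, A 1] : Vec2)‖ₑ
        ≤ 36 * (ENNReal.ofReal √(epsNormSq ε ξ) * majorant ε u ξ) := by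
  set x := √(epsNormSq ε ξ) with hxdef
  have h1 := one_le_horNorm hξ
  have hhx := horNorm_le_sqrt_epsNormSq ε ξ
  rw [← hxdef] at hhx
  have hx1 : 1 ≤ x := h1.trans hhx
  have hx : 0 < x := by linarith
  -- Where the majorant is infinite the bound is void; elsewhere the estimate is carried out in real
  -- numbers.
  by_cases hβ : majorant ε u ξ = ∞
  · rw [hβ, ENNReal.mul_top (by simpa using hx)]
    simp
  set B := (majorant ε u ξ).toReal with hB
  have hB0 : 0 ≤ B := ENNReal.toReal_nonneg
  have hX : coord 0 ξ ^ 2 + coord 1 ξ ^ 2 + ε ^ 2 * coord 2 ξ ^ 2 = x ^ 2 := by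
    rw [hxdef, Real.sq_sqrt (epsNormSq_nonneg ε ξ)]; rfl
  have c0 := abs_coord_le_horNorm (by decide : (0 : Fin 3) ≠ 2) ξ
  have c1 := abs_coord_le_horNorm (by decide : (1 : Fin 3) ≠ 2) ξ
  have c2 := eps_mul_abs_coord_le hε ξ
  rw [← hxdef] at c2
  have hQ : ∀ j, ‖conv (comp j u) (comp 2 (perpHat u)) ξ‖ ≤ 1 * B := fun j =>
    norm_le_of_enorm_le zero_le_one hβ (by simpa using enorm_conv_vert_le u j ξ)
  have hQ2 : ‖(coord 2 ξ : ℂ) * conv (comp 2 u) (comp 2 (perpHat u)) ξ‖ ≤ 4 * horNorm ξ * B := by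
    refine norm_le_of_enorm_le (by positivity) hβ ?_
    rw [ENNReal.ofReal_mul (by norm_num), mul_assoc]
    simpa using h.enorm_coord_mul_conv_vert_le hε hε1 h1
  have hP2 : ∀ i, ‖conv (comp 2 u) (comp i (perpHat u)) ξ
      + conv (comp 2 (perpHat u)) (comp i (meanHat u)) ξ‖ ≤ 2 * B := fun i =>
    norm_le_of_enorm_le (by norm_num) hβ (by simpa using h.enorm_add_conv_vert_le i ξ)
  have hP : ∀ i j : Fin 3, i ≠ 2 → j ≠ 2 → ε * ‖conv (comp j u) (comp i (perpHat u)) ξ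
      + conv (comp j (perpHat u)) (comp i (meanHat u)) ξ‖ ≤ 2 * B := by
    intro i j hi hj
    have := norm_le_of_enorm_le (z := (ε : ℂ) * (conv (comp j u) (comp i (perpHat u)) ξ
      + conv (comp j (perpHat u)) (comp i (meanHat u)) ξ)) (k := 2) (by norm_num) hβ (by
        have e : ‖(ε : ℂ)‖ₑ = ENNReal.ofReal ε := by
          rw [← ofReal_norm, Complex.norm_real, Real.norm_of_nonneg hε.le]
        rw [enorm_mul, e]
        simpa using enorm_add_conv_hor_le u hi hj ξ)
    rwa [norm_mul, Complex.norm_real, Real.norm_of_nonneg hε.le] at this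
  have mulle : ∀ {a b : ℝ} {z : ℂ}, |a| ≤ horNorm ξ → ‖z‖ ≤ b → ‖(a : ℂ) * z‖ ≤ x * b := by
    intro a b z ha hz
    rw [norm_mul, Complex.norm_real, Real.norm_eq_abs]
    exact mul_le_mul (ha.trans hhx) hz (norm_nonneg _) hx.le
  -- The constant is `1 + 1` for the horizontal derivatives and 4 for `∂₃(w³w³)`.
  have hF2 : ‖fourierTr (fun x => advect u 2 x) ξ‖ ≤ 6 * (x * B) := by
    rw [h.fourierTr_advect hε hε1, Fin.sum_univ_three]
    refine (norm_three_le (mulle c0 (hQ 0)) (mulle c1 (hQ 1)) hQ2).trans ?_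
    nlinarith [mul_le_mul_of_nonneg_right hhx hB0]
  -- Here 6 is three derivatives times the 2 in the flux bounds; the vertical one consumes the `ε`
  -- through `ε|ξ₃| ≤ x`.
  have hF : ∀ i : Fin 3, i ≠ 2 →
      ε * ‖fourierTr (fun x => advect u i x + stretch u i x) ξ‖ ≤ 6 * (x * B) := by
    intro i hi
    rw [h.fourierTr_advect_add_stretch hε hε1, Fin.sum_univ_three]
    have k0 : ∀ {a : ℝ} {z : ℂ}, |a| ≤ horNorm ξ → ε * ‖z‖ ≤ 2 * B →
        ‖(a : ℂ) * z‖ ≤ x * (2 * B) / ε := by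
      intro a z ha hz
      rw [le_div_iff₀ hε, norm_mul, Complex.norm_real, Real.norm_eq_abs, mul_assoc, mul_comm _ ε]
      exact mul_le_mul (ha.trans hhx) hz (by positivity) hx.le
    have k2 : ‖(coord 2 ξ : ℂ) * (conv (comp 2 u) (comp i (perpHat u)) ξ
      + conv (comp 2 (perpHat u)) (comp i (meanHat u)) ξ)‖ ≤ x * (2 * B) / ε := by
      rw [le_div_iff₀ hε, norm_mul, Complex.norm_real, Real.norm_eq_abs, mul_right_comm,
        mul_comm _ ε]
      exact mul_le_mul c2 (hP2 i) (norm_nonneg _) hx.le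
    have := norm_three_le (k0 c0 (hP i 0 hi (by decide))) (k0 c1 (hP i 1 hi (by decide))) k2
    calc _ ≤ ε * (x * (2 * B) / ε + x * (2 * B) / ε + x * (2 * B) / ε) := by gcongr
      _ = 6 * (x * B) := by field_simp; ring
  rw [Fin.sum_univ_three] at hdiv
  -- The pressure turns 6 into 18 per component; adding the two horizontal components gives 36.
  obtain ⟨r2, r0, r1⟩ := pressure_elimination (K := 6 * (x * B)) hε hx hX
    (hh 0 (by decide)) (hh 1 (by decide)) hv hdiv (hF 0 (by decide)) (hF 1 (by decide)) hF2
  have hR : 36 * (ENNReal.ofReal x * majorant ε u ξ) = ENNReal.ofReal (36 * (x * B)) := by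
    rw [ENNReal.ofReal_mul (by norm_num), ENNReal.ofReal_mul hx.le, hB, ENNReal.ofReal_toReal hβ]
    simp
  rw [hR]
  constructor
  · rw [← ofReal_norm]
    apply ENNReal.ofReal_le_ofReal
    have : 0 ≤ x * B := by positivity
    linarith
  · rw [← ofReal_norm, ← ENNReal.ofReal_mul hε.le]
    apply ENNReal.ofReal_le_ofReal
    have hn : ‖(!₂[A 0, A 1] : Vec2)‖ ≤ ‖A 0‖ + ‖A 1‖ := by
      rw [EuclideanSpace.norm_eq]
      apply Real.sqrt_le_iff.2
      refine ⟨by positivity, ?_⟩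
      simp [Fin.sum_univ_two]
      nlinarith [norm_nonneg (A 0), norm_nonneg (A 1)]
    calc ε * ‖(!₂[A 0, A 1] : Vec2)‖ ≤ ε * (‖A 0‖ + ‖A 1‖) := by gcongr
      _ ≤ 36 * (x * B) := by linarith

end RescaledNS

end

/-! ### Kernels in time -/

noncomputable section

namespace RescaledNS

open MeasureTheory Set Filter Topology
open scoped ENNReal


/-! ### Kernels in time -/

theorem sqrt_sub_sqrt_le {s t : ℝ} (hs : 0 ≤ s) (hst : s ≤ t) : √t - √s ≤ √(t - s) := by
  rw [sub_le_iff_le_add, Real.sqrt_le_iff]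
  refine ⟨by positivity, ?_⟩
  have h1 := Real.sq_sqrt hs
  have h2 := Real.sq_sqrt (sub_nonneg.2 hst)
  nlinarith [mul_nonneg (Real.sqrt_nonneg s) (Real.sqrt_nonneg (t - s))]

/-- A majorant of `x exp (-τ x² + √τ x)` for `x ≥ 1`. -/
def heatKernel (τ : ℝ) : ℝ := Real.exp (1 / 2) * (τ ^ (-(1 / 2) : ℝ) * Real.exp (-(1 / 4) * τ))

/-- With `y = √τ x`, `-y² + y ≤ 1/2 - y²/2`. One `y²/4` gives the decay `e^{-τ/4}`, since `y² ≥ τ`;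
the other absorbs the prefactor through `y e^{-y²/4} ≤ 1`. Writing `x = y/√τ` leaves the integrable
singularity `τ^{-1/2}`. -/
theorem mul_exp_le_heatKernel {τ x h : ℝ} (hτ : 0 < τ) (hx : 1 ≤ x) (hh : h ≤ x) :
    x * Real.exp (-(τ * x ^ 2) + √τ * h) ≤ heatKernel τ := by
  set y := √τ * x with hy
  have hs : 0 < √τ := Real.sqrt_pos.2 hτ
  have hsq : √τ ^ 2 = τ := Real.sq_sqrt hτ.le
  have hy2 : y ^ 2 = τ * x ^ 2 := by rw [hy, mul_pow, hsq]
  have hyτ : τ ≤ y ^ 2 := by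
    rw [hy2]; exact le_mul_of_one_le_right hτ.le (one_le_pow₀ hx)
  have h1 : -(τ * x ^ 2) + √τ * h ≤ 1 / 2 + -(y ^ 2 / 4) + -(1 / 4) * τ := by
    have : √τ * h ≤ y := by rw [hy]; gcongr
    nlinarith [sq_nonneg (y - 1)]
  have h2 : y * Real.exp (-(y ^ 2 / 4)) ≤ 1 := by
    rw [Real.exp_neg, ← div_eq_mul_inv, div_le_one (Real.exp_pos _)]
    have := Real.add_one_le_exp (y ^ 2 / 4)
    nlinarith [sq_nonneg (y - 2)]
  have h3 : τ ^ (-(1 / 2) : ℝ) = (√τ)⁻¹ := by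
    rw [Real.rpow_neg hτ.le, Real.sqrt_eq_rpow]
  have hxy : x = (√τ)⁻¹ * y := by rw [hy]; field_simp
  calc x * Real.exp (-(τ * x ^ 2) + √τ * h)
      ≤ x * Real.exp (1 / 2 + -(y ^ 2 / 4) + -(1 / 4) * τ) := by gcongr
    _ = Real.exp (1 / 2) * ((√τ)⁻¹ * Real.exp (-(1 / 4) * τ)) * (y * Real.exp (-(y ^ 2 / 4))) := by
        rw [Real.exp_add, Real.exp_add]
        nth_rewrite 1 [hxy]
        ring
    _ ≤ Real.exp (1 / 2) * ((√τ)⁻¹ * Real.exp (-(1 / 4) * τ)) * 1 := by gcongr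
    _ = heatKernel τ := by rw [heatKernel, h3, mul_one]

/-- The mass of `heatKernel`. -/
def heatMass : ℝ≥0∞ := ∫⁻ τ in Ioi 0, ENNReal.ofReal (heatKernel τ)

theorem heatMass_ne_top : heatMass ≠ ∞ := by
  have h := integrableOn_rpow_mul_exp_neg_mul_rpow (s := -(1 / 2)) (p := 1) (b := 1 / 4)
    (by norm_num) (by norm_num) (by norm_num)
  simp only [Real.rpow_one] at h
  have h2 : IntegrableOn heatKernel (Ioi 0) := h.const_mul (Real.exp (1 / 2))
  have h3 := h2.2
  rw [HasFiniteIntegral] at h3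
  refine (lt_of_le_of_lt (lintegral_mono fun τ => ?_) h3).ne
  rw [← ofReal_norm]
  exact ENNReal.ofReal_le_ofReal (le_abs_self _)

theorem measurable_heatKernel : Measurable heatKernel := by
  unfold heatKernel
  fun_prop

theorem lintegral_heatKernel_sub_le (t : ℝ) :
    ∫⁻ s in Ioo 0 t, ENNReal.ofReal (heatKernel (t - s)) ≤ heatMass := by
  have hm := measurable_heatKernel
  calc ∫⁻ s in Ioo 0 t, ENNReal.ofReal (heatKernel (t - s))
      = ∫⁻ s, (Ioo 0 t).indicator (fun s => ENNReal.ofReal (heatKernel (t - s))) s :=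
        (lintegral_indicator measurableSet_Ioo _).symm
    _ ≤ ∫⁻ s, (fun τ => (Ioi 0).indicator (fun τ => ENNReal.ofReal (heatKernel τ)) τ) (t - s) := by
        refine lintegral_mono fun s => ?_
        by_cases hs : s ∈ Ioo 0 t
        · simp [hs, hs.2]
        · simp [hs]
    _ = heatMass := by
        rw [lintegral_sub_left_eq_self
          (fun τ => (Ioi 0).indicator (fun τ => ENNReal.ofReal (heatKernel τ)) τ),
          lintegral_indicator measurableSet_Ioi, heatMass]

/-- A majorant of `exp (-t x² + √t x)` for `x ≥ 1`. -/
def initKernel (t : ℝ) : ℝ := if t ≤ 2 / 3 then Real.exp (1 / 4) else Real.exp (2 / 3 - 5 / 8 * t)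

/-- With `y = √t x`, the maximum of `-y² + y` is `1/4`, used for small `t`. For large `t`, `(y -
4/3)² ≥ 0` gives `-y² + y ≤ 2/3 - (5/8)y²`, and `y² ≥ t`. The two bounds agree at `t = 2/3`. -/
theorem exp_le_initKernel {t x h : ℝ} (ht : 0 ≤ t) (hx : 1 ≤ x) (hh : h ≤ x) :
    Real.exp (-(t * x ^ 2) + √t * h) ≤ initKernel t := by
  have hs := Real.sqrt_nonneg t
  have hsq : √t ^ 2 = t := Real.sq_sqrt ht
  have hy2 : (√t * x) ^ 2 = t * x ^ 2 := by rw [mul_pow, hsq]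
  have h1 : √t * h ≤ √t * x := by gcongr
  unfold initKernel
  split_ifs with h0
  · apply Real.exp_le_exp.2
    nlinarith [sq_nonneg (√t * x - 1 / 2)]
  · apply Real.exp_le_exp.2
    nlinarith [sq_nonneg (√t * x - 4 / 3), mul_le_mul_of_nonneg_left (one_le_pow₀ hx : 1 ≤ x ^ 2) ht]

theorem initKernel_le (t : ℝ) : initKernel t ≤ Real.exp (1 / 4) := by
  unfold initKernel
  split_ifs with h
  · exact le_rfl
  · exact Real.exp_le_exp.2 (by linarith)

theorem measurable_initKernel : Measurable initKernel := by
  unfold initKernel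
  exact Measurable.ite measurableSet_Iic measurable_const (by fun_prop)

theorem exp_quarter_le : Real.exp (1 / 4) ≤ 1.3 := by
  have h := Real.exp_one_lt_d9
  have h4 : Real.exp (1 / 4) ^ 4 = Real.exp 1 := by
    rw [← Real.exp_nat_mul]; norm_num
  by_contra hc
  push Not at hc
  have : (1.3 : ℝ) ^ 4 < Real.exp (1 / 4) ^ 4 := by gcongr
  rw [h4] at this
  norm_num at this
  linarith

/-- The integral is `e^{1/4}(2/3 + 8/5)`, and `1.3 · 34/15 < 3`. -/
theorem lintegral_initKernel_le : ∫⁻ t in Ioi 0, ENNReal.ofReal (initKernel t) ≤ 3 := by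
  have hu : Ioi (0 : ℝ) = Ioc 0 (2 / 3) ∪ Ioi (2 / 3) :=
    (Ioc_union_Ioi_eq_Ioi (by norm_num)).symm
  have h1 : ∫⁻ t in Ioc (0 : ℝ) (2 / 3), ENNReal.ofReal (initKernel t)
      = ENNReal.ofReal (Real.exp (1 / 4) * (2 / 3)) := by
    rw [setLIntegral_congr_fun (g := fun _ => ENNReal.ofReal (Real.exp (1 / 4))) measurableSet_Ioc
      (fun t ht => by simp [initKernel, ht.2]), setLIntegral_const, Real.volume_Ioc,
      ENNReal.ofReal_mul (Real.exp_pos _).le]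
    norm_num
  have h2 : ∫⁻ t in Ioi (2 / 3 : ℝ), ENNReal.ofReal (initKernel t)
      = ENNReal.ofReal (Real.exp (1 / 4) * (8 / 5)) := by
    have hI : IntegrableOn (fun t : ℝ => Real.exp (2 / 3) * Real.exp (-(5 / 8) * t)) (Ioi (2 / 3)) :=
      (integrableOn_exp_mul_Ioi (by norm_num) _).const_mul _
    have e : ∀ t ∈ Ioi (2 / 3 : ℝ), ENNReal.ofReal (initKernel t)
        = ENNReal.ofReal (Real.exp (2 / 3) * Real.exp (-(5 / 8) * t)) := by
      intro t ht
      have : ¬ t ≤ 2 / 3 := not_le.2 ht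
      rw [initKernel, if_neg this, ← Real.exp_add]
      congr 2
      ring
    rw [setLIntegral_congr_fun measurableSet_Ioi e, ← ofReal_integral_eq_lintegral_ofReal hI
      (Eventually.of_forall fun t => by positivity), integral_const_mul,
      integral_exp_mul_Ioi (by norm_num)]
    congr 1
    have : Real.exp (2 / 3) * Real.exp (-(5 / 8) * (2 / 3)) = Real.exp (1 / 4) := by
      rw [← Real.exp_add]; norm_num
    linear_combination (8 / 5) * this
  rw [hu, lintegral_union measurableSet_Ioi (Ioc_disjoint_Ioi le_rfl), h1, h2,
    ← ENNReal.ofReal_add (by positivity) (by positivity)]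
  have : (3 : ℝ≥0∞) = ENNReal.ofReal 3 := by simp
  rw [this]
  apply ENNReal.ofReal_le_ofReal
  linarith [exp_quarter_le]

end RescaledNS

end

/-! ### The exponential weight and the forcing of an approximate solution -/

noncomputable section

namespace RescaledNS

open MeasureTheory Set Filter Topology
open scoped ENNReal


section Square

variable {α : Type*} [MeasurableSpace α] {ν : Measure α}

theorem eLpNorm_two_const_mul' {c : ℝ≥0∞} (hc : c ≠ ∞) (f : α → ℝ≥0∞) :
    eLpNorm (fun x => c * f x) 2 ν = c * eLpNorm f 2 ν := by
  apply (ENNReal.pow_right_strictMono (n := 2) (by norm_num)).injective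
  simp only [mul_pow, eLpNorm_two_sq]
  rw [lintegral_const_mul' _ _ (ENNReal.pow_ne_top hc)]

theorem mul_eLpNorm_two_le {E : Type*} [NormedAddCommGroup E] {δ k : ℝ≥0∞} (hδ : δ ≠ ∞)
    (hk : k ≠ ∞) {f : α → E} {g : α → ℝ≥0∞} (h : ∀ᵐ x ∂ν, δ * ‖f x‖ₑ ≤ k * g x) :
    δ * eLpNorm f 2 ν ≤ k * eLpNorm g 2 ν := by
  rw [← eLpNorm_enorm, ← eLpNorm_two_const_mul' hδ, ← eLpNorm_two_const_mul' hk]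
  exact eLpNorm_two_mono h

end Square

/-! ### The phase -/

theorem phase_eq (a lam : ℝ) (θ : ℝ → ℝ) (t : ℝ) (ξ : Freq) :
    phase a lam θ t ξ = √t * horNorm ξ + (a - lam * θ t) * |coord 2 ξ| := by
  unfold phase; ring

/-- The phase is a combination of the seminorms `|ξ_h|` and `|ξ₃|` with coefficients `√t` and `a -
λθ(t)`. The condition on `θ` is what keeps the second one nonnegative. -/
theorem phase_le_add {a lam : ℝ} {θ : ℝ → ℝ} {t : ℝ} (h : lam * θ t ≤ a) (ξ η : Freq) :
    phase a lam θ t ξ ≤ phase a lam θ t η + phase a lam θ t (ξ - η) := by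
  rw [phase_eq, phase_eq, phase_eq]
  have h1 := horNorm_add_le η (ξ - η)
  rw [add_sub_cancel] at h1
  have h2 : |coord 2 ξ| ≤ |coord 2 η| + |coord 2 (ξ - η)| := by
    rw [coord_sub]
    calc |coord 2 ξ| = |coord 2 η + (coord 2 ξ - coord 2 η)| := by rw [add_sub_cancel]
      _ ≤ _ := abs_add_le _ _
  have h3 := mul_le_mul_of_nonneg_left h1 (Real.sqrt_nonneg t)
  have h4 := mul_le_mul_of_nonneg_left h2 (sub_nonneg.2 h)
  linarith

theorem phase_sub_le {a lam : ℝ} {θ : ℝ → ℝ} {s t : ℝ} (hlam : 0 ≤ lam) (hs : 0 ≤ s) (hst : s ≤ t)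
    (hθ : θ s ≤ θ t) (ξ : Freq) :
    phase a lam θ t ξ ≤ phase a lam θ s ξ + √(t - s) * horNorm ξ := by
  rw [phase_eq, phase_eq]
  have h1 := mul_le_mul_of_nonneg_right (sqrt_sub_sqrt_le hs hst) (horNorm_nonneg ξ)
  have h2 := mul_le_mul_of_nonneg_right (mul_le_mul_of_nonneg_left hθ hlam) (abs_nonneg (coord 2 ξ))
  linarith

@[fun_prop] theorem measurable_phase (a lam : ℝ) (θ : ℝ → ℝ) (t : ℝ) :
    Measurable (phase a lam θ t) := by
  unfold phase; fun_prop

/-- Subadditivity gives `e^{ψ(ξ)} ≤ e^{ψ(η)} e^{ψ(ξ-η)}` under the integral, one exponential for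
each factor. -/
theorem exp_mul_majorant_le {ψ : Freq → ℝ} (hψ : ∀ ξ η, ψ ξ ≤ ψ η + ψ (ξ - η)) (ε : ℝ)
    (u : Freq → Vec3) (ξ : Freq) :
    ENNReal.ofReal (Real.exp (ψ ξ)) * NiceField.majorant ε u ξ
      ≤ lossConv (oscSize ε (expMul ψ (perpHat u))) (fun η => ‖expMul ψ u η‖ₑ) ξ := by
  have he : ∀ {E : Type} [NormedAddCommGroup E] [NormedSpace ℝ E] (x : ℝ) (z : E),
      ‖Real.exp x • z‖ₑ = ENNReal.ofReal (Real.exp x) * ‖z‖ₑ := by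
    intro E _ _ x z
    rw [enorm_smul, Real.enorm_eq_ofReal (Real.exp_pos x).le]
  have ho : ∀ η, oscSize ε (expMul ψ (perpHat u)) η
      = ENNReal.ofReal (Real.exp (ψ η)) * oscSize ε (perpHat u) η := by
    intro η
    have h1 : comp 2 (expMul ψ (perpHat u)) η = Real.exp (ψ η) • comp 2 (perpHat u) η := rfl
    have h2 : hor (expMul ψ (perpHat u)) η = Real.exp (ψ η) • hor (perpHat u) η := by
      ext i; fin_cases i <;> simp [hor, expMul]
    rw [oscSize, h1, h2, he, he, oscSize]
    ring
  unfold NiceField.majorant lossConv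
  rw [← lintegral_const_mul' _ _ ENNReal.ofReal_ne_top]
  refine lintegral_mono fun η => ?_
  simp only
  rw [ho, expMul, he]
  have hexp : ENNReal.ofReal (Real.exp (ψ ξ))
      ≤ ENNReal.ofReal (Real.exp (ψ η)) * ENNReal.ofReal (Real.exp (ψ (ξ - η))) := by
    rw [← ENNReal.ofReal_mul (Real.exp_pos _).le, ← Real.exp_add]
    exact ENNReal.ofReal_le_ofReal (Real.exp_le_exp.2 (hψ ξ η))
  calc _ ≤ (ENNReal.ofReal (Real.exp (ψ η)) * ENNReal.ofReal (Real.exp (ψ (ξ - η)))) *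
        ((1 + min (eNorm η) (eNorm (ξ - η))) * (oscSize ε (perpHat u) η * ‖u (ξ - η)‖ₑ)) := by
        gcongr
    _ = _ := by ring

/-! ### The time derivative of an approximate solution -/

theorem coeFn_compLp_ae {E : Type*} [NormedAddCommGroup E] [NormedSpace ℝ E] (L : Vec3 →L[ℝ] E)
    (V : Field) : (L.compLpL 2 freqMeasure V : Freq → E) =ᵐ[freqMeasure] fun ξ => L (V ξ) :=
  L.coeFn_compLpL V

/-- The coordinates, as real linear maps. -/
def projL (j : Fin 3) : Vec3 →L[ℝ] ℂ := (EuclideanSpace.proj j : Vec3 →L[ℂ] ℂ).restrictScalars ℝ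

theorem projL_apply (j : Fin 3) (x : Vec3) : projL j x = x j := rfl

theorem bddMeas_coord_box (N : ℕ) (j : Fin 3) :
    BddMeas ((box N).indicator (coord j)) where
  meas := (measurable_coord j).indicator (measurableSet_box N)
  bdd := ⟨N, fun ξ => by
    by_cases h : ξ ∈ box N
    · rw [indicator_of_mem h]; exact h j
    · rw [indicator_of_notMem h]; simp⟩

/-- The divergence of the part of the spectrum in a box. -/
def divBox (N : ℕ) : Field →L[ℝ] Lp ℂ 2 freqMeasure :=
  ∑ j : Fin 3, (mulLp freqMeasure ℂ ((bddMeas_coord_box N j).toLp freqMeasure)) ∘L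
    ((projL j).compLpL 2 freqMeasure)

theorem divBox_ae (N : ℕ) (V : Field) : (divBox N V : Freq → ℂ) =ᵐ[freqMeasure]
    fun ξ => ∑ j : Fin 3, (((box N).indicator (coord j) ξ : ℝ) : ℂ) * V ξ j := by
  have hj : ∀ j : Fin 3, (mulLp freqMeasure ℂ ((bddMeas_coord_box N j).toLp freqMeasure)
      ((projL j).compLpL 2 freqMeasure V) : Freq → ℂ) =ᵐ[freqMeasure]
      fun ξ => (((box N).indicator (coord j) ξ : ℝ) : ℂ) * V ξ j := by
    intro j
    filter_upwards [mulLp_coeFn ((bddMeas_coord_box N j).toLp freqMeasure)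
      ((projL j).compLpL 2 freqMeasure V), (bddMeas_coord_box N j).coeFn_toLp (ν := freqMeasure),
      coeFn_compLp_ae (projL j) V] with ξ h1 h2 h3
    rw [h1, h2, h3, projL_apply, Complex.real_smul]
  have e : divBox N V = mulLp freqMeasure ℂ ((bddMeas_coord_box N 0).toLp freqMeasure)
        ((projL 0).compLpL 2 freqMeasure V)
      + mulLp freqMeasure ℂ ((bddMeas_coord_box N 1).toLp freqMeasure)
        ((projL 1).compLpL 2 freqMeasure V)
      + mulLp freqMeasure ℂ ((bddMeas_coord_box N 2).toLp freqMeasure)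
        ((projL 2).compLpL 2 freqMeasure V) := by
    simp [divBox, Fin.sum_univ_three]
  rw [e]
  filter_upwards [Lp.coeFn_add (mulLp freqMeasure ℂ ((bddMeas_coord_box N 0).toLp freqMeasure)
        ((projL 0).compLpL 2 freqMeasure V)
      + mulLp freqMeasure ℂ ((bddMeas_coord_box N 1).toLp freqMeasure)
        ((projL 1).compLpL 2 freqMeasure V)) (mulLp freqMeasure ℂ
        ((bddMeas_coord_box N 2).toLp freqMeasure) ((projL 2).compLpL 2 freqMeasure V)),
      Lp.coeFn_add (mulLp freqMeasure ℂ ((bddMeas_coord_box N 0).toLp freqMeasure)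
        ((projL 0).compLpL 2 freqMeasure V))
      (mulLp freqMeasure ℂ ((bddMeas_coord_box N 1).toLp freqMeasure)
        ((projL 1).compLpL 2 freqMeasure V)), hj 0, hj 1, hj 2] with ξ h1 h2 h3 h4 h5
  rw [h1, Pi.add_apply, h2, Pi.add_apply, h3, h4, h5, Fin.sum_univ_three]

theorem divBox_eq_zero_of_divFree (N : ℕ) {V : Field} (h : DivFree V) : divBox N V = 0 := by
  rw [Lp.eq_zero_iff_ae_eq_zero]
  filter_upwards [divBox_ae N V, h] with ξ h1 h2
  rw [h1]
  simp only [dHat, comp, mul_assoc] at h2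
  rw [← Finset.mul_sum] at h2
  have h3 := (mul_eq_zero.1 h2).resolve_left Complex.I_ne_zero
  by_cases hb : ξ ∈ box N
  · simp only [indicator_of_mem hb]
    exact h3
  · simp [indicator_of_notMem hb]

/-- The divergence is unbounded on L², but its restriction to a box is a bounded operator and so
commutes with the time derivative. -/
theorem div_derivWithin_eq_zero {v : ℝ → Field} (hv : DifferentiableOn ℝ v (Ici 0))
    (hd : ∀ t, 0 ≤ t → DivFree (v t)) {t : ℝ} (ht : 0 ≤ t) (N : ℕ) :
    ∀ᵐ ξ ∂freqMeasure, ξ ∈ box N →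
      ∑ j : Fin 3, (coord j ξ : ℂ) * (derivWithin v (Ici 0) t : Field) ξ j = 0 := by
  have h1 : HasDerivWithinAt (fun s => divBox N (v s)) (divBox N (derivWithin v (Ici 0) t))
      (Ici 0) t :=
    (divBox N).hasFDerivAt.comp_hasDerivWithinAt t (hv t ht).hasDerivWithinAt
  have h2 : HasDerivWithinAt (fun s => divBox N (v s)) 0 (Ici 0) t :=
    (hasDerivWithinAt_const t (Ici 0) (0 : Lp ℂ 2 freqMeasure)).congr
      (fun s hs => divBox_eq_zero_of_divFree N (hd s hs)) (divBox_eq_zero_of_divFree N (hd t ht))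
  have h3 : divBox N (derivWithin v (Ici 0) t) = 0 :=
    (uniqueDiffOn_Ici (0 : ℝ) t ht).eq_deriv _ h1 h2
  rw [Lp.eq_zero_iff_ae_eq_zero] at h3
  filter_upwards [h3, divBox_ae N (derivWithin v (Ici 0) t)] with ξ e1 e2 hb
  rw [e2] at e1
  simp only [indicator_of_mem hb] at e1
  exact e1

/-- The horizontal part, as a real linear map. -/
def horL : Vec3 →L[ℝ] Vec2 :=
  LinearMap.toContinuousLinearMap
    { toFun := fun x => !₂[x 0, x 1]
      map_add' := fun x y => by ext i; fin_cases i <;> simp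
      map_smul' := fun c x => by ext i; fin_cases i <;> simp }

theorem horL_apply (x : Vec3) : horL x = !₂[x 0, x 1] := rfl

/-- The pointwise bound is applied to the residual `∂ₜv + |ξ_ε|²v`, which is divergence free because
both of its terms are; off `ξ_h = 0` and inside the truncation the projections in the equations
disappear. -/
theorem IsApproxSolution.forcing_le {n : ℕ} {ε : ℝ} {v₀ : Field} {v : ℝ → Field}
    {q : ℝ → Freq → ℂ} (h : IsApproxSolution n ε v₀ v q) (hε : 0 < ε) (hε1 : ε ≤ 1) {t : ℝ}
    (ht : 0 ≤ t) :
    ∀ᵐ ξ ∂freqMeasure, ¬ (ξ.1 = 0 ∧ ξ.2.1 = 0) → epsNormSq ε ξ ≤ (n : ℝ) ^ 2 →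
      ‖projL 2 ((derivWithin v (Ici 0) t : Field) ξ + epsNormSq ε ξ • v t ξ)‖ₑ
        ≤ 36 * (ENNReal.ofReal √(epsNormSq ε ξ) * NiceField.majorant ε (v t) ξ) ∧
      ENNReal.ofReal ε * ‖horL ((derivWithin v (Ici 0) t : Field) ξ + epsNormSq ε ξ • v t ξ)‖ₑ
        ≤ 36 * (ENNReal.ofReal √(epsNormSq ε ξ) * NiceField.majorant ε (v t) ξ) := by
  obtain ⟨u, hu, huv⟩ := exists_niceField (v t) (h.spectrum t ht) (h.divFree t ht)
  have hmaj : ∀ ξ, NiceField.majorant ε u ξ = NiceField.majorant ε (v t) ξ := by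
    intro ξ
    refine lossConv_congr ?_ ?_ ξ
    · filter_upwards [perpHat_congr huv] with η hη
      simp [oscSize, comp, hor, hη]
    · filter_upwards [huv] with η hη
      rw [hη]
  filter_upwards [huv, h.horizontal t ht 0 (by decide), h.horizontal t ht 1 (by decide),
    h.vertical t ht, div_derivWithin_eq_zero h.differentiable h.divFree ht ⌈(n : ℝ) / ε⌉₊]
    with ξ e h0 h1 h2 hd hξ hn
  have hdv := hd fun j => abs_coord_le_of_epsNormSq_le hε hε1 hn j
  have hpr : ∀ F : Freq → ℂ, projHat n ε (perpHat F) ξ = F ξ := by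
    intro F
    have m1 : ξ ∈ {ξ | epsNormSq ε ξ ≤ (n : ℝ) ^ 2} := hn
    have m2 : ξ ∈ {ξ : Freq | ξ.1 = 0 ∧ ξ.2.1 = 0}ᶜ := hξ
    rw [projHat, indicator_of_mem m1, perpHat, indicator_of_mem m2]
  have hco : ∀ (i : Fin 3) (V : Freq → Vec3), comp i (perpHat V) ξ = V ξ i := by
    intro i V
    have m2 : ξ ∈ {ξ : Freq | ξ.1 = 0 ∧ ξ.2.1 = 0}ᶜ := hξ
    rw [comp, perpHat, indicator_of_mem m2]
  rw [hpr, hco, hco] at h0 h1 h2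
  rw [← hmaj, projL_apply, horL_apply]
  have hA : ∀ i : Fin 3, ((derivWithin v (Ici 0) t : Field) ξ + epsNormSq ε ξ • v t ξ) i
      = (derivWithin v (Ici 0) t : Field) ξ i + (epsNormSq ε ξ : ℂ) * v t ξ i := by
    intro i
    simp
  refine hu.forcing_le hε hε1 hξ (q := q t ξ) ?_ ?_ ?_
  · intro i hi
    rw [hA]
    have ea : ∀ i, (fun x => advect u i x + stretch u i x)
        = fun x => advect (v t) i x + stretch (v t) i x := by
      intro i; rw [advect_congr huv, stretch_congr huv]
    rw [ea]
    fin_cases i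
    · exact h0
    · exact h1
    · simp at hi
  · rw [hA]
    have ea : (fun x => advect u 2 x) = fun x => advect (v t) 2 x := by rw [advect_congr huv]
    rw [ea]
    exact h2
  · simp only [hA, mul_add, Finset.sum_add_distrib]
    rw [hdv, zero_add]
    have := hu.div ξ
    rw [e] at this
    calc _ = (epsNormSq ε ξ : ℂ) * ∑ j : Fin 3, (coord j ξ : ℂ) * v t ξ j := by
          rw [Finset.mul_sum]
          exact Finset.sum_congr rfl fun j _ => by ring
      _ = 0 := by rw [this, mul_zero]

end RescaledNS

end

/-! ### Weighted Duhamel estimate on one dyadic block -/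

noncomputable section

namespace RescaledNS

open MeasureTheory Set Filter Topology
open scoped ENNReal


/-- The part of a shell where the oscillating part of an approximate solution lives. -/
def oscShell (n : ℕ) (ε : ℝ) (m : ℕ) : Set Freq :=
  shell m ∩ {ξ : Freq | ξ.1 = 0 ∧ ξ.2.1 = 0}ᶜ ∩ {ξ | epsNormSq ε ξ ≤ (n : ℝ) ^ 2}

theorem measurableSet_spectrum (n : ℕ) (ε : ℝ) :
    MeasurableSet {ξ | epsNormSq ε ξ ≤ (n : ℝ) ^ 2} :=
  measurableSet_le (by fun_prop) measurable_const

theorem measurableSet_oscShell (n : ℕ) (ε : ℝ) (m : ℕ) : MeasurableSet (oscShell n ε m) :=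
  ((measurableSet_shell m).inter measurableSet_hor_eq_zero.compl).inter
    (measurableSet_spectrum n ε)

theorem bddMeas_epsNormSq (n : ℕ) (ε : ℝ) :
    BddMeas ({ξ | epsNormSq ε ξ ≤ (n : ℝ) ^ 2}.indicator (epsNormSq ε)) where
  meas := (measurable_epsNormSq ε).indicator (measurableSet_spectrum n ε)
  bdd := ⟨(n : ℝ) ^ 2, fun ξ => by
    by_cases h : ξ ∈ {ξ | epsNormSq ε ξ ≤ (n : ℝ) ^ 2}
    · rw [indicator_of_mem h, abs_of_nonneg (epsNormSq_nonneg ε ξ)]; exact h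
    · rw [indicator_of_notMem h, abs_zero]; positivity⟩

/-- The weight `e^Φ` is unbounded; cutting it to a shell makes it an admissible test weight for
`eLpNorm_duhamel_le`. -/
theorem bddMeas_exp_phase (n : ℕ) (ε : ℝ) (m : ℕ) {a lam : ℝ} {θ : ℝ → ℝ} {t : ℝ}
    (h : lam * θ t ≤ a) :
    BddMeas ((oscShell n ε m).indicator fun ξ => Real.exp (phase a lam θ t ξ)) where
  meas := by
    refine Measurable.indicator ?_ (measurableSet_oscShell n ε m)
    fun_prop
  bdd := ⟨Real.exp (√t * 2 ^ m + (a - lam * θ t) * 2 ^ m), fun ξ => by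
    by_cases hm : ξ ∈ oscShell n ε m
    · have h1 := freqNorm_le_of_mem_shell hm.1.1
      rw [indicator_of_mem hm, Real.abs_exp, Real.exp_le_exp, phase_eq]
      have h2 := (horNorm_le_freqNorm ξ).trans h1
      have h3 := (abs_coord_le_freqNorm 2 ξ).trans h1
      have h4 := sub_nonneg.2 h
      gcongr
    · rw [indicator_of_notMem hm, abs_zero]; positivity⟩

theorem enorm_exp_smul {E : Type*} [NormedAddCommGroup E] [NormedSpace ℝ E] (x : ℝ) (z : E) :
    ‖Real.exp x • z‖ₑ = ENNReal.ofReal (Real.exp x) * ‖z‖ₑ := by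
  rw [enorm_smul, Real.enorm_eq_ofReal (Real.exp_pos x).le]

theorem perpHat_of_not {u : Freq → Vec3} {ξ : Freq} (h : ¬ (ξ.1 = 0 ∧ ξ.2.1 = 0)) :
    perpHat u ξ = u ξ := by
  have m2 : ξ ∈ {ξ : Freq | ξ.1 = 0 ∧ ξ.2.1 = 0}ᶜ := h
  rw [perpHat, indicator_of_mem m2]

/-- The smoothing of the heat flow absorbs both the growth of the phase and one derivative. -/
theorem exp_forcing_le {ε a lam : ℝ} {θ : ℝ → ℝ} {s t : ℝ} (hlam : 0 ≤ lam)
    (hs : 0 ≤ s) (hst : s < t) (hθst : θ s ≤ θ t) (hθs : lam * θ s ≤ a) (V : Freq → Vec3)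
    {ξ : Freq} (hξ : ¬ (ξ.1 = 0 ∧ ξ.2.1 = 0)) :
    ENNReal.ofReal (Real.exp (phase a lam θ t ξ) * Real.exp (-((t - s) * epsNormSq ε ξ))) *
        (36 * (ENNReal.ofReal √(epsNormSq ε ξ) * NiceField.majorant ε V ξ))
      ≤ ENNReal.ofReal (heatKernel (t - s)) * (36 *
        lossConv (oscSize ε (expMul (phase a lam θ s) (perpHat V)))
          (fun η => ‖expMul (phase a lam θ s) V η‖ₑ) ξ) := by
  set x := √(epsNormSq ε ξ) with hx
  have hx2 : x ^ 2 = epsNormSq ε ξ := Real.sq_sqrt (epsNormSq_nonneg ε ξ)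
  have hhx := horNorm_le_sqrt_epsNormSq ε ξ
  have hx1 : 1 ≤ x := (one_le_horNorm hξ).trans hhx
  have h1 := mul_exp_le_heatKernel (sub_pos.2 hst) hx1 hhx
  have h2 := exp_mul_majorant_le (fun ξ η => phase_le_add hθs ξ η) ε V ξ
  have h3 := phase_sub_le hlam hs hst.le hθst (a := a) ξ
  calc _ = 36 * (ENNReal.ofReal (x * (Real.exp (phase a lam θ t ξ)
        * Real.exp (-((t - s) * epsNormSq ε ξ)))) * NiceField.majorant ε V ξ) := by
        rw [ENNReal.ofReal_mul (by positivity : 0 ≤ x)]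
        ring
    _ ≤ 36 * (ENNReal.ofReal (heatKernel (t - s) * Real.exp (phase a lam θ s ξ))
          * NiceField.majorant ε V ξ) := by
        refine mul_le_mul_right (mul_le_mul_left (ENNReal.ofReal_le_ofReal ?_) _) _
        rw [← Real.exp_add, ← hx2]
        calc x * Real.exp (phase a lam θ t ξ + -((t - s) * x ^ 2))
            ≤ x * Real.exp ((-((t - s) * x ^ 2) + √(t - s) * horNorm ξ)
              + phase a lam θ s ξ) := by
              refine mul_le_mul_of_nonneg_left (Real.exp_le_exp.2 ?_) (by positivity)
              linarith
          _ = x * Real.exp (-((t - s) * x ^ 2) + √(t - s) * horNorm ξ)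
              * Real.exp (phase a lam θ s ξ) := by rw [Real.exp_add]; ring
          _ ≤ _ := by gcongr
    _ = ENNReal.ofReal (heatKernel (t - s)) * (36 * (ENNReal.ofReal (Real.exp (phase a lam θ s ξ))
          * NiceField.majorant ε V ξ)) := by
        have : 0 ≤ heatKernel (t - s) := by
          unfold heatKernel
          have := (sub_pos.2 hst).le
          positivity
        rw [ENNReal.ofReal_mul this]
        ring
    _ ≤ _ := by gcongr

/-- Duhamel's formula on a block, with the weight of the phase. -/
theorem IsApproxSolution.block_le {E : Type} [NormedAddCommGroup E] [NormedSpace ℝ E]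
    [CompleteSpace E] (L : Vec3 →L[ℝ] E) {δ : ℝ≥0∞} (hδ : δ ≠ ∞) {n : ℕ} {ε a lam : ℝ}
    {v₀ : Field} {v : ℝ → Field} {q : ℝ → Freq → ℂ} {θ : ℝ → ℝ}
    (h : IsApproxSolution n ε v₀ v q) (hlam : 0 ≤ lam) {t : ℝ} (ht : 0 ≤ t)
    (hθ0 : 0 ≤ θ t) (hθ : ∀ s, 0 ≤ s → s ≤ t → θ s ≤ θ t) (hθt : lam * θ t ≤ a)
    (hL : ∀ s, 0 ≤ s → ∀ᵐ ξ ∂freqMeasure, ¬ (ξ.1 = 0 ∧ ξ.2.1 = 0) →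
      epsNormSq ε ξ ≤ (n : ℝ) ^ 2 →
      δ * ‖L ((derivWithin v (Ici 0) s : Field) ξ + epsNormSq ε ξ • v s ξ)‖ₑ
        ≤ 36 * (ENNReal.ofReal √(epsNormSq ε ξ) * NiceField.majorant ε (v s) ξ)) (m : ℕ) :
    δ * blockNorm m (fun ξ => L (wPhi a lam θ v t ξ))
      ≤ ENNReal.ofReal (initKernel t) * (δ * blockNorm m (fun ξ => L (wInit a v₀ ξ)))
        + ∫⁻ s in Ioo 0 t, ENNReal.ofReal (heatKernel (t - s)) * (36 *
          eLpNorm (lossConv (oscSize ε (wPhi a lam θ v s)) (fun η => ‖vPhi a lam θ v s η‖ₑ)) 2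
            (freqMeasure.restrict (shell m))) := by
  set c := (oscShell n ε m).indicator fun ξ => Real.exp (phase a lam θ t ξ) with hc
  set ρ := {ξ | epsNormSq ε ξ ≤ (n : ℝ) ^ 2}.indicator (epsNormSq ε) with hρ
  set u : ℝ → Lp E 2 freqMeasure := fun s => L.compLpL 2 freqMeasure (v s) with hu
  have hc_mem : ∀ ξ, ξ ∈ oscShell n ε m → c ξ = Real.exp (phase a lam θ t ξ) := fun ξ hξ =>
    indicator_of_mem hξ _
  have hc_not : ∀ ξ, ξ ∉ oscShell n ε m → c ξ = 0 := fun ξ hξ => indicator_of_notMem hξ _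
  have hρ_mem : ∀ ξ, ξ ∈ oscShell n ε m → ρ ξ = epsNormSq ε ξ := fun ξ hξ =>
    indicator_of_mem hξ.2 _
  have hud : DifferentiableOn ℝ u (Ici 0) := fun s hs =>
    ((L.compLpL 2 freqMeasure).hasFDerivAt.comp_hasDerivWithinAt s
      (h.differentiable s hs).hasDerivWithinAt).differentiableWithinAt
  have hud' : ∀ s, 0 ≤ s → derivWithin u (Ici 0) s
      = L.compLpL 2 freqMeasure (derivWithin v (Ici 0) s) := fun s hs =>
    ((L.compLpL 2 freqMeasure).hasFDerivAt.comp_hasDerivWithinAt s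
      (h.differentiable s hs).hasDerivWithinAt).derivWithin (uniqueDiffOn_Ici (0 : ℝ) s hs)
  have key := eLpNorm_duhamel_le (bddMeas_epsNormSq n ε) (bddMeas_exp_phase n ε m hθt) hud ht
  rw [← hc, ← hρ] at key
  -- On the rest of the shell `w` vanishes almost everywhere: either `ξ_h = 0` or `ξ` is outside the
  -- truncated spectrum.
  have hlhs : blockNorm m (fun ξ => L (wPhi a lam θ v t ξ))
      = eLpNorm (fun ξ => c ξ • u t ξ) 2 freqMeasure := by
    rw [blockNorm, ← eLpNorm_indicator_eq_eLpNorm_restrict (measurableSet_shell m)]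
    apply eLpNorm_congr_ae
    filter_upwards [h.spectrum t ht, coeFn_compLp_ae L (v t)] with ξ h1 h2
    have h2' : u t ξ = L (v t ξ) := h2
    rw [h2']
    by_cases hξ : ξ ∈ oscShell n ε m
    · rw [hc_mem ξ hξ, indicator_of_mem hξ.1.1, wPhi, expMul, map_smul, perpHat_of_not hξ.1.2]
    · rw [hc_not ξ hξ, zero_smul]
      by_cases hs : ξ ∈ shell m
      · rw [indicator_of_mem hs]
        have hz : perpHat (v t : Freq → Vec3) ξ = 0 := by
          by_cases hh : ξ.1 = 0 ∧ ξ.2.1 = 0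
          · simp [perpHat, hh]
          · rw [perpHat_of_not hh, h1, projHat, indicator_of_notMem]
            exact fun hn => hξ ⟨⟨hs, hh⟩, hn⟩
        rw [wPhi, expMul, hz, smul_zero, map_zero]
      · rw [indicator_of_notMem hs]
  have hinit : δ * eLpNorm (fun x => (c x * Real.exp (-(t * ρ x))) • u 0 x) 2 freqMeasure
      ≤ ENNReal.ofReal (initKernel t) * (δ * blockNorm m (fun ξ => L (wInit a v₀ ξ))) := by
    have e : δ * blockNorm m (fun ξ => L (wInit a v₀ ξ))
        = eLpNorm ((shell m).indicator fun ξ => δ * ‖L (wInit a v₀ ξ)‖ₑ) 2 freqMeasure := by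
      rw [eLpNorm_indicator_eq_eLpNorm_restrict (measurableSet_shell m),
        eLpNorm_two_const_mul' hδ, eLpNorm_enorm, blockNorm]
    rw [e]
    refine mul_eLpNorm_two_le hδ ENNReal.ofReal_ne_top ?_
    filter_upwards [h.initial, coeFn_compLp_ae L (v 0)] with ξ h1 h2
    have h2' : u 0 ξ = L (v 0 ξ) := h2
    by_cases hξ : ξ ∈ oscShell n ε m
    · rw [hc_mem ξ hξ, hρ_mem ξ hξ, indicator_of_mem hξ.1.1, h2', h1, projHat,
        indicator_of_mem hξ.2, wInit, expMul, perpHat_of_not hξ.1.2, map_smul, ← Real.exp_add,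
        enorm_exp_smul, enorm_exp_smul]
      have hhx := horNorm_le_sqrt_epsNormSq ε ξ
      have hx1 : 1 ≤ √(epsNormSq ε ξ) := (one_le_horNorm hξ.1.2).trans hhx
      have hk := exp_le_initKernel ht hx1 hhx
      rw [Real.sq_sqrt (epsNormSq_nonneg ε ξ)] at hk
      -- The term `-λθ(t)|ξ₃|` is nonpositive and is dropped, so the data carry only the weight
      -- `e^{a|ξ₃|}`.
      have hle : Real.exp (phase a lam θ t ξ + -(t * epsNormSq ε ξ))
          ≤ initKernel t * Real.exp (a * |coord 2 ξ|) := by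
        calc _ ≤ Real.exp ((-(t * epsNormSq ε ξ) + √t * horNorm ξ) + a * |coord 2 ξ|) := by
              apply Real.exp_le_exp.2
              rw [phase_eq]
              have := mul_nonneg (mul_nonneg hlam hθ0) (abs_nonneg (coord 2 ξ))
              linarith
          _ ≤ _ := by rw [Real.exp_add]; gcongr
      have hi0 : 0 ≤ initKernel t := (Real.exp_pos _).le.trans hk
      calc _ ≤ δ * (ENNReal.ofReal (initKernel t * Real.exp (a * |coord 2 ξ|)) * ‖L (v₀ ξ)‖ₑ) := by
            gcongr
        _ = _ := by rw [ENNReal.ofReal_mul hi0]; ring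
    · rw [hc_not ξ hξ]
      simp
  have hforce : ∀ s ∈ Ioo 0 t, δ * eLpNorm (fun x => (c x * Real.exp (-((t - s) * ρ x))) •
      ((derivWithin u (Ici 0) s : Lp E 2 freqMeasure) x + ρ x • u s x)) 2 freqMeasure
      ≤ ENNReal.ofReal (heatKernel (t - s)) * (36 *
          eLpNorm (lossConv (oscSize ε (wPhi a lam θ v s)) (fun η => ‖vPhi a lam θ v s η‖ₑ)) 2
            (freqMeasure.restrict (shell m))) := by
    intro s hs
    rw [← eLpNorm_two_const_mul' (by norm_num),
      ← eLpNorm_indicator_eq_eLpNorm_restrict (measurableSet_shell m)]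
    refine mul_eLpNorm_two_le hδ ENNReal.ofReal_ne_top ?_
    rw [hud' s hs.1.le]
    filter_upwards [hL s hs.1.le, coeFn_compLp_ae L (v s),
      coeFn_compLp_ae L (derivWithin v (Ici 0) s)] with ξ h1 h2 h3
    have h2' : u s ξ = L (v s ξ) := h2
    by_cases hξ : ξ ∈ oscShell n ε m
    · rw [hc_mem ξ hξ, hρ_mem ξ hξ, indicator_of_mem hξ.1.1, h2', h3, ← map_smul, ← map_add,
        ← Real.exp_add, enorm_exp_smul]
      have hf := exp_forcing_le hlam hs.1.le hs.2 (hθ s hs.1.le hs.2.le)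
        ((mul_le_mul_of_nonneg_left (hθ s hs.1.le hs.2.le) hlam).trans hθt) (ε := ε) (v s) hξ.1.2
      rw [← Real.exp_add] at hf
      refine le_trans ?_ hf
      rw [← mul_assoc, mul_comm δ, mul_assoc]
      exact mul_le_mul_right (h1 hξ.1.2 hξ.2) _
    · rw [hc_not ξ hξ]
      simp
  calc δ * blockNorm m (fun ξ => L (wPhi a lam θ v t ξ))
      = δ * eLpNorm (fun ξ => c ξ • u t ξ) 2 freqMeasure := by rw [hlhs]
    _ ≤ δ * (eLpNorm (fun x => (c x * Real.exp (-(t * ρ x))) • u 0 x) 2 freqMeasure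
        + ∫⁻ s in Ioo 0 t, eLpNorm (fun x => (c x * Real.exp (-((t - s) * ρ x))) •
            ((derivWithin u (Ici 0) s : Lp E 2 freqMeasure) x + ρ x • u s x)) 2 freqMeasure) := by
        gcongr
    _ ≤ _ := by
        rw [mul_add, ← lintegral_const_mul' _ _ hδ]
        refine add_le_add hinit ?_
        exact setLIntegral_mono' measurableSet_Ioo hforce

end RescaledNS

end

/-! ### Properties of `θ`, finiteness of the norms, and sums over blocks -/

noncomputable section

namespace RescaledNS

open MeasureTheory Set Filter Topology
open scoped ENNReal


/-! ### The loss of analyticity -/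

namespace IsAnalyticityLoss

variable {a lam ε : ℝ} {v : ℝ → Field} {θ : ℝ → ℝ}

theorem monotoneOn (h : IsAnalyticityLoss a lam ε v θ) (hε : 0 ≤ ε) : MonotoneOn θ (Ici 0) := by
  refine monotoneOn_of_deriv_nonneg (convex_Ici 0)
    (fun t ht => (h.ode t ht).continuousWithinAt) ?_ ?_
  · intro t ht
    rw [interior_Ici] at ht
    exact ((h.ode t ht.le).hasDerivAt (Ici_mem_nhds ht)).differentiableAt.differentiableWithinAt
  · intro t ht
    rw [interior_Ici] at ht
    rw [((h.ode t ht.le).hasDerivAt (Ici_mem_nhds ht)).deriv]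
    positivity

theorem nonneg (h : IsAnalyticityLoss a lam ε v θ) (hε : 0 ≤ ε) {t : ℝ} (ht : 0 ≤ t) :
    0 ≤ θ t := by
  rw [← h.initial]
  exact h.monotoneOn hε (mem_Ici.2 le_rfl) ht ht

theorem derivWithin_eq (h : IsAnalyticityLoss a lam ε v θ) {t : ℝ} (ht : 0 ≤ t) :
    derivWithin θ (Ici 0) t = (besovNorm (7 / 2) (comp 2 (wPhi a lam θ v t))).toReal
      + ε * (besovNorm (7 / 2) (hor (wPhi a lam θ v t))).toReal :=
  (h.ode t ht).derivWithin (uniqueDiffOn_Ici (0 : ℝ) t ht)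

theorem derivWithin_nonneg (h : IsAnalyticityLoss a lam ε v θ) (hε : 0 ≤ ε) {t : ℝ}
    (ht : 0 ≤ t) : 0 ≤ derivWithin θ (Ici 0) t := by
  rw [h.derivWithin_eq ht]
  positivity

/-- A nonnegative derivative is automatically integrable, so the fundamental theorem of calculus
applies although nothing is known about the continuity of `θ'`. -/
theorem lintegral_eq (h : IsAnalyticityLoss a lam ε v θ) (hε : 0 ≤ ε) {T : ℝ} (hT : 0 ≤ T) :
    ∫⁻ t in Ioo 0 T, ENNReal.ofReal (derivWithin θ (Ici 0) t) = ENNReal.ofReal (θ T) := by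
  have hc : ContinuousOn θ (Icc 0 T) := fun t ht =>
    (h.ode t ht.1).continuousWithinAt.mono Icc_subset_Ici_self
  have hd : ∀ t ∈ Ioo 0 T, HasDerivAt θ (derivWithin θ (Ici 0) t) t := fun t ht => by
    rw [h.derivWithin_eq ht.1.le]
    exact (h.ode t ht.1.le).hasDerivAt (Ici_mem_nhds ht.1)
  have hp : ∀ t ∈ Ioo 0 T, 0 ≤ derivWithin θ (Ici 0) t := fun t ht =>
    h.derivWithin_nonneg hε ht.1.le
  have hI := intervalIntegral.integrableOn_deriv_of_nonneg hc hd hp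
  have hI' : IntervalIntegrable (derivWithin θ (Ici 0)) volume 0 T :=
    (intervalIntegrable_iff_integrableOn_Ioc_of_le hT).2 hI
  have hftc := intervalIntegral.integral_eq_sub_of_hasDerivAt_of_le hT hc hd hI'
  rw [h.initial, sub_zero, intervalIntegral.integral_of_le hT, integral_Ioc_eq_integral_Ioo] at hftc
  rw [← hftc, ofReal_integral_eq_lintegral_ofReal (hI.mono_set Ioo_subset_Ioc_self)]
  filter_upwards [ae_restrict_mem measurableSet_Ioo] with t ht
  exact hp t ht

end IsAnalyticityLoss

/-! ### Finiteness of the norms -/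

theorem weight_ne_top (s : ℝ) (m : ℕ) : weight s m ≠ ∞ := ENNReal.ofReal_ne_top

theorem freqNorm_le_of_mem_box {N : ℕ} {ξ : Freq} (h : ξ ∈ box N) : freqNorm ξ ≤ 2 * N := by
  apply Real.sqrt_le_iff.2
  refine ⟨by positivity, ?_⟩
  have hj : ∀ j, coord j ξ ^ 2 ≤ (N : ℝ) ^ 2 := fun j => by
    rw [← sq_abs]; exact pow_le_pow_left₀ (abs_nonneg _) (h j) 2
  nlinarith [hj 0, hj 1, hj 2, sq_nonneg (N : ℝ)]

/-- A box meets only finitely many shells. -/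
theorem besovNorm_ne_top {E : Type} [NormedAddCommGroup E] {f : Freq → E} {N : ℕ}
    (hf : eLpNorm f 2 freqMeasure ≠ ∞) (hs : ∀ᵐ ξ ∂freqMeasure, f ξ ≠ 0 → ξ ∈ box N) (s : ℝ) :
    besovNorm s f ≠ ∞ := by
  obtain ⟨M, hM⟩ := pow_unbounded_of_one_lt (2 * (1 + 2 * (N : ℝ))) one_lt_two
  have hz : ∀ m ∉ Finset.range M, weight s m * blockNorm m f = 0 := by
    intro m hm
    rw [Finset.mem_range, not_lt] at hm
    have : f =ᵐ[freqMeasure.restrict (shell m)] 0 := by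
      filter_upwards [ae_restrict_of_ae hs, ae_restrict_mem (measurableSet_shell m)] with ξ h1 h2
      by_contra hne
      have h3 := freqNorm_le_of_mem_box (h1 hne)
      have h4 := two_pow_le_of_mem_shell h2
      have h5 : (2 : ℝ) ^ M ≤ 2 ^ m := pow_le_pow_right₀ (by norm_num) hm
      have h6 : max 1 (freqNorm ξ) ≤ 1 + 2 * N := max_le (by simp) (by linarith)
      linarith
    rw [blockNorm, eLpNorm_congr_ae this, eLpNorm_zero, mul_zero]
  rw [besovNorm, tsum_eq_sum hz]
  refine (ENNReal.sum_lt_top.2 fun m _ => ?_).ne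
  refine ENNReal.mul_lt_top (weight_ne_top s m).lt_top ?_
  exact (eLpNorm_mono_measure f Measure.restrict_le_self).trans_lt hf.lt_top

theorem norm_exp_phase_le {a lam : ℝ} {θ : ℝ → ℝ} {t : ℝ} (h : lam * θ t ≤ a) {N : ℕ} {ξ : Freq}
    (hξ : ξ ∈ box N) :
    Real.exp (phase a lam θ t ξ) ≤ Real.exp (√t * (2 * N) + (a - lam * θ t) * N) := by
  rw [Real.exp_le_exp, phase_eq]
  have h1 := (horNorm_le_freqNorm ξ).trans (freqNorm_le_of_mem_box hξ)
  have h2 := hξ 2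
  have h3 := sub_nonneg.2 h
  gcongr

theorem IsApproxSolution.wPhi_spectrum {n : ℕ} {ε a lam : ℝ} {v₀ : Field} {v : ℝ → Field}
    {q : ℝ → Freq → ℂ} {θ : ℝ → ℝ} (h : IsApproxSolution n ε v₀ v q) (hε : 0 < ε) (hε1 : ε ≤ 1)
    {t : ℝ} (ht : 0 ≤ t) :
    ∀ᵐ ξ ∂freqMeasure, wPhi a lam θ v t ξ ≠ 0 → ξ ∈ box ⌈(n : ℝ) / ε⌉₊ := by
  filter_upwards [h.spectrum t ht] with ξ h1 hne j
  refine abs_coord_le_of_epsNormSq_le hε hε1 ?_ j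
  by_contra hn
  apply hne
  have hn' : ξ ∉ {ξ | epsNormSq ε ξ ≤ (n : ℝ) ^ 2} := hn
  have hz : v t ξ = 0 := by rw [h1, projHat, indicator_of_notMem hn']
  have : perpHat (v t : Freq → Vec3) ξ = 0 := by
    by_cases hh : ξ.1 = 0 ∧ ξ.2.1 = 0
    · simp [perpHat, hh]
    · rw [perpHat_of_not hh, hz]
  rw [wPhi, expMul, this, smul_zero]

theorem IsApproxSolution.eLpNorm_wPhi_ne_top {n : ℕ} {ε a lam : ℝ} {v₀ : Field} {v : ℝ → Field}
    {q : ℝ → Freq → ℂ} {θ : ℝ → ℝ} (h : IsApproxSolution n ε v₀ v q) (hε : 0 < ε) (hε1 : ε ≤ 1)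
    {t : ℝ} (ht : 0 ≤ t) (hθ : lam * θ t ≤ a) :
    eLpNorm (wPhi a lam θ v t) 2 freqMeasure ≠ ∞ := by
  set N := ⌈(n : ℝ) / ε⌉₊
  have hle : 1 * eLpNorm (wPhi a lam θ v t) 2 freqMeasure
      ≤ ENNReal.ofReal (Real.exp (√t * (2 * N) + (a - lam * θ t) * N)) *
        eLpNorm (fun ξ => ‖v t ξ‖ₑ) 2 freqMeasure := by
    refine mul_eLpNorm_two_le (by simp) ENNReal.ofReal_ne_top ?_
    filter_upwards [h.wPhi_spectrum (a := a) (lam := lam) (θ := θ) hε hε1 ht] with ξ h1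
    rw [one_mul]
    by_cases hz : wPhi a lam θ v t ξ = 0
    · simp [hz]
    · have h2 := norm_exp_phase_le hθ (h1 hz)
      rw [wPhi, expMul, enorm_exp_smul]
      gcongr
      exact norm_perpHat_le _ ξ
  rw [one_mul, eLpNorm_enorm] at hle
  exact (hle.trans_lt (ENNReal.mul_lt_top ENNReal.ofReal_lt_top (Lp.memLp (v t)).2)).ne

/-- The equation for `θ` uses `toReal`, which sends `∞` to `0`; finiteness makes `θ'` the true sum
of norms. -/
theorem IsApproxSolution.besovNorm_ne_top {n : ℕ} {ε a lam : ℝ} {v₀ : Field} {v : ℝ → Field}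
    {q : ℝ → Freq → ℂ} {θ : ℝ → ℝ} (h : IsApproxSolution n ε v₀ v q) (hε : 0 < ε) (hε1 : ε ≤ 1)
    {t : ℝ} (ht : 0 ≤ t) (hθ : lam * θ t ≤ a) :
    besovNorm (7 / 2) (comp 2 (wPhi a lam θ v t)) ≠ ∞ ∧
      besovNorm (7 / 2) (hor (wPhi a lam θ v t)) ≠ ∞ := by
  have hfin := h.eLpNorm_wPhi_ne_top hε hε1 ht hθ
  have hsp := h.wPhi_spectrum (a := a) (lam := lam) (θ := θ) hε hε1 ht
  constructor
  · refine RescaledNS.besovNorm_ne_top (N := ⌈(n : ℝ) / ε⌉₊) (ne_top_of_le_ne_top hfin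
      (eLpNorm_mono_enorm fun ξ => norm_comp_le _ 2 ξ)) ?_ _
    filter_upwards [hsp] with ξ h1 hne
    exact h1 fun h0 => hne (by simp [comp, h0])
  · refine RescaledNS.besovNorm_ne_top (N := ⌈(n : ℝ) / ε⌉₊) (ne_top_of_le_ne_top hfin
      (eLpNorm_mono_enorm fun ξ => norm_hor_le _ ξ)) ?_ _
    filter_upwards [hsp] with ξ h1 hne
    exact h1 fun h0 => hne (by ext i; fin_cases i <;> simp [hor, h0])

/-! ### Block norms of the weighted fields -/

theorem measurable_perpHat (V : Field) : Measurable (perpHat (V : Freq → Vec3)) :=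
  (Lp.stronglyMeasurable V).measurable.indicator measurableSet_hor_eq_zero.compl

theorem measurable_wPhi (a lam : ℝ) (θ : ℝ → ℝ) (v : ℝ → Field) (t : ℝ) :
    Measurable (wPhi a lam θ v t) := by
  have := measurable_perpHat (v t)
  unfold wPhi expMul
  fun_prop

theorem measurable_vPhi (a lam : ℝ) (θ : ℝ → ℝ) (v : ℝ → Field) (t : ℝ) :
    Measurable (vPhi a lam θ v t) := by
  have := (Lp.stronglyMeasurable (v t)).measurable
  unfold vPhi expMul
  fun_prop

theorem measurable_hor {u : Freq → Vec3} (hu : Measurable u) : Measurable (hor u) :=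
  horL.continuous.measurable.comp hu

theorem measurable_oscSize (ε : ℝ) {w : Freq → Vec3} (hw : Measurable w) :
    Measurable (oscSize ε w) := by
  have h1 := measurable_comp hw 2
  have h2 := measurable_hor hw
  unfold oscSize
  fun_prop

theorem eLpNorm_oscSize_le (ε : ℝ) {w : Freq → Vec3} (hw : Measurable w) (m : ℕ) :
    eLpNorm (oscSize ε w) 2 (freqMeasure.restrict (shell m))
      ≤ blockNorm m (comp 2 w) + ENNReal.ofReal ε * blockNorm m (hor w) := by
  have h1 := measurable_comp hw 2
  have h2 := measurable_hor hw
  have e : oscSize ε w = (fun ξ => ‖comp 2 w ξ‖ₑ) + fun ξ => ENNReal.ofReal ε * ‖hor w ξ‖ₑ := rfl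
  rw [e]
  refine (eLpNorm_add_le (Measurable.aestronglyMeasurable (by fun_prop))
    (Measurable.aestronglyMeasurable (by fun_prop)) (by norm_num)).trans (le_of_eq ?_)
  rw [eLpNorm_two_const_mul' ENNReal.ofReal_ne_top, eLpNorm_enorm, eLpNorm_enorm, blockNorm,
    blockNorm]

theorem eLpNorm_oscSize_wPhi_le {ε : ℝ} (hε1 : ε ≤ 1) (a lam : ℝ) (θ : ℝ → ℝ) (v : ℝ → Field)
    (t : ℝ) (m : ℕ) :
    eLpNorm (oscSize ε (wPhi a lam θ v t)) 2 (freqMeasure.restrict (shell m))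
      ≤ 2 * blockNorm m (vPhi a lam θ v t) := by
  rw [blockNorm, ← eLpNorm_enorm (vPhi a lam θ v t), ← eLpNorm_two_const_mul' (by norm_num)]
  refine eLpNorm_two_mono (Eventually.of_forall fun ξ => ?_)
  have h0 : ‖wPhi a lam θ v t ξ‖ₑ ≤ ‖vPhi a lam θ v t ξ‖ₑ := by
    rw [wPhi, vPhi, expMul, expMul, enorm_exp_smul, enorm_exp_smul]
    gcongr
    exact norm_perpHat_le _ ξ
  have h1 := (norm_comp_le (wPhi a lam θ v t) 2 ξ).trans h0
  have h2 := (norm_hor_le (wPhi a lam θ v t) ξ).trans h0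
  have h3 : ENNReal.ofReal ε ≤ 1 := by simpa using hε1
  calc oscSize ε (wPhi a lam θ v t) ξ ≤ ‖vPhi a lam θ v t ξ‖ₑ + 1 * ‖vPhi a lam θ v t ξ‖ₑ := by
        unfold oscSize; gcongr
    _ = _ := by rw [one_mul, two_mul]

/-- The product estimate in the Besov space, for given block sizes of the two factors. -/
theorem tsum_weight_lossCoeff_mul_le (F G : ℕ → ℝ≥0∞) :
    ∑' m, weight (7 / 2) m * ∑' p : ℕ × ℕ, lossCoeff m p.1 p.2 * (F p.1 * G p.2)
      ≤ prodConst * ((∑' k, weight (7 / 2) k * F k) * ∑' l, weight (7 / 2) l * G l) := by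
  calc _ = ∑' p : ℕ × ℕ, ∑' m, weight (7 / 2) m * (lossCoeff m p.1 p.2 * (F p.1 * G p.2)) := by
        rw [ENNReal.tsum_comm]
        simp_rw [ENNReal.tsum_mul_left]
    _ = ∑' k, ∑' l, ∑' m, weight (7 / 2) m * (lossCoeff m k l * (F k * G l)) :=
        ENNReal.tsum_prod' (f := fun p : ℕ × ℕ => ∑' m,
          weight (7 / 2) m * (lossCoeff m p.1 p.2 * (F p.1 * G p.2)))
    _ ≤ ∑' k, ∑' l, prodConst * ((weight (7 / 2) k * F k) * (weight (7 / 2) l * G l)) := by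
        refine ENNReal.tsum_le_tsum fun k => ENNReal.tsum_le_tsum fun l => ?_
        simp_rw [← mul_assoc (weight _ _) (lossCoeff _ _ _)]
        rw [ENNReal.tsum_mul_right]
        refine (mul_le_mul_left (tsum_weight_lossCoeff_le k l) _).trans (le_of_eq ?_)
        ring
    _ = _ := by simp_rw [ENNReal.tsum_mul_left, ENNReal.tsum_mul_right]

/-- This direction needs only the superadditivity of the lower integral, so the time dependence of
the blocks need not be measurable. -/
theorem tsum_lintegral_le {α : Type*} [MeasurableSpace α] {ν : Measure α} (f : ℕ → α → ℝ≥0∞) :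
    ∑' m, ∫⁻ x, f m x ∂ν ≤ ∫⁻ x, ∑' m, f m x ∂ν := by
  refine ENNReal.tsum_le_of_sum_range_le fun n => ?_
  refine le_trans ?_ (lintegral_mono fun x => ENNReal.sum_le_tsum (Finset.range n))
  induction n with
  | zero => simp
  | succ n ih =>
    simp_rw [Finset.sum_range_succ]
    exact (add_le_add_left ih _).trans (le_lintegral_add _ _)

end RescaledNS

end

/-! ### The Volterra inequality for `θ'` and the two estimates -/

noncomputable section

namespace RescaledNS

open MeasureTheory Set Filter Topology
open scoped ENNReal NNReal


theorem measurable_derivWithin_Ici_const (f : ℝ → ℝ) (c : ℝ) :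
    Measurable (derivWithin f (Ici c)) := by
  have e : derivWithin f (Ici c) = fun x =>
      if x < c then 0 else if x = c then derivWithin f (Ici c) c else deriv f x := by
    funext x
    split_ifs with h1 h2
    · exact derivWithin_zero_of_notMem_closure (by simpa using h1)
    · rw [h2]
    · exact derivWithin_of_mem_nhds (Ici_mem_nhds ((not_lt.1 h1).lt_of_ne (Ne.symm h2)))
  rw [e]
  exact Measurable.ite measurableSet_Iio measurable_const
    (Measurable.ite (measurableSet_singleton c) measurable_const (measurable_deriv f))

/-- Young's inequality `L¹ * L¹ ⊆ L¹` in time, by Tonelli's theorem with the kernel extended by zero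
to `τ ≤ 0`. -/
theorem lintegral_lintegral_heatKernel_le {g : ℝ → ℝ≥0∞} (hg : Measurable g) (T : ℝ) :
    ∫⁻ t in Ioo 0 T, ∫⁻ s in Ioo 0 t, ENNReal.ofReal (heatKernel (t - s)) * g s
      ≤ heatMass * ∫⁻ s in Ioo 0 T, g s := by
  set k : ℝ → ℝ≥0∞ := (Ioi 0).indicator fun τ => ENNReal.ofReal (heatKernel τ) with hk
  have hkm : Measurable k :=
    (ENNReal.measurable_ofReal.comp measurable_heatKernel).indicator measurableSet_Ioi
  calc ∫⁻ t in Ioo 0 T, ∫⁻ s in Ioo 0 t, ENNReal.ofReal (heatKernel (t - s)) * g s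
      ≤ ∫⁻ t in Ioo 0 T, ∫⁻ s in Ioo 0 T, k (t - s) * g s := by
        refine setLIntegral_mono' measurableSet_Ioo fun t ht => ?_
        calc _ = ∫⁻ s in Ioo 0 t, k (t - s) * g s := by
              refine setLIntegral_congr_fun measurableSet_Ioo fun s hs => ?_
              simp only [hk]
              rw [indicator_of_mem (mem_Ioi.2 (sub_pos.2 hs.2))]
          _ ≤ _ := lintegral_mono_set (Ioo_subset_Ioo_right ht.2.le)
    _ = ∫⁻ s in Ioo 0 T, ∫⁻ t in Ioo 0 T, k (t - s) * g s := by
        refine lintegral_lintegral_swap (Measurable.aemeasurable ?_)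
        exact (hkm.comp (measurable_fst.sub measurable_snd)).mul (hg.comp measurable_snd)
    _ ≤ ∫⁻ s in Ioo 0 T, heatMass * g s := by
        refine lintegral_mono fun s => ?_
        rw [lintegral_mul_const _ (show Measurable fun t => k (t - s) from
          hkm.comp (measurable_id.sub_const s))]
        refine mul_le_mul_left ((setLIntegral_le_lintegral _ _).trans (le_of_eq ?_)) _
        rw [lintegral_sub_right_eq_self k, hk, lintegral_indicator measurableSet_Ioi, heatMass]
    _ = _ := lintegral_const_mul _ hg

/-- Summation over the blocks of an estimate of Duhamel type. -/
theorem tsum_duhamel_le {W B J : ℕ → ℝ≥0∞} {N : ℕ → ℝ → ℝ≥0∞} {k R : ℝ → ℝ≥0∞} {δ i c : ℝ≥0∞}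
    {S : Set ℝ} (hW : ∀ m, W m ≠ ∞)
    (h : ∀ m, δ * B m ≤ i * (δ * J m) + ∫⁻ s in S, k s * (c * N m s))
    (hN : ∀ᵐ s ∂volume.restrict S, ∑' m, W m * N m s ≤ R s) :
    δ * ∑' m, W m * B m ≤ i * (δ * ∑' m, W m * J m) + ∫⁻ s in S, k s * (c * R s) := by
  calc δ * ∑' m, W m * B m = ∑' m, W m * (δ * B m) := by
        rw [← ENNReal.tsum_mul_left]
        exact tsum_congr fun m => by ring
    _ ≤ ∑' m, (i * (δ * (W m * J m)) + ∫⁻ s in S, k s * (c * (W m * N m s))) := by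
        refine ENNReal.tsum_le_tsum fun m => (mul_le_mul_right (h m) _).trans (le_of_eq ?_)
        rw [mul_add, ← lintegral_const_mul' _ _ (hW m)]
        congr 1
        · ring
        · exact lintegral_congr fun s => by ring
    _ = i * (δ * ∑' m, W m * J m) + ∑' m, ∫⁻ s in S, k s * (c * (W m * N m s)) := by
        rw [ENNReal.tsum_add, ENNReal.tsum_mul_left, ENNReal.tsum_mul_left]
    _ ≤ _ := by
        refine add_le_add_right ((tsum_lintegral_le _).trans (lintegral_mono_ae ?_)) _
        filter_upwards [hN] with s hs
        rw [ENNReal.tsum_mul_left, ENNReal.tsum_mul_left]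
        gcongr

section Estimates

variable {n : ℕ} {ε a lam T : ℝ} {v₀ : Field} {v : ℝ → Field} {q : ℝ → Freq → ℂ} {θ : ℝ → ℝ}

theorem ae_blockNorm_le_essSup {E : Type} [NormedAddCommGroup E] (f : ℝ → Freq → E) {t : ℝ}
    (ht : t ≤ T) :
    ∀ᵐ s ∂volume.restrict (Ioo 0 t), ∀ l,
      blockNorm l (f s) ≤ essSup (fun r => blockNorm l (f r)) (volume.restrict (Icc 0 T)) := by
  have h : ∀ᵐ s ∂volume.restrict (Icc 0 T), ∀ l,
      blockNorm l (f s) ≤ essSup (fun r => blockNorm l (f r)) (volume.restrict (Icc 0 T)) :=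
    ae_all_iff.2 fun l => ENNReal.ae_le_essSup _
  exact ae_restrict_of_ae_restrict_of_subset
    (Ioo_subset_Icc_self.trans (Icc_subset_Icc_right ht)) h

/-- A block of the quadratic term. -/
def lossBlock (ε a lam : ℝ) (θ : ℝ → ℝ) (v : ℝ → Field) (m : ℕ) (s : ℝ) : ℝ≥0∞ :=
  eLpNorm (lossConv (oscSize ε (wPhi a lam θ v s)) (fun η => ‖vPhi a lam θ v s η‖ₑ)) 2
    (freqMeasure.restrict (shell m))

theorem lossBlock_le (ε a lam : ℝ) (θ : ℝ → ℝ) (v : ℝ → Field) (m : ℕ) (s : ℝ) :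
    lossBlock ε a lam θ v m s ≤ ∑' p : ℕ × ℕ, lossCoeff m p.1 p.2 *
      (eLpNorm (oscSize ε (wPhi a lam θ v s)) 2 (freqMeasure.restrict (shell p.1))
        * blockNorm p.2 (vPhi a lam θ v s)) := by
  have h := eLpNorm_lossConv_le (measurable_oscSize ε (measurable_wPhi a lam θ v s))
    (measurable_vPhi a lam θ v s).enorm m
  simp_rw [eLpNorm_enorm] at h
  exact h

/-- The factor `w` is kept at time `s`, where its norm is `θ'(s)`; the factor `v` is replaced by an
envelope `G` of its blocks, later the essential supremum in time, which produces the norm of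
`L̃^∞_T(B^{7/2})`. -/
theorem tsum_weight_lossBlock_le (ε a lam : ℝ) (θ : ℝ → ℝ) (v : ℝ → Field) {s : ℝ}
    {G : ℕ → ℝ≥0∞} (hG : ∀ l, blockNorm l (vPhi a lam θ v s) ≤ G l) :
    ∑' m, weight (7 / 2) m * lossBlock ε a lam θ v m s
      ≤ prodConst * ((besovNorm (7 / 2) (comp 2 (wPhi a lam θ v s))
          + ENNReal.ofReal ε * besovNorm (7 / 2) (hor (wPhi a lam θ v s)))
        * ∑' l, weight (7 / 2) l * G l) := by
  set F : ℕ → ℝ≥0∞ := fun k => blockNorm k (comp 2 (wPhi a lam θ v s))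
    + ENNReal.ofReal ε * blockNorm k (hor (wPhi a lam θ v s)) with hF
  have hsum : ∑' k, weight (7 / 2) k * F k = besovNorm (7 / 2) (comp 2 (wPhi a lam θ v s))
      + ENNReal.ofReal ε * besovNorm (7 / 2) (hor (wPhi a lam θ v s)) := by
    rw [besovNorm, besovNorm, ← ENNReal.tsum_mul_left, ← ENNReal.tsum_add]
    exact tsum_congr fun k => by simp only [hF]; ring
  rw [← hsum]
  refine le_trans (ENNReal.tsum_le_tsum fun m => ?_) (tsum_weight_lossCoeff_mul_le F G)
  refine mul_le_mul_right ((lossBlock_le ε a lam θ v m s).trans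
    (ENNReal.tsum_le_tsum fun p => ?_)) _
  exact mul_le_mul_right (mul_le_mul' (eLpNorm_oscSize_le ε (measurable_wPhi a lam θ v s) p.1)
    (hG p.2)) _

theorem IsApproxSolution.ofReal_derivWithin_eq (h : IsApproxSolution n ε v₀ v q)
    (hl : IsAnalyticityLoss a lam ε v θ) (hε : 0 < ε) (hε1 : ε ≤ 1) {t : ℝ} (ht : 0 ≤ t)
    (hθ : lam * θ t ≤ a) :
    ENNReal.ofReal (derivWithin θ (Ici 0) t) = besovNorm (7 / 2) (comp 2 (wPhi a lam θ v t))
      + ENNReal.ofReal ε * besovNorm (7 / 2) (hor (wPhi a lam θ v t)) := by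
  obtain ⟨h1, h2⟩ := h.besovNorm_ne_top hε hε1 ht hθ
  rw [hl.derivWithin_eq ht, ENNReal.ofReal_add (by positivity) (by positivity),
    ENNReal.ofReal_mul hε.le, ENNReal.ofReal_toReal h1, ENNReal.ofReal_toReal h2]

theorem IsAnalyticityLoss.mul_le (hl : IsAnalyticityLoss a lam ε v θ) (hε : 0 ≤ ε)
    (hlam : 0 < lam) (hθ : θ T ≤ a / lam) {t : ℝ} (ht : 0 ≤ t) (htT : t ≤ T) :
    lam * θ t ≤ a := by
  rw [mul_comm, ← le_div_iff₀ hlam]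
  exact (hl.monotoneOn hε ht (ht.trans htT) htT).trans hθ

/-- The factors `1` give this bound the same shape as the horizontal one, where `ε` takes their
place, so that `tsum_duhamel_le` serves for both. -/
theorem IsApproxSolution.blockNorm_vertical_le (h : IsApproxSolution n ε v₀ v q)
    (hl : IsAnalyticityLoss a lam ε v θ) (hε : 0 < ε) (hε1 : ε ≤ 1) (hlam : 0 < lam)
    (hθ : θ T ≤ a / lam) {t : ℝ} (ht : 0 ≤ t) (htT : t ≤ T) (m : ℕ) :
    1 * blockNorm m (comp 2 (wPhi a lam θ v t))
      ≤ ENNReal.ofReal (initKernel t) * (1 * blockNorm m (comp 2 (wInit a v₀)))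
        + ∫⁻ s in Ioo 0 t,
          ENNReal.ofReal (heatKernel (t - s)) * (36 * lossBlock ε a lam θ v m s) := by
  refine h.block_le (projL 2) ENNReal.one_ne_top hlam.le ht (hl.nonneg hε.le ht)
    (fun s hs hst => hl.monotoneOn hε.le hs ht hst) (hl.mul_le hε.le hlam hθ ht htT) ?_ m
  intro s hs
  filter_upwards [h.forcing_le hε hε1 hs] with ξ h1 h2 h3
  rw [one_mul]
  exact (h1 h2 h3).1

theorem IsApproxSolution.blockNorm_horizontal_le (h : IsApproxSolution n ε v₀ v q)
    (hl : IsAnalyticityLoss a lam ε v θ) (hε : 0 < ε) (hε1 : ε ≤ 1) (hlam : 0 < lam)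
    (hθ : θ T ≤ a / lam) {t : ℝ} (ht : 0 ≤ t) (htT : t ≤ T) (m : ℕ) :
    ENNReal.ofReal ε * blockNorm m (hor (wPhi a lam θ v t))
      ≤ ENNReal.ofReal (initKernel t) * (ENNReal.ofReal ε * blockNorm m (hor (wInit a v₀)))
        + ∫⁻ s in Ioo 0 t,
          ENNReal.ofReal (heatKernel (t - s)) * (36 * lossBlock ε a lam θ v m s) := by
  refine h.block_le horL ENNReal.ofReal_ne_top hlam.le ht (hl.nonneg hε.le ht)
    (fun s hs hst => hl.monotoneOn hε.le hs ht hst) (hl.mul_le hε.le hlam hθ ht htT) ?_ m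
  intro s hs
  filter_upwards [h.forcing_le hε hε1 hs] with ξ h1 h2 h3
  exact (h1 h2 h3).2

/-- The Volterra inequality satisfied by the derivative of `θ`. -/
theorem IsApproxSolution.ofReal_derivWithin_le (h : IsApproxSolution n ε v₀ v q)
    (hl : IsAnalyticityLoss a lam ε v θ) (hε : 0 < ε) (hε1 : ε ≤ 1) (hlam : 0 < lam)
    (hθ : θ T ≤ a / lam) {t : ℝ} (ht : 0 ≤ t) (htT : t ≤ T) :
    ENNReal.ofReal (derivWithin θ (Ici 0) t)
      ≤ ENNReal.ofReal (initKernel t) * (ENNReal.ofReal ε * besovNorm (7 / 2) (hor (wInit a v₀))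
          + besovNorm (7 / 2) (comp 2 (wInit a v₀)))
        + 2 * ∫⁻ s in Ioo 0 t, ENNReal.ofReal (heatKernel (t - s)) * (36 * (prodConst *
          (ENNReal.ofReal (derivWithin θ (Ici 0) s) * tildeNorm (7 / 2) T (vPhi a lam θ v)))) := by
  have hN : ∀ᵐ s ∂volume.restrict (Ioo 0 t),
      ∑' m, weight (7 / 2) m * lossBlock ε a lam θ v m s ≤ prodConst *
        (ENNReal.ofReal (derivWithin θ (Ici 0) s) * tildeNorm (7 / 2) T (vPhi a lam θ v)) := by
    filter_upwards [ae_blockNorm_le_essSup (vPhi a lam θ v) htT, ae_restrict_mem measurableSet_Ioo]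
      with s h1 hs
    rw [h.ofReal_derivWithin_eq hl hε hε1 hs.1.le
      (hl.mul_le hε.le hlam hθ hs.1.le (hs.2.le.trans htT))]
    exact tsum_weight_lossBlock_le ε a lam θ v h1
  -- The vertical and the rescaled horizontal parts have the same forcing bound; their sum on the
  -- left is `θ'(t)`, whence the factor 2 on the integral.
  have h3 := tsum_duhamel_le (weight_ne_top (7 / 2))
    (h.blockNorm_vertical_le hl hε hε1 hlam hθ ht htT) hN
  have h4 := tsum_duhamel_le (weight_ne_top (7 / 2))
    (h.blockNorm_horizontal_le hl hε hε1 hlam hθ ht htT) hN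
  rw [one_mul, one_mul] at h3
  rw [h.ofReal_derivWithin_eq hl hε hε1 ht (hl.mul_le hε.le hlam hθ ht htT)]
  refine (add_le_add h3 h4).trans (le_of_eq ?_)
  rw [← besovNorm, ← besovNorm]
  ring

/-- The constant of the estimates. -/
def estimateConst : ℝ≥0 := (72 * prodConst * heatMass).toNNReal

theorem coe_estimateConst : (estimateConst : ℝ≥0∞) = 72 * prodConst * heatMass :=
  ENNReal.coe_toNNReal (ENNReal.mul_ne_top (ENNReal.mul_ne_top (by norm_num) prodConst_ne_top)
    heatMass_ne_top)

/-- Integration of the Volterra inequality over `[0, T]`: the data kernel has mass at most 3, the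
heat kernel contributes its mass, and `θ'` integrates to `θ(T)` on both sides. The constant 72 is `2
· 36`. -/
theorem IsApproxSolution.ofReal_loss_le (h : IsApproxSolution n ε v₀ v q)
    (hl : IsAnalyticityLoss a lam ε v θ) (hε : 0 < ε) (hε1 : ε ≤ 1) (hlam : 0 < lam)
    (hT : 0 ≤ T) (hθ : θ T ≤ a / lam) :
    ENNReal.ofReal (θ T) ≤
      3 * (ENNReal.ofReal ε * besovNorm (7 / 2) (hor (wInit a v₀))
          + besovNorm (7 / 2) (comp 2 (wInit a v₀)))
        + estimateConst * tildeNorm (7 / 2) T (vPhi a lam θ v) * ENNReal.ofReal (θ T) := by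
  set I := ENNReal.ofReal ε * besovNorm (7 / 2) (hor (wInit a v₀))
    + besovNorm (7 / 2) (comp 2 (wInit a v₀))
  set G := tildeNorm (7 / 2) T (vPhi a lam θ v)
  have hd : Measurable fun t => ENNReal.ofReal (derivWithin θ (Ici 0) t) :=
    ENNReal.measurable_ofReal.comp (measurable_derivWithin_Ici_const θ 0)
  have hi : Measurable fun t => ENNReal.ofReal (initKernel t) :=
    ENNReal.measurable_ofReal.comp measurable_initKernel
  calc ENNReal.ofReal (θ T) = ∫⁻ t in Ioo 0 T, ENNReal.ofReal (derivWithin θ (Ici 0) t) :=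
        (hl.lintegral_eq hε.le hT).symm
    _ ≤ ∫⁻ t in Ioo 0 T, (ENNReal.ofReal (initKernel t) * I + 2 * ∫⁻ s in Ioo 0 t,
          ENNReal.ofReal (heatKernel (t - s)) *
            (36 * (prodConst * (ENNReal.ofReal (derivWithin θ (Ici 0) s) * G)))) :=
        setLIntegral_mono' measurableSet_Ioo fun t ht =>
          h.ofReal_derivWithin_le hl hε hε1 hlam hθ ht.1.le ht.2.le
    _ = (∫⁻ t in Ioo 0 T, ENNReal.ofReal (initKernel t)) * I + 2 * ∫⁻ t in Ioo 0 T,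
          ∫⁻ s in Ioo 0 t, ENNReal.ofReal (heatKernel (t - s)) *
            (36 * (prodConst * (ENNReal.ofReal (derivWithin θ (Ici 0) s) * G))) := by
        rw [lintegral_add_left (hi.mul_const I), lintegral_mul_const _ hi,
          lintegral_const_mul' _ _ (by norm_num)]
    _ ≤ 3 * I + 2 * (heatMass * ∫⁻ s in Ioo 0 T,
          36 * (prodConst * (ENNReal.ofReal (derivWithin θ (Ici 0) s) * G))) := by
        refine add_le_add (mul_le_mul_left ((lintegral_mono_set Ioo_subset_Ioi_self).trans
          lintegral_initKernel_le) _) (mul_le_mul_right (lintegral_lintegral_heatKernel_le ?_ T) _)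
        exact ((hd.mul_const G).const_mul _).const_mul _
    _ = _ := by
        rw [lintegral_const_mul' _ _ (by norm_num), lintegral_const_mul' _ _ prodConst_ne_top,
          lintegral_mul_const _ hd, hl.lintegral_eq hε.le hT, coe_estimateConst]
        ring

/-- On each block both factors of the quadratic term are replaced by their suprema in time before
the summation over blocks. Here 72 is 36 times the 2 from `|w³| + ε|w^h| ≤ 2|v|`. -/
theorem IsApproxSolution.tildeNorm_vertical_le (h : IsApproxSolution n ε v₀ v q)
    (hl : IsAnalyticityLoss a lam ε v θ) (hε : 0 < ε) (hε1 : ε ≤ 1) (hlam : 0 < lam)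
    (hθ : θ T ≤ a / lam) :
    tildeNorm (7 / 2) T (fun t => comp 2 (wPhi a lam θ v t)) ≤
      ENNReal.ofReal (Real.exp (1 / 4)) * besovNorm (7 / 2) (comp 2 (wInit a v₀))
        + estimateConst * tildeNorm (7 / 2) T (vPhi a lam θ v) ^ 2 := by
  set G : ℕ → ℝ≥0∞ := fun l =>
    essSup (fun r => blockNorm l (vPhi a lam θ v r)) (volume.restrict (Icc 0 T)) with hG
  set R : ℕ → ℝ≥0∞ := fun m => ∑' p : ℕ × ℕ, lossCoeff m p.1 p.2 * (2 * G p.1 * G p.2) with hR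
  have hblock : ∀ m, essSup (fun t => blockNorm m (comp 2 (wPhi a lam θ v t)))
      (volume.restrict (Icc 0 T)) ≤ ENNReal.ofReal (Real.exp (1 / 4)) *
        blockNorm m (comp 2 (wInit a v₀)) + heatMass * (36 * R m) := by
    intro m
    refine essSup_le_of_ae_le _ ?_
    filter_upwards [ae_restrict_mem measurableSet_Icc] with t ht
    have h1 := h.blockNorm_vertical_le hl hε hε1 hlam hθ ht.1 ht.2 m
    rw [one_mul, one_mul] at h1
    have hm := measurable_heatKernel
    refine h1.trans (add_le_add (mul_le_mul_left
      (ENNReal.ofReal_le_ofReal (initKernel_le t)) _) ?_)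
    calc _ ≤ ∫⁻ s in Ioo 0 t, ENNReal.ofReal (heatKernel (t - s)) * (36 * R m) := by
          refine lintegral_mono_ae ?_
          filter_upwards [ae_blockNorm_le_essSup (vPhi a lam θ v) ht.2] with s hs
          refine mul_le_mul_right (mul_le_mul_right ((lossBlock_le ε a lam θ v m s).trans
            (ENNReal.tsum_le_tsum fun p => ?_)) _) _
          exact mul_le_mul_right (mul_le_mul' ((eLpNorm_oscSize_wPhi_le hε1 a lam θ v s p.1).trans
            (mul_le_mul_right (hs p.1) _)) (hs p.2)) _
      _ = (∫⁻ s in Ioo 0 t, ENNReal.ofReal (heatKernel (t - s))) * (36 * R m) :=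
          lintegral_mul_const _ (by fun_prop)
      _ ≤ _ := mul_le_mul_left (lintegral_heatKernel_sub_le t) _
  calc _ ≤ ∑' m, weight (7 / 2) m * (ENNReal.ofReal (Real.exp (1 / 4)) *
        blockNorm m (comp 2 (wInit a v₀)) + heatMass * (36 * R m)) :=
        ENNReal.tsum_le_tsum fun m => mul_le_mul_right (hblock m) _
    _ = ENNReal.ofReal (Real.exp (1 / 4)) * besovNorm (7 / 2) (comp 2 (wInit a v₀))
        + heatMass * 36 * ∑' m, weight (7 / 2) m * R m := by
        rw [besovNorm, ← ENNReal.tsum_mul_left, ← ENNReal.tsum_mul_left, ← ENNReal.tsum_add]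
        exact tsum_congr fun m => by ring
    _ ≤ ENNReal.ofReal (Real.exp (1 / 4)) * besovNorm (7 / 2) (comp 2 (wInit a v₀))
        + heatMass * 36 * (prodConst * ((∑' k, weight (7 / 2) k * (2 * G k)) *
          ∑' l, weight (7 / 2) l * G l)) := by
        gcongr
        exact tsum_weight_lossCoeff_mul_le (fun k => 2 * G k) G
    _ = _ := by
        have e : ∑' k, weight (7 / 2) k * (2 * G k) = 2 * ∑' k, weight (7 / 2) k * G k := by
          rw [← ENNReal.tsum_mul_left]
          exact tsum_congr fun k => by ring
        rw [e, coe_estimateConst, tildeNorm]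
        ring

end Estimates

end RescaledNS

end

open RescaledNS in
open scoped ENNReal NNReal in
theorem proposition2p1 :
    ∃ C : ℝ≥0, ∀ (a ε lam T : ℝ) (n : ℕ) (v₀ : Field) (v : ℝ → Field) (q : ℝ → Freq → ℂ)
      (θ : ℝ → ℝ),
      0 < a → 0 < ε → ε ≤ 1 → 0 < lam → 0 ≤ T →
      DivFree v₀ → IsApproxSolution n ε v₀ v q → IsAnalyticityLoss a lam ε v θ →
      θ T ≤ a / lam →
      (ENNReal.ofReal (θ T) ≤
          3 * (ENNReal.ofReal ε * besovNorm (7 / 2) (hor (wInit a v₀))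
                + besovNorm (7 / 2) (comp 2 (wInit a v₀)))
            + C * tildeNorm (7 / 2) T (vPhi a lam θ v) * ENNReal.ofReal (θ T)) ∧
      (tildeNorm (7 / 2) T (fun t => comp 2 (wPhi a lam θ v t)) ≤
          ENNReal.ofReal (Real.exp (1 / 4)) * besovNorm (7 / 2) (comp 2 (wInit a v₀))
            + C * tildeNorm (7 / 2) T (vPhi a lam θ v) ^ 2) :=
  ⟨estimateConst, fun _ _ _ _ _ _ _ _ _ _ hε hε1 hlam hT _ h hl hθ =>
    ⟨h.ofReal_loss_le hl hε hε1 hlam hT hθ, h.tildeNorm_vertical_le hl hε hε1 hlam hθ⟩⟩
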